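/- **Conventions.** For $r>0$ the mean over the sphere $S_m(r)=\{z\in\mathbb{C}^m:\|z\|=r\}$ is taken with respect to the rotation-invariant probability measure, i.e. the one induced by $\eta_m=d^c\log\|z\|^2\wedge(dd^c\log\|z\|^2)^{m-1}$. For a meromorphic function $f$ on $\mathbb{C}^m$ let $f=f_0/f_1$ be a reduced representation ($f_0,f_1$ entire, $f_1\not\equiv0$, and the only common factors of $f_0,f_1$ are units), and put $$m(r,f)=\int_{S_m(r)}\log^+|f|\,\eta_m,\qquad T_f(r)=\int_{S_m(r)}\log\bigl(|f_0|^2+|f_1|^2\bigr)^{1/2}\eta_m-\int_{S_m(1)}\log\bigl(|f_0|^2+|f_1|^2\bigr)^{1/2}\eta_m .$$ The order of $f$ is $\limsup_{r\to\infty}\log^+T_f(r)/\log r$. A measurable set $E\subset\mathbb{R}$ has logarithmic density one if $\frac1{\log r}\int_{E\cap[1,r]}\frac{dt}{t}\to1$ as $r\to\infty$. We say that $S(r)=o(T(r))$ on a set of logarithmic density one if there is such a set $E$ with $S(r)=o(T(r))$ as $r\to\infty$, $r\in E$. A meromorphic function $a$ is small with respect to $w$ if $T_a(r)=o(T_w(r))$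 on a set of logarithmic density one. A $q$-difference polynomial in $w$ (with diagonal shifts) is a finite sum $$P(z,w)=\sum_{\lambda\in I}a_\lambda(z)\,w(z)^{l_{\lambda,0}}w(q_{\lambda,1}z)^{l_{\lambda,1}}\cdots w(q_{\lambda,i}z)^{l_{\lambda,i}},$$ with nonnegative integer exponents and meromorphic coefficients $a_\lambda$, where each $q_s\in\mathbb{C}\setminus\{0\}$ acts by $q_sz=(q_sz_1,\dots,q_sz_m)$ (that is, it stands for the vector $(q_s,\dots,q_s)$). The terms are understood with like monomials collected, and the total degree is the degree in $w(z)$ and its shifts $w(q_sz)$ together. **Theorem.** Let $w$ be a nonconstant meromorphic function of order zero on $\mathbb{C}^m$, and let $U(z,w)$, $P(z,w)$, $Q(z,w)$ be $q$-difference polynomials in $w$ of the above form, all of whose coefficients are small with respect to $w$, such that $$U(z,w)\,P(z,w)=Q(z,w).$$ Assume that $U$ has total degree $n$, that $Q$ has total degree at most $n$, and that $U$ contains exactly one term of total degree $n$ (with a coefficient that is not identically zero). Then $\log^+|P(z,w)|$ is integrable over $S_m(r)$ for every $r>0$, and $$m(r,P(z,w))=o(T_w(r))$$ on a set of logarithmic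 density one. -/

import Mathlib

open MeasureTheory Filter Asymptotics

open scoped ENNReal

noncomputable section

/-- The space `ℂ^m` with its Hermitian norm `‖z‖ = (|z₁|² + ⋯ + |z_m|²)^{1/2}`. -/
abbrev CSpace (m : ℕ) : Type := EuclideanSpace ℂ (Fin m)

/-! ### Entire and meromorphic functions on `ℂ^m` -/

/-- The algebra of entire (holomorphic) functions on `ℂ^m`. -/
def entireSubalgebra (m : ℕ) : Subalgebra ℂ (CSpace m → ℂ) where
  carrier := {f | AnalyticOnNhd ℂ f Set.univ}
  mul_mem' hf hg := AnalyticOnNhd.mul hf hg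
  add_mem' hf hg := AnalyticOnNhd.add hf hg
  algebraMap_mem' _ := analyticOnNhd_const

/-- The type of entire functions on `ℂ^m`. -/
abbrev Entire (m : ℕ) : Type := ↥(entireSubalgebra m)

instance instNoZeroDivisorsEntire (m : ℕ) : NoZeroDivisors (Entire m) where
  eq_zero_or_eq_zero_of_mul_eq_zero := by
    intro f g hfg
    by_cases hf : f = 0
    · exact Or.inl hf
    right
    obtain ⟨z, hz⟩ : ∃ z, f.1 z ≠ 0 := by
      by_contra hne
      push Not at hne
      exact hf (Subtype.ext (funext hne))
    have hcont : ContinuousAt f.1 z := (f.2 z (Set.mem_univ z)).continuousAt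
    have hev : g.1 =ᶠ[nhds z] (0 : CSpace m → ℂ) := by
      filter_upwards [hcont.eventually_ne hz] with y hy
      have h1 : f.1 y * g.1 y = 0 := congrFun (congrArg Subtype.val hfg) y
      simpa [hy] using h1
    exact Subtype.ext
      (AnalyticOnNhd.eq_of_eventuallyEq g.2 (entireSubalgebra m).zero_mem hev)

instance instIsDomainEntire (m : ℕ) : IsDomain (Entire m) :=
  NoZeroDivisors.to_isDomain _

/-- The field of meromorphic functions on `ℂ^m`: every meromorphic function on `ℂ^m` is globally
a quotient of two entire functions, so this is the field of fractions of the entire functions. -/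
abbrev Mero (m : ℕ) : Type := FractionRing (Entire m)

open scoped Classical in
/-- The value at `z` of a meromorphic function `f`: if `f = g / h` with `g`, `h` entire and
`h z ≠ 0`, it is `g z / h z` (see `Mero.val_eq`). At the points where no such representation
exists (poles and points of indeterminacy) the value is set to be `0`. -/
def Mero.val {m : ℕ} (f : Mero m) (z : CSpace m) : ℂ :=
  if H : ∃ p : Entire m × Entire m,
      f = algebraMap (Entire m) (Mero m) p.1 / algebraMap (Entire m) (Mero m) p.2 ∧
        p.2.1 z ≠ 0 then
    H.choose.1.1 z / H.choose.2.1 z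
  else 0

/-- The value of a meromorphic function does not depend on the representation. -/
theorem Mero.val_eq {m : ℕ} (f : Mero m) (g h : Entire m)
    (hf : f = algebraMap (Entire m) (Mero m) g / algebraMap (Entire m) (Mero m) h)
    (z : CSpace m) (hz : h.1 z ≠ 0) : Mero.val f z = g.1 z / h.1 z := by
  have H : ∃ p : Entire m × Entire m,
      f = algebraMap (Entire m) (Mero m) p.1 / algebraMap (Entire m) (Mero m) p.2 ∧
        p.2.1 z ≠ 0 := ⟨(g, h), hf, hz⟩
  have hinj : Function.Injective (algebraMap (Entire m) (Mero m)) :=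
    IsFractionRing.injective _ _
  have hne : ∀ k : Entire m, k.1 z ≠ 0 → algebraMap (Entire m) (Mero m) k ≠ 0 := by
    intro k hk h0
    have hk0 : k = 0 := hinj (by rw [h0, map_zero])
    exact hk (by rw [hk0]; rfl)
  obtain ⟨hs1, hs2⟩ := H.choose_spec
  unfold Mero.val
  rw [dif_pos H, div_eq_div_iff hs2 hz]
  have heq := hs1.symm.trans hf
  rw [div_eq_div_iff (hne _ hs2) (hne _ hz), ← map_mul, ← map_mul] at heq
  exact congrFun (congrArg Subtype.val (hinj heq)) z

/-- The ring endomorphism `f(z) ↦ f(qz)` of the entire functions, for `q ∈ ℂ \ {0}`. -/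
def Entire.dilate {m : ℕ} (q : ℂˣ) : Entire m →+* Entire m where
  toFun f := ⟨fun z => f.1 ((q : ℂ) • z), fun z _ =>
    (f.2 ((q : ℂ) • z) (Set.mem_univ _)).comp
      (((q : ℂ) • ContinuousLinearMap.id ℂ (CSpace m)).analyticAt z)⟩
  map_one' := rfl
  map_mul' _ _ := rfl
  map_zero' := rfl
  map_add' _ _ := rfl

theorem Entire.dilate_injective {m : ℕ} (q : ℂˣ) :
    Function.Injective (Entire.dilate (m := m) q) := by
  intro f g hfg
  refine Subtype.ext (funext fun z => ?_)
  have h1 : f.1 ((q : ℂ) • (((q⁻¹ : ℂˣ) : ℂ) • z)) = g.1 ((q : ℂ) • (((q⁻¹ : ℂˣ) : ℂ) • z)) :=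
    congrFun (congrArg Subtype.val hfg) (((q⁻¹ : ℂˣ) : ℂ) • z)
  rwa [smul_smul, Units.mul_inv, one_smul] at h1

/-- The shift `w(z) ↦ w(qz)` on meromorphic functions, where `q ∈ ℂ \ {0}` stands for the
diagonal vector `(q, …, q) ∈ ℂ^m \ {0}`. -/
def Mero.shift {m : ℕ} (q : ℂˣ) : Mero m →+* Mero m :=
  IsFractionRing.map (Entire.dilate_injective (m := m) q)

/-- A `q`-difference polynomial with diagonal shifts: a finite sum of terms
`a(z) w(q₁z)^{l₁} ⋯ w(q_kz)^{l_k}` with meromorphic `a`. The variable `X q` stands for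
`w(qz)`; in particular `X 1` stands for `w(z)`. -/
abbrev QDiffPoly (m : ℕ) : Type := MvPolynomial ℂˣ (Mero m)

/-- The meromorphic function `P(z, w)`, obtained by putting `w(qz)` for `X q`. -/
def QDiffPoly.subst {m : ℕ} (P : QDiffPoly m) (w : Mero m) : Mero m :=
  MvPolynomial.eval (fun q => Mero.shift q w) P

/-! ### Nevanlinna functions -/

/-- The rotation invariant probability measure on the unit sphere of `ℂ^m` (for `m ≥ 1`), that is,
the measure induced there by the form `d^c log ‖z‖² ∧ (dd^c log ‖z‖²)^{m-1}`. -/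
def sphereMeasure (m : ℕ) : Measure (Metric.sphere (0 : CSpace m) 1) :=
  ((volume : Measure (CSpace m)).toSphere Set.univ)⁻¹ • (volume : Measure (CSpace m)).toSphere

/-- The mean of `u` over the sphere `‖z‖ = r`. -/
def sphereMean {m : ℕ} (u : CSpace m → ℝ) (r : ℝ) : ℝ :=
  ∫ ξ : Metric.sphere (0 : CSpace m) 1, u (r • (ξ : CSpace m)) ∂(sphereMeasure m)

/-- The proximity function `m(r, f)`, the mean of `log⁺ |f|` over the sphere `‖z‖ = r`. -/
def proximity {m : ℕ} (f : Mero m) (r : ℝ) : ℝ :=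
  sphereMean (fun z => Real.posLog ‖Mero.val f z‖) r

/-- `(f₀, f₁)` is a reduced representation of the meromorphic function `f`: `f = f₀ / f₁` with
entire functions `f₀`, `f₁` whose only common factors are units. -/
structure IsReducedRep {m : ℕ} (f : Mero m) (f₀ f₁ : Entire m) : Prop where
  den_ne_zero : f₁ ≠ 0
  eq_div : f = algebraMap (Entire m) (Mero m) f₀ / algebraMap (Entire m) (Mero m) f₁
  isRelPrime : IsRelPrime f₀ f₁

/-- The characteristic function `T(r)` computed from a representation `(f₀, f₁)`: the mean of
`log (|f₀|² + |f₁|²)^{1/2}` over `‖z‖ = r` minus its mean over `‖z‖ = 1`. -/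
def characteristic {m : ℕ} (f₀ f₁ : Entire m) (r : ℝ) : ℝ :=
  sphereMean (fun z => Real.log (Real.sqrt (‖f₀.1 z‖ ^ 2 + ‖f₁.1 z‖ ^ 2))) r -
    sphereMean (fun z => Real.log (Real.sqrt (‖f₀.1 z‖ ^ 2 + ‖f₁.1 z‖ ^ 2))) 1

/-- The order `limsup_{r → ∞} log⁺ T(r) / log r` of a growth function `T`. -/
def growthOrder (T : ℝ → ℝ) : ℝ≥0∞ :=
  limsup (fun r : ℝ => ENNReal.ofReal (Real.posLog (T r) / Real.log r)) atTop

/-- `E` is a (measurable) set of logarithmic density one: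
`(log r)⁻¹ ∫_{E ∩ [1, r]} dt / t → 1` as `r → ∞`. -/
def HasLogDensityOne (E : Set ℝ) : Prop :=
  MeasurableSet E ∧
    Tendsto (fun r : ℝ => (∫ t in E ∩ Set.Icc 1 r, t⁻¹) / Real.log r) atTop (nhds 1)

/-- `S(r) = o(T(r))` as `r → ∞` on a set of logarithmic density one. -/
def IsLittleOLogDensityOne (S T : ℝ → ℝ) : Prop :=
  ∃ E : Set ℝ, HasLogDensityOne E ∧ S =o[atTop ⊓ 𝓟 E] T

/-- The meromorphic function `a` is small with respect to the growth function `T`: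
`T_a(r) = o(T(r))` on a set of logarithmic density one. -/
def IsSmallFor {m : ℕ} (a : Mero m) (T : ℝ → ℝ) : Prop :=
  ∃ a₀ a₁ : Entire m, IsReducedRep a a₀ a₁ ∧ IsLittleOLogDensityOne (characteristic a₀ a₁) T

end

/-! The argument is Clunie's lemma, with a q-difference estimate in place of the lemma on the
logarithmic derivative.

Pointwise part. Let B bound the moduli of all coefficients, the reciprocal of the leading
coefficient of U, and the ratios |w(qz)/w(z)| and their inverses. If |w(z)| is at most a suitable
power of B times a constant, then P is bounded termwise by a power of B. Otherwise the unique term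
of degree n dominates U, so |U| is at least a multiple of |w|^n over a power of B, while |Q| is at
most a power of B times |w|^n; again |P| = |Q/U| is bounded by a power of B (`exists_norm_eval_le`).
Taking B to be the exponential of a sum of terms log⁺|a| and |log|w(qz)/w(z)|| gives a linear bound
for log⁺|P| (`exists_posLog_subst_le`), which is then integrated. The coefficients contribute o(T)
by the first main theorem.

The shifts. Write w = f₀/f₁ and restrict to a complex line through 0. On the disc of radius R = Kr,
split each fᵢ into a zero-free factor and a polynomial of zeros. The log-ratio of the zero-free
factors is harmonic, so passing from z to qz changes it by O(1/K) times its mean modulus on |z| = R.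
Each zero costs O(1) in the mean, and by Jensen the number of zeros is at most the growth of the
logarithmic mean from R to LR, divided by log L (`circleAverage_abs_log_quotient_dilate_le`).
Averaging over lines, the mean of |log|w(qz)/w(z)|| is at most (O(1/K) + O(1/log L)) (T(LKr) + O(1))
(`sphereMean_absLogDilate_le`).

Order zero. As log T(r) = o(log r), the inequality T(LKr) ≤ 2T(r) holds, up to bounded terms in T,
off a set of logarithmic density zero (`hasLogDensityOne_of_monotone`). Since K and L are arbitrary,
each ε has its own set of density one, and a diagonal choice merges these sets
(`isLittleOLogDensityOne_of_forall`).

The growth of w is measured by `maxLogMean`, the mean of max(log|f₀|, log|f₁|), which is within O(1)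
of T. It is increasing by Cartan's identity and tends to infinity because w is not constant. -/

/-! ### One variable: circle means, Jensen's formula and zero counting. -/

open Metric Real in
/-- The circle mean of `log |z - a|` over `|z| = r` is `log (max r |a|)`. -/
theorem circleAverage_log_norm_sub_eq_log_max (a : ℂ) {r : ℝ} (hr : 0 < r) :
    circleAverage (fun z => log ‖z - a‖) 0 r = log (max r ‖a‖) := by
  rw [circleAverage_log_norm_sub_const_eq_log_radius_add_posLog hr.ne', zero_sub, norm_neg,
    posLog_eq_log_max_one (by positivity), ← log_mul hr.ne' (by positivity)]
  congr 1
  rw [mul_max_of_nonneg _ _ hr.le, mul_one, mul_inv_cancel_left₀ hr.ne']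

open Metric Real in
theorem circleIntegrable_log_norm_of_analyticOnNhd {f : ℂ → ℂ} {r : ℝ}
    (hf : AnalyticOnNhd ℂ f (sphere 0 |r|)) :
    CircleIntegrable (fun z => log ‖f z‖) 0 r :=
  MeromorphicOn.circleIntegrable_log_norm hf.meromorphicOn

-- With the convention `Real.log 0 = 0`, identities and bounds for log|f| fail at the zeros. These
-- are countably many, so circle means do not see them.
open Metric Real in
theorem circleAverage_mono_off_countable {f g : ℂ → ℝ} {r : ℝ} (hr : 0 < r) {S : Set ℂ}
    (hS : S.Countable) (hf : CircleIntegrable f 0 r) (hg : CircleIntegrable g 0 r)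
    (h : ∀ z, ‖z‖ = r → z ∉ S → f z ≤ g z) : circleAverage f 0 r ≤ circleAverage g 0 r := by
  unfold circleAverage
  refine smul_le_smul_of_nonneg_left ?_ (by positivity)
  refine intervalIntegral.integral_mono_ae (by positivity) hf hg ?_
  filter_upwards [(hS.preimage_circleMap 0 hr.ne').ae_notMem volume] with θ hθ
  exact h _ (by simp [abs_of_pos hr]) hθ

open Metric Real in
theorem circleAverage_congr_off_countable {f g : ℂ → ℝ} {r : ℝ} (hr : 0 < r) {S : Set ℂ}
    (hS : S.Countable) (h : ∀ z, ‖z‖ = r → z ∉ S → f z = g z) :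
    circleAverage f 0 r = circleAverage g 0 r := by
  unfold circleAverage
  congr 1
  refine intervalIntegral.integral_congr_ae ?_
  filter_upwards [(hS.preimage_circleMap 0 hr.ne').ae_notMem volume] with θ hθ _
  exact h _ (by simp [abs_of_pos hr]) hθ

open Metric Real in
/-- The oscillation of `log |z - a|` around its mean over `|z| = r` is bounded independently of
`a` and `r`. -/
theorem circleAverage_abs_log_norm_sub_le (a : ℂ) {r : ℝ} (hr : 0 < r) :
    circleAverage (fun z => |log ‖z - a‖ - log (max r ‖a‖)|) 0 r ≤ 2 * log 2 := by
  have hM : 0 < max r ‖a‖ := lt_max_of_lt_left hr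
  have hint : CircleIntegrable (fun z => log ‖z - a‖) 0 r :=
    circleIntegrable_log_norm_of_analyticOnNhd (fun z _ => by fun_prop)
  have hint' : CircleIntegrable (fun z => log ‖z - a‖ - log (max r ‖a‖)) 0 r :=
    hint.sub (circleIntegrable_const _ _ _)
  have hint2 : CircleIntegrable
      (fun z => 2 * log 2 - (log ‖z - a‖ - log (max r ‖a‖))) 0 r :=
    (circleIntegrable_const _ _ _).sub hint'
  calc circleAverage (fun z => |log ‖z - a‖ - log (max r ‖a‖)|) 0 r
      ≤ circleAverage (fun z => 2 * log 2 - (log ‖z - a‖ - log (max r ‖a‖))) 0 r := by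
        refine circleAverage_mono_off_countable hr (Set.countable_singleton a) hint'.abs hint2 ?_
        intro z hz hza
        have h0 : z - a ≠ 0 := sub_ne_zero.2 hza
        -- A one-sided bound suffices: x ≤ log 2 gives |x| ≤ 2 log 2 - x, and this x has mean zero
        -- by the exact formula for the mean.
        have hup : log ‖z - a‖ - log (max r ‖a‖) ≤ log 2 := by
          rw [sub_le_iff_le_add, ← log_mul two_ne_zero hM.ne']
          apply log_le_log (norm_pos_iff.2 h0)
          have := norm_sub_le z a
          have h1 := le_max_left r ‖a‖
          have h2 := le_max_right r ‖a‖
          linarith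
        rw [abs_le]
        constructor <;> linarith [log_pos one_lt_two]
    _ = 2 * log 2 := by
        rw [circleAverage_fun_sub (circleIntegrable_const _ _ _) hint', circleAverage_const,
          circleAverage_fun_sub hint (circleIntegrable_const _ _ _), circleAverage_const,
          circleAverage_log_norm_sub_eq_log_max a hr]
        ring

open Metric in
/-- Factorization of an entire function over a closed disc. -/
theorem exists_eq_prod_mul_of_analyticOnNhd {f : ℂ → ℂ} (hf : AnalyticOnNhd ℂ f Set.univ)
    (hne : ∃ z, f z ≠ 0) {R : ℝ} (hR : 0 < R) :
    ∃ (F : Finset ℂ) (n : ℂ → ℕ) (g : ℂ → ℂ), AnalyticOnNhd ℂ g (closedBall 0 R) ∧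
      (∀ z ∈ closedBall 0 R, g z ≠ 0) ∧ (∀ a ∈ F, ‖a‖ ≤ R) ∧
      ∀ z ∈ closedBall 0 R, f z = (∏ a ∈ F, (z - a) ^ n a) * g z := by
  have hfU : AnalyticOnNhd ℂ f (closedBall 0 R) := hf.mono (Set.subset_univ _)
  have htop : ∀ u, meromorphicOrderAt f u ≠ ⊤ := by
    obtain ⟨z₀, hz₀⟩ := hne
    intro u
    refine MeromorphicOn.meromorphicOrderAt_ne_top_of_isPreconnected (x := z₀) hf.meromorphicOn
      isPreconnected_univ (Set.mem_univ _) (Set.mem_univ _) ?_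
    rw [(hf z₀ (Set.mem_univ _)).meromorphicOrderAt_eq, 
      (hf z₀ (Set.mem_univ _)).analyticOrderAt_eq_zero.2 hz₀]
    simp
  set D := MeromorphicOn.divisor f (closedBall 0 R) with hD
  have hfin : D.support.Finite := D.finiteSupport (isCompact_closedBall 0 R)
  obtain ⟨g, hg, hg0, hfg⟩ := MeromorphicOn.extract_zeros_poles hfU.meromorphicOn
    (fun u => htop u) hfin
  have hDnn : ∀ u, 0 ≤ D u := fun u => MeromorphicOn.AnalyticOnNhd.divisor_nonneg hfU u
  refine ⟨hfin.toFinset, fun a => (D a).toNat, g, hg, fun z hz => hg0 ⟨z, hz⟩, fun a ha => ?_, ?_⟩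
  · have := D.supportWithinDomain (hfin.mem_toFinset.1 ha)
    simpa using this
  have hprod : (∏ᶠ (u : ℂ), (fun x => x - u) ^ D u) =
      fun z => ∏ a ∈ hfin.toFinset, (z - a) ^ (D a).toNat := by
    rw [finprod_eq_prod_of_mulSupport_subset (s := hfin.toFinset)]
    · ext z
      rw [Finset.prod_apply]
      refine Finset.prod_congr rfl fun a _ => ?_
      rw [Pi.pow_apply, ← zpow_natCast, Int.toNat_of_nonneg (hDnn a)]
    · rw [Function.FactorizedRational.mulSupport]
      simp
  rw [← hD, hprod] at hfg
  intro z hz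
  -- The factorization holds off a discrete subset of the disc. Every point of the disc, boundary
  -- included, is an accumulation point of it, so continuity extends the identity to all of the
  -- disc.
  have hev : f =ᶠ[nhdsWithin z (closedBall 0 R \ {z})]
      fun z => (∏ a ∈ hfin.toFinset, (z - a) ^ (D a).toNat) * g z := by
    have : nhdsWithin z (closedBall 0 R \ {z}) ≤ codiscreteWithin (closedBall 0 R) := by
      unfold codiscreteWithin
      exact le_iSup₂_of_le z hz le_rfl
    exact this hfg
  have hneBot : (nhdsWithin z (closedBall 0 R \ {z})).NeBot := by
    have h1 : (closedBall (0 : ℂ) R).Nontrivial := by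
      refine ⟨0, by simp [hR.le], (R : ℂ), by simp [abs_of_pos hR], ?_⟩
      exact_mod_cast hR.ne
    have h2 : Preperfect (closedBall (0 : ℂ) R) :=
      (convex_closedBall (0 : ℂ) R).isPreconnected.preperfect_of_nontrivial h1
    have h3 := h2 z hz
    rw [accPt_iff_nhds] at h3
    rw [← mem_closure_iff_nhdsWithin_neBot, mem_closure_iff_nhds]
    intro t ht
    obtain ⟨y, hy, hyz⟩ := h3 t ht
    exact ⟨y, hy.1, hy.2, hyz⟩
  have hc1 : Tendsto f (nhdsWithin z (closedBall 0 R \ {z})) (nhds (f z)) :=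
    (hfU z hz).continuousAt.continuousWithinAt
  have hc2 : Tendsto (fun z => (∏ a ∈ hfin.toFinset, (z - a) ^ (D a).toNat) * g z)
      (nhdsWithin z (closedBall 0 R \ {z}))
      (nhds ((∏ a ∈ hfin.toFinset, (z - a) ^ (D a).toNat) * g z)) := by
    apply ContinuousAt.continuousWithinAt
    exact ContinuousAt.mul (by fun_prop) (hg z hz).continuousAt
  exact tendsto_nhds_unique (hc1.congr' hev) hc2 

/-- The circle mean of `log |f|` over `|z| = r`. -/
noncomputable def logMean (f : ℂ → ℂ) (r : ℝ) : ℝ :=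
  Real.circleAverage (fun z => Real.log ‖f z‖) 0 r

theorem log_norm_prod_mul {F : Finset ℂ} {n : ℂ → ℕ} {z c : ℂ} (hc : c ≠ 0) (hz : z ∉ F) :
    Real.log ‖(∏ a ∈ F, (z - a) ^ n a) * c‖ =
      (∑ a ∈ F, (n a : ℝ) * Real.log ‖z - a‖) + Real.log ‖c‖ := by
  have h1 : ∀ a ∈ F, ‖(z - a) ^ n a‖ ≠ 0 := by
    intro a ha
    refine norm_ne_zero_iff.2 (pow_ne_zero _ (sub_ne_zero.2 ?_))
    rintro rfl
    exact hz ha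
  rw [norm_mul, norm_prod, Real.log_mul (Finset.prod_ne_zero_iff.2 h1) (norm_ne_zero_iff.2 hc),
    Real.log_prod h1]
  simp [Real.log_pow]

open Metric Real in
/-- Jensen's formula for a factorized function. -/
theorem logMean_eq_of_eq_prod_mul {f g : ℂ → ℂ} {R r : ℝ} (hr : 0 < r) (hrR : r ≤ R)
    {F : Finset ℂ} {n : ℂ → ℕ} (hg : AnalyticOnNhd ℂ g (closedBall 0 R))
    (hg0 : ∀ z ∈ closedBall 0 R, g z ≠ 0)
    (hf : ∀ z ∈ closedBall 0 R, f z = (∏ a ∈ F, (z - a) ^ n a) * g z) :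
    logMean f r = (∑ a ∈ F, (n a : ℝ) * log (max r ‖a‖)) + log ‖g 0‖ := by
  have hsub : closedBall (0 : ℂ) |r| ⊆ closedBall 0 R := by
    rw [abs_of_pos hr]; exact closedBall_subset_closedBall hrR
  have hgint : CircleIntegrable (fun z => log ‖g z‖) 0 r :=
    circleIntegrable_log_norm_of_analyticOnNhd (hg.mono (sphere_subset_closedBall.trans hsub))
  have hint : ∀ a : ℂ, CircleIntegrable (fun z => log ‖z - a‖) 0 r := fun a =>
    circleIntegrable_log_norm_of_analyticOnNhd (fun z _ => by fun_prop)
  have hint' : ∀ a ∈ F, CircleIntegrable (fun z => (n a : ℝ) * log ‖z - a‖) 0 r := fun a _ =>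
    (hint a).const_mul _
  have hsum : CircleIntegrable (fun z => ∑ a ∈ F, (n a : ℝ) * log ‖z - a‖) 0 r := by
    have := CircleIntegrable.sum F hint'
    convert this using 1
    ext z; simp
  calc logMean f r
      = circleAverage (fun z => (∑ a ∈ F, (n a : ℝ) * log ‖z - a‖) + log ‖g z‖) 0 r := by
        refine circleAverage_congr_off_countable hr F.countable_toSet fun z hz hzF => ?_
        have hzR : z ∈ closedBall (0 : ℂ) R := by simpa [hz] using hrR
        rw [hf z hzR, log_norm_prod_mul (hg0 z hzR) hzF]
    _ = _ := by
        rw [circleAverage_fun_add hsum hgint, circleAverage_fun_sum hint']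
        congr 1
        · refine Finset.sum_congr rfl fun a _ => ?_
          have := circleAverage_fun_smul (a := (n a : ℝ)) (f := fun z => log ‖z - a‖) (c := 0)
            (R := r)
          simp only [smul_eq_mul] at this
          rw [this, circleAverage_log_norm_sub_eq_log_max a hr]
        · exact AnalyticOnNhd.circleAverage_log_norm_of_ne_zero (hg.mono hsub)
            (fun u hu => hg0 u (hsub hu))

open Metric Real in
/-- Factorization of an entire function over a closed disc, together with a bound for the number of
zeros. -/
theorem exists_factorization_card_le {f : ℂ → ℂ} (hf : AnalyticOnNhd ℂ f Set.univ)
    (hne : ∃ z, f z ≠ 0) {R L : ℝ} (hR : 0 < R) (hL : 1 < L) :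
    ∃ (F : Finset ℂ) (n : ℂ → ℕ) (g : ℂ → ℂ), AnalyticOnNhd ℂ g (closedBall 0 R) ∧
      (∀ z ∈ closedBall 0 R, g z ≠ 0) ∧ (∀ a ∈ F, ‖a‖ ≤ R) ∧
      (∀ z ∈ closedBall 0 R, f z = (∏ a ∈ F, (z - a) ^ n a) * g z) ∧
      (∑ a ∈ F, (n a : ℝ)) * log L ≤ logMean f (L * R) - logMean f R := by
  have hRL : R ≤ L * R := by nlinarith
  obtain ⟨F, n, g, hg, hg0, hF, hfg⟩ :=
    exists_eq_prod_mul_of_analyticOnNhd hf hne (R := L * R) (by positivity)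
  have hsub : closedBall (0 : ℂ) R ⊆ closedBall 0 (L * R) := closedBall_subset_closedBall hRL
  -- Zeros with R < |a| ≤ LR go into the zero-free factor.
  refine ⟨F.filter (fun a => ‖a‖ ≤ R), n,
    fun z => (∏ a ∈ F.filter (fun a => ¬ ‖a‖ ≤ R), (z - a) ^ n a) * g z, ?_, ?_, ?_, ?_, ?_⟩
  · refine AnalyticOnNhd.mul (fun z _ => by fun_prop) (hg.mono hsub)
  · intro z hz
    refine mul_ne_zero (Finset.prod_ne_zero_iff.2 fun a ha => pow_ne_zero _ ?_) (hg0 z (hsub hz))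
    rw [sub_ne_zero]
    rintro rfl
    exact (Finset.mem_filter.1 ha).2 (by simpa using hz)
  · intro a ha
    exact (Finset.mem_filter.1 ha).2
  · intro z hz
    rw [hfg z (hsub hz), ← mul_assoc, Finset.prod_filter_mul_prod_filter_not]
  -- Subtract Jensen's formula at R from that at LR, using one factorization. A zero in the smaller
  -- disc contributes exactly log L per multiplicity, the others a nonnegative amount.
  · rw [logMean_eq_of_eq_prod_mul (by positivity) le_rfl hg hg0 hfg,
      logMean_eq_of_eq_prod_mul hR hRL hg hg0 hfg, add_sub_add_right_eq_sub,
      ← Finset.sum_sub_distrib, Finset.sum_mul, Finset.sum_filter]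
    refine Finset.sum_le_sum fun a ha => ?_
    rw [← mul_sub]
    have hLR : max (L * R) ‖a‖ = L * R := max_eq_left (hF a ha)
    split_ifs with haR
    · rw [hLR, max_eq_left haR, log_mul (by positivity) hR.ne', add_sub_cancel_right]
    · have : log (max R ‖a‖) ≤ log (max (L * R) ‖a‖) :=
        log_le_log (lt_max_of_lt_left hR) (max_le_max_right _ hRL)
      exact mul_nonneg (Nat.cast_nonneg _) (sub_nonneg.2 this)

/-- The zero count of `exists_factorization_card_le` with L = R/r is nonnegative. -/
theorem logMean_mono {f : ℂ → ℂ} (hf : AnalyticOnNhd ℂ f Set.univ) (hne : ∃ z, f z ≠ 0)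
    {r R : ℝ} (hr : 0 < r) (hrR : r ≤ R) : logMean f r ≤ logMean f R := by
  rcases hrR.eq_or_lt with rfl | hlt
  · rfl
  obtain ⟨F, n, g, -, -, -, -, h⟩ :=
    exists_factorization_card_le hf hne hr ((one_lt_div hr).2 hlt)
  rw [div_mul_cancel₀ _ hr.ne'] at h
  have : 0 ≤ (∑ a ∈ F, (n a : ℝ)) * Real.log (R / r) :=
    mul_nonneg (Finset.sum_nonneg fun _ _ => Nat.cast_nonneg _)
      (Real.log_nonneg ((one_lt_div hr).2 hlt).le)
  linarith

/-- The zero at the origin makes the count in the unit disc at least 1. This is the source of the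
unbounded growth of the characteristic. -/
theorem log_le_logMean_sub {f : ℂ → ℂ} (hf : AnalyticOnNhd ℂ f Set.univ) (hne : ∃ z, f z ≠ 0)
    (h0 : f 0 = 0) {r : ℝ} (hr : 1 ≤ r) : Real.log r ≤ logMean f r - logMean f 1 := by
  rcases hr.eq_or_lt with rfl | hlt
  · simp
  obtain ⟨F, n, g, -, hg0, -, hfg, h⟩ := exists_factorization_card_le hf hne one_pos hlt
  rw [mul_one] at h
  have hmem : (0 : ℂ) ∈ Metric.closedBall (0 : ℂ) 1 := by simp
  have h1 := hfg 0 hmem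
  rw [h0, eq_comm, mul_eq_zero, or_iff_left (hg0 0 hmem), Finset.prod_eq_zero_iff] at h1
  obtain ⟨a, ha, ha0⟩ := h1
  have hna : 1 ≤ n a := Nat.one_le_iff_ne_zero.2 fun h => by simp [h] at ha0
  have h2 : (1 : ℝ) ≤ ∑ a ∈ F, (n a : ℝ) :=
    le_trans (by exact_mod_cast hna)
      (Finset.single_le_sum (f := fun a => (n a : ℝ)) (fun _ _ => Nat.cast_nonneg _) ha)
  have h3 := Real.log_nonneg hr
  nlinarith

/-- Jensen's formula together with log|a| ≤ log max(r, |a|) for each zero a. -/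
theorem log_norm_zero_le_logMean {f : ℂ → ℂ} (hf : AnalyticOnNhd ℂ f Set.univ) (h0 : f 0 ≠ 0)
    {r : ℝ} (hr : 0 < r) : Real.log ‖f 0‖ ≤ logMean f r := by
  obtain ⟨F, n, g, hg, hg0, hF, hfg⟩ := exists_eq_prod_mul_of_analyticOnNhd hf ⟨0, h0⟩ hr
  have hmem : (0 : ℂ) ∈ Metric.closedBall (0 : ℂ) r := by simp [hr.le]
  rw [logMean_eq_of_eq_prod_mul hr le_rfl hg hg0 hfg, hfg 0 hmem, norm_mul, norm_prod]
  have hpos : 0 < ∏ a ∈ F, ‖((0 : ℂ) - a) ^ n a‖ := by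
    rw [← norm_prod, norm_pos_iff]
    exact left_ne_zero_of_mul (hfg 0 hmem ▸ h0)
  rw [Real.log_mul hpos.ne' (norm_ne_zero_iff.2 (hg0 0 hmem))]
  refine add_le_add_left ?_ _
  rw [Real.log_prod (Finset.prod_ne_zero_iff.1 hpos.ne')]
  refine Finset.sum_le_sum fun a ha => ?_
  rw [norm_pow, Real.log_pow, zero_sub, norm_neg]
  rcases eq_or_ne a 0 with rfl | ha0
  · have hn : n 0 = 0 := by
      by_contra hn
      exact Finset.prod_ne_zero_iff.1 hpos.ne' 0 ha (by simp [hn])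
    simp [hn]
  · refine mul_le_mul_of_nonneg_left ?_ (Nat.cast_nonneg _)
    exact Real.log_le_log (norm_pos_iff.2 ha0) (le_max_right _ _)

/-! ### One variable: the effect of a dilation z ↦ qz on log|f₀/f₁|. -/

-- Harnack: the kernel lies between (R - |w|)/(R + |w|) and (R + |w|)/(R - |w|).
open Metric Real in
theorem abs_poissonKernel_sub_one_le {R t : ℝ} (hR : 0 < R) (ht : t ≤ 1 / 2) {w z : ℂ}
    (hw : ‖w‖ ≤ t * R) (hz : ‖z‖ = R) : |poissonKernel 0 w z - 1| ≤ 4 * t := by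
  have ht0 : 0 ≤ t := by
    by_contra h
    nlinarith [norm_nonneg w]
  have hwR : ‖w‖ < R := by nlinarith
  have hwb : w ∈ ball (0 : ℂ) R := by simpa using hwR
  have hzs : z ∈ sphere (0 : ℂ) R := by simpa using hz
  have h1 := re_herglotzRieszKernel_le hzs hwb
  have h2 := le_re_herglotzRieszKernel hzs hwb
  have h3 : poissonKernel 0 w z = ((z - 0 + (w - 0)) / (z - 0 - (w - 0))).re := by
    rw [poissonKernel_eq_re_herglotzRieszKernel, Function.comp_apply, herglotzRieszKernel_def]
  rw [← h3, sub_zero] at h1 h2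
  have h4 : (R + ‖w‖) / (R - ‖w‖) ≤ 1 + 4 * t := by
    rw [div_le_iff₀ (by linarith)]
    nlinarith [norm_nonneg w, mul_nonneg ht0 hR.le]
  have h5 : 1 - 4 * t ≤ (R - ‖w‖) / (R + ‖w‖) := by
    rw [le_div_iff₀ (by linarith [norm_nonneg w])]
    nlinarith [norm_nonneg w, mul_nonneg ht0 hR.le]
  rw [abs_le]
  constructor <;> linarith

open Metric Real InnerProductSpace in
/-- A quantitative form of the continuity of harmonic functions near the centre of a disc. -/
theorem abs_sub_le_circleAverage_of_harmonicOnNhd {u : ℂ → ℝ} {R t : ℝ} (hR : 0 < R)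
    (hu : HarmonicOnNhd u (closedBall 0 R)) (ht : t ≤ 1 / 2) {z w : ℂ} (hz : ‖z‖ ≤ t * R)
    (hw : ‖w‖ ≤ t * R) : |u z - u w| ≤ 8 * t * circleAverage (fun ζ => |u ζ|) 0 R := by
  have hball : ∀ x : ℂ, ‖x‖ ≤ t * R → x ∈ ball (0 : ℂ) R := by
    intro x hx
    have : ‖x‖ < R := by nlinarith [norm_nonneg x]
    simpa using this
  have hcont : ContinuousOn u (sphere 0 R) := fun x hx =>
    (hu x (sphere_subset_closedBall hx)).1.continuousAt.continuousWithinAt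
  have hK : ∀ x : ℂ, ‖x‖ ≤ t * R → ContinuousOn (poissonKernel 0 x) (sphere 0 R) := by
    intro x hx
    rw [poissonKernel_eq_re_herglotzRieszKernel]
    have := continuousOn_herglotzRieszKernel_sphere (hball x hx)
    rw [abs_of_pos hR] at this
    exact Complex.continuous_re.comp_continuousOn this
  have hint : ∀ x : ℂ, ‖x‖ ≤ t * R → CircleIntegrable (poissonKernel 0 x • u) 0 R := fun x hx =>
    ((hK x hx).smul hcont).circleIntegrable hR.le
  rw [← hu.circleAverage_poissonKernel_smul (hball z hz),
    ← hu.circleAverage_poissonKernel_smul (hball w hw),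
    ← circleAverage_sub (hint z hz) (hint w hw)]
  have habs : CircleIntegrable (fun ζ => |u ζ|) 0 R := hcont.abs.circleIntegrable hR.le
  calc |circleAverage (poissonKernel 0 z • u - poissonKernel 0 w • u) 0 R|
      ≤ circleAverage |poissonKernel 0 z • u - poissonKernel 0 w • u| 0 R :=
        abs_circleAverage_le_circleAverage_abs
    _ ≤ circleAverage (fun ζ => (8 * t) * |u ζ|) 0 R := by
        refine circleAverage_mono ((hint z hz).sub (hint w hw)).abs (habs.const_mul _) ?_
        intro ζ hζ
        rw [abs_of_pos hR, mem_sphere_zero_iff_norm] at hζ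
        have h1 := abs_poissonKernel_sub_one_le hR ht hz hζ
        have h2 := abs_poissonKernel_sub_one_le hR ht hw hζ
        simp only [Pi.abs_apply, Pi.sub_apply, smul_eq_mul, Pi.mul_apply]
        rw [← sub_mul, abs_mul]
        refine mul_le_mul_of_nonneg_right ?_ (abs_nonneg _)
        have h3 := abs_sub (poissonKernel 0 z ζ - 1) (poissonKernel 0 w ζ - 1)
        rw [sub_sub_sub_cancel_right] at h3
        linarith
    _ = 8 * t * circleAverage (fun ζ => |u ζ|) 0 R := by
        have := circleAverage_fun_smul (a := 8 * t) (f := fun ζ => |u ζ|) (c := 0) (R := R)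
        simpa only [smul_eq_mul] using this

open Metric Real in
theorem circleIntegrable_abs_log_sub {b : ℝ} (a : ℂ) (r : ℝ) :
    CircleIntegrable (fun z => |log ‖z - a‖ - b|) 0 r := by
  have hint : CircleIntegrable (fun z => log ‖z - a‖) 0 r :=
    circleIntegrable_log_norm_of_analyticOnNhd (fun z _ => by fun_prop)
  exact (hint.sub (circleIntegrable_const _ _ _)).abs

open Metric Real in
theorem circleIntegrable_log_dilate_sub (a q : ℂ) (r : ℝ) :
    CircleIntegrable (fun z => |log ‖q * z - a‖ - log ‖z - a‖|) 0 r := by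
  have hint : CircleIntegrable (fun z => log ‖z - a‖) 0 r :=
    circleIntegrable_log_norm_of_analyticOnNhd (fun z _ => by fun_prop)
  have hint' : CircleIntegrable (fun z => log ‖q * z - a‖) 0 r :=
    circleIntegrable_log_norm_of_analyticOnNhd (fun z _ => by fun_prop)
  exact (hint'.sub hint).abs

-- The cost of a single zero. Since log|qz - a| = log|q| + log|z - a/q|, both logarithms oscillate
-- boundedly about their means, and these means differ by at most |log|q||, uniformly in a and r.
open Metric Real in
theorem circleAverage_abs_log_dilate_sub_le (a : ℂ) {q : ℂ} (hq : q ≠ 0) {r : ℝ} (hr : 0 < r) :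
    circleAverage (fun z => |log ‖q * z - a‖ - log ‖z - a‖|) 0 r ≤
      4 * log 2 + |log ‖q‖| := by
  have hq' : 0 < ‖q‖ := norm_pos_iff.2 hq
  set M := log (max r ‖a / q‖)
  set M' := log (max r ‖a‖)
  have hM : |log ‖q‖ + M - M'| ≤ |log ‖q‖| := by
    have e1 : log ‖q‖ + M = log (max (‖q‖ * r) ‖a‖) := by
      rw [← log_mul hq'.ne' (lt_max_of_lt_left hr).ne', mul_max_of_nonneg _ _ hq'.le, norm_div,
        mul_div_cancel₀ _ hq'.ne']
    rw [e1]
    have p1 : 0 < max r ‖a‖ := lt_max_of_lt_left hr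
    have p2 : 0 < max (‖q‖ * r) ‖a‖ := lt_max_of_lt_left (by positivity)
    rw [← log_div p2.ne' p1.ne']
    have n0 := norm_nonneg a
    rcases le_total 1 ‖q‖ with h | h
    · have h1 : 1 ≤ max (‖q‖ * r) ‖a‖ / max r ‖a‖ := by
        rw [one_le_div p1]
        exact max_le_max_right _ (by nlinarith)
      have h2 : max (‖q‖ * r) ‖a‖ / max r ‖a‖ ≤ ‖q‖ := by
        rw [div_le_iff₀ p1, mul_max_of_nonneg _ _ hq'.le]
        exact max_le_max le_rfl (by nlinarith)
      rw [abs_of_nonneg (log_nonneg h1), abs_of_nonneg (log_nonneg h)]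
      exact log_le_log (by positivity) h2
    · have h1 : max (‖q‖ * r) ‖a‖ / max r ‖a‖ ≤ 1 := by
        rw [div_le_one p1]
        exact max_le_max_right _ (by nlinarith)
      have h2 : ‖q‖ ≤ max (‖q‖ * r) ‖a‖ / max r ‖a‖ := by
        rw [le_div_iff₀ p1, mul_max_of_nonneg _ _ hq'.le]
        exact max_le_max le_rfl (by nlinarith)
      rw [abs_of_nonpos (log_nonpos (by positivity) h1), abs_of_nonpos (log_nonpos hq'.le h)]
      exact neg_le_neg (log_le_log hq' h2)
  have i1 := circleIntegrable_abs_log_sub (b := M) (a / q) r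
  have i2 := circleIntegrable_abs_log_sub (b := M') a r
  have i3 : CircleIntegrable (fun _ : ℂ => |log ‖q‖|) 0 r := circleIntegrable_const _ _ _
  calc circleAverage (fun z => |log ‖q * z - a‖ - log ‖z - a‖|) 0 r
      ≤ circleAverage (fun z => (|log ‖z - a / q‖ - M| + |log ‖z - a‖ - M'|) + |log ‖q‖|) 0 r := by
        refine circleAverage_mono_off_countable hr (Set.countable_singleton (a / q))
          (circleIntegrable_log_dilate_sub a q r) ((i1.add i2).add i3) ?_
        intro z hz hza
        have e2 : log ‖q * z - a‖ = log ‖q‖ + log ‖z - a / q‖ := by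
          rw [← log_mul hq'.ne' (norm_ne_zero_iff.2 (sub_ne_zero.2 hza)), ← norm_mul, mul_sub,
            mul_div_cancel₀ _ hq]
        rw [e2]
        have e3 : log ‖q‖ + log ‖z - a / q‖ - log ‖z - a‖ =
          (log ‖z - a / q‖ - M) - (log ‖z - a‖ - M') + (log ‖q‖ + M - M') := by ring
        rw [e3]
        exact (abs_add_le _ _).trans (add_le_add (abs_sub _ _) hM)
    _ ≤ 4 * log 2 + |log ‖q‖| := by
        rw [circleAverage_fun_add (f₁ := fun z => |log ‖z - a / q‖ - M| + |log ‖z - a‖ - M'|)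
          (i1.add i2) i3, circleAverage_fun_add i1 i2, circleAverage_const]
        linarith [circleAverage_abs_log_norm_sub_le a hr,
          circleAverage_abs_log_norm_sub_le (a / q) hr]

open Metric Real in
theorem circleAverage_sum_mul {F : Finset ℂ} (n : ℂ → ℝ) {φ : ℂ → ℂ → ℝ} {r : ℝ}
    (hφ : ∀ a, CircleIntegrable (φ a) 0 r) :
    CircleIntegrable (fun z => ∑ a ∈ F, n a * φ a z) 0 r ∧
    circleAverage (fun z => ∑ a ∈ F, n a * φ a z) 0 r = ∑ a ∈ F, n a * circleAverage (φ a) 0 r := by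
  have h : ∀ a ∈ F, CircleIntegrable (fun z => n a * φ a z) 0 r := fun a _ => (hφ a).const_mul _
  constructor
  · have := CircleIntegrable.sum F h
    convert this using 1
    ext z; simp
  · rw [circleAverage_fun_sum h]
    refine Finset.sum_congr rfl fun a _ => ?_
    have := circleAverage_fun_smul (a := n a) (f := φ a) (c := 0) (R := r)
    simpa only [smul_eq_mul] using this

open Metric Real in
/-- The mean over a circle of `|log |F(qz) / F(z)||` for a quotient `F = f₀ / f₁` of entire
functions. -/
theorem circleAverage_abs_log_quotient_dilate_le {q : ℂ} (hq : q ≠ 0) {f₀ f₁ : ℂ → ℂ}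
    (h₀ : AnalyticOnNhd ℂ f₀ Set.univ) (h₁ : AnalyticOnNhd ℂ f₁ Set.univ)
    (hne₀ : ∃ z, f₀ z ≠ 0) (hne₁ : ∃ z, f₁ z ≠ 0) {r K L : ℝ} (hr : 0 < r)
    (hK : 2 * max 1 ‖q‖ ≤ K) (hL : 1 < L) :
    circleAverage (fun z => |(log ‖f₀ (q * z)‖ - log ‖f₁ (q * z)‖) -
        (log ‖f₀ z‖ - log ‖f₁ z‖)|) 0 r ≤
      8 * (max 1 ‖q‖ / K) * circleAverage (fun z => |log ‖f₀ z‖ - log ‖f₁ z‖|) 0 (K * r) +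
      (12 * log 2 + |log ‖q‖|) / log L * ((logMean f₀ (L * (K * r)) - logMean f₀ (K * r)) +
        (logMean f₁ (L * (K * r)) - logMean f₁ (K * r))) := by
  have hK0 : 0 < K := by linarith [le_max_left 1 ‖q‖]
  set R := K * r with hRdef
  have hR : 0 < R := by positivity
  set t := max 1 ‖q‖ / K with htdef
  have ht0 : 0 ≤ t := by positivity
  have ht : t ≤ 1 / 2 := by rw [htdef, div_le_iff₀ hK0]; linarith
  have htR : t * R = max 1 ‖q‖ * r := by rw [htdef, hRdef]; field_simp
  obtain ⟨F₀, n₀, g₀, hg₀, hgn₀, hF₀, hf₀, hc₀⟩ := exists_factorization_card_le h₀ hne₀ hR hL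
  obtain ⟨F₁, n₁, g₁, hg₁, hgn₁, hF₁, hf₁, hc₁⟩ := exists_factorization_card_le h₁ hne₁ hR hL
  set N₀ := ∑ a ∈ F₀, (n₀ a : ℝ)
  set N₁ := ∑ a ∈ F₁, (n₁ a : ℝ)
  have hN₀ : 0 ≤ N₀ := Finset.sum_nonneg fun _ _ => Nat.cast_nonneg _
  have hN₁ : 0 ≤ N₁ := Finset.sum_nonneg fun _ _ => Nat.cast_nonneg _
  -- The constants N log R normalize each factor z - a to (z - a)/R. On |z| = R the function u then
  -- differs from log|f₀/f₁| by an amount whose mean modulus is O(1) per zero, with no log R left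
  -- over.
  set u : ℂ → ℝ := fun z => (log ‖g₀ z‖ + N₀ * log R) - (log ‖g₁ z‖ + N₁ * log R) with hu
  have hharm : InnerProductSpace.HarmonicOnNhd u (closedBall 0 R) := by
    have e : u = (fun z => log ‖g₀ z‖) - (fun z => log ‖g₁ z‖) +
        fun _ => N₀ * log R - N₁ * log R := by
      ext z; simp only [hu, Pi.add_apply, Pi.sub_apply]; ring
    rw [e]
    intro z hz
    exact ((AnalyticAt.harmonicAt_log_norm (hg₀ z hz) (hgn₀ z hz)).sub
      (AnalyticAt.harmonicAt_log_norm (hg₁ z hz) (hgn₁ z hz))).add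
        (InnerProductSpace.harmonicAt_const _)
  have hlog₀ : ∀ z ∈ closedBall (0 : ℂ) R, z ∉ F₀ →
      log ‖f₀ z‖ = (∑ a ∈ F₀, (n₀ a : ℝ) * log ‖z - a‖) + log ‖g₀ z‖ := fun z hz hzF => by
    rw [hf₀ z hz, log_norm_prod_mul (hgn₀ z hz) hzF]
  have hlog₁ : ∀ z ∈ closedBall (0 : ℂ) R, z ∉ F₁ →
      log ‖f₁ z‖ = (∑ a ∈ F₁, (n₁ a : ℝ) * log ‖z - a‖) + log ‖g₁ z‖ := fun z hz hzF => by
    rw [hf₁ z hz, log_norm_prod_mul (hgn₁ z hz) hzF]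
  have iC : ∀ {f : ℂ → ℂ}, AnalyticOnNhd ℂ f Set.univ → ∀ ρ,
      CircleIntegrable (fun z => log ‖f z‖) 0 ρ := fun hf ρ =>
    circleIntegrable_log_norm_of_analyticOnNhd (hf.mono (Set.subset_univ _))
  have iF := ((iC h₀ R).sub (iC h₁ R)).abs
  -- the mean of `|u|` over the outer circle
  have hmeanu : circleAverage (fun ζ => |u ζ|) 0 R ≤
      circleAverage (fun z => |log ‖f₀ z‖ - log ‖f₁ z‖|) 0 R + (N₀ + N₁) * (2 * log 2) := by
    have j₀ := circleAverage_sum_mul (F := F₀) (fun a => (n₀ a : ℝ))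
      (fun a => circleIntegrable_abs_log_sub (b := log (max R ‖a‖)) a R)
    have j₁ := circleAverage_sum_mul (F := F₁) (fun a => (n₁ a : ℝ))
      (fun a => circleIntegrable_abs_log_sub (b := log (max R ‖a‖)) a R)
    have iu : CircleIntegrable (fun ζ => |u ζ|) 0 R := by
      refine ContinuousOn.circleIntegrable hR.le (ContinuousOn.abs fun x hx => ?_)
      exact (hharm x (sphere_subset_closedBall hx)).1.continuousAt.continuousWithinAt
    calc circleAverage (fun ζ => |u ζ|) 0 R
        ≤ circleAverage (fun z => |log ‖f₀ z‖ - log ‖f₁ z‖| +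
            ((∑ a ∈ F₀, (n₀ a : ℝ) * |log ‖z - a‖ - log (max R ‖a‖)|) +
              ∑ a ∈ F₁, (n₁ a : ℝ) * |log ‖z - a‖ - log (max R ‖a‖)|)) 0 R := by
          refine circleAverage_mono_off_countable hR (F₀.countable_toSet.union F₁.countable_toSet)
            iu (iF.add (j₀.1.add j₁.1)) ?_
          intro z hz hzF
          rw [Set.mem_union, not_or] at hzF
          have hzR : z ∈ closedBall (0 : ℂ) R := by simp [hz]
          have s : ∀ (F : Finset ℂ) (n : ℂ → ℕ), (∀ a ∈ F, ‖a‖ ≤ R) →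
              |(∑ a ∈ F, (n a : ℝ) * log ‖z - a‖) - (∑ a ∈ F, (n a : ℝ)) * log R| ≤
              ∑ a ∈ F, (n a : ℝ) * |log ‖z - a‖ - log (max R ‖a‖)| := by
            intro F n hF
            rw [Finset.sum_mul, ← Finset.sum_sub_distrib]
            refine (Finset.abs_sum_le_sum_abs _ _).trans (Finset.sum_le_sum fun a ha => ?_)
            rw [max_eq_left (hF a ha), ← mul_sub, abs_mul, abs_of_nonneg (Nat.cast_nonneg (n a))]
          have e : u z = (log ‖f₀ z‖ - log ‖f₁ z‖) -
              (((∑ a ∈ F₀, (n₀ a : ℝ) * log ‖z - a‖) - N₀ * log R) -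
              ((∑ a ∈ F₁, (n₁ a : ℝ) * log ‖z - a‖) - N₁ * log R)) := by
            rw [hlog₀ z hzR hzF.1, hlog₁ z hzR hzF.2, hu]; ring
          rw [e]
          refine (abs_sub _ _).trans (add_le_add le_rfl ((abs_sub _ _).trans ?_))
          exact add_le_add (s F₀ n₀ hF₀) (s F₁ n₁ hF₁)
      _ ≤ _ := by
          rw [circleAverage_fun_add (f₁ := fun z => |log ‖f₀ z‖ - log ‖f₁ z‖|)
            (f₂ := fun z => (∑ a ∈ F₀, (n₀ a : ℝ) * |log ‖z - a‖ - log (max R ‖a‖)|) +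
              ∑ a ∈ F₁, (n₁ a : ℝ) * |log ‖z - a‖ - log (max R ‖a‖)|) iF (j₀.1.add j₁.1),
            circleAverage_fun_add j₀.1 j₁.1, j₀.2,
            j₁.2, add_mul, Finset.sum_mul, Finset.sum_mul]
          refine add_le_add le_rfl (add_le_add ?_ ?_) <;>
          exact Finset.sum_le_sum fun a _ => mul_le_mul_of_nonneg_left
            (circleAverage_abs_log_norm_sub_le a hR) (Nat.cast_nonneg _)
  -- the inner circle
  have hin : ∀ z : ℂ, ‖z‖ = r → z ∈ closedBall (0 : ℂ) R ∧ q * z ∈ closedBall (0 : ℂ) R ∧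
      ‖z‖ ≤ t * R ∧ ‖q * z‖ ≤ t * R := by
    intro z hz
    have a1 : ‖z‖ ≤ t * R := by
      rw [htR, hz]
      have := le_max_left 1 ‖q‖
      nlinarith
    have a2 : ‖q * z‖ ≤ t * R := by
      rw [htR, norm_mul, hz]
      exact mul_le_mul_of_nonneg_right (le_max_right _ _) hr.le
    have a3 : t * R ≤ R := by nlinarith
    refine ⟨?_, ?_, a1, a2⟩ <;> simp only [mem_closedBall, dist_zero_right] <;> linarith
  have iD : ∀ {f : ℂ → ℂ}, AnalyticOnNhd ℂ f Set.univ →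
      CircleIntegrable (fun z => log ‖f (q * z)‖) 0 r := fun {f} hf =>
    iC (f := fun z => f (q * z)) (fun z _ => AnalyticAt.fun_comp (hf (q * z) (Set.mem_univ _))
      (by fun_prop)) r
  have k₀ := circleAverage_sum_mul (F := F₀) (fun a => (n₀ a : ℝ))
      (fun a => circleIntegrable_log_dilate_sub a q r)
  have k₁ := circleAverage_sum_mul (F := F₁) (fun a => (n₁ a : ℝ))
      (fun a => circleIntegrable_log_dilate_sub a q r)
  set B := 8 * t * circleAverage (fun ζ => |u ζ|) 0 R with hB
  have hmain : circleAverage (fun z => |(log ‖f₀ (q * z)‖ - log ‖f₁ (q * z)‖) -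
        (log ‖f₀ z‖ - log ‖f₁ z‖)|) 0 r ≤ B + (N₀ + N₁) * (4 * log 2 + |log ‖q‖|) := by
    calc _ ≤ circleAverage (fun z => B +
            ((∑ a ∈ F₀, (n₀ a : ℝ) * |log ‖q * z - a‖ - log ‖z - a‖|) +
              ∑ a ∈ F₁, (n₁ a : ℝ) * |log ‖q * z - a‖ - log ‖z - a‖|)) 0 r := by
          refine circleAverage_mono_off_countable hr
            (((F₀.countable_toSet.union F₁.countable_toSet)).union
              ((F₀.countable_toSet.union F₁.countable_toSet).preimage
                (mul_right_injective₀ hq)))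
            (((iD h₀).sub (iD h₁)).sub ((iC h₀ r).sub (iC h₁ r))).abs
            ((circleIntegrable_const _ _ _).add (k₀.1.add k₁.1)) ?_
          intro z hz hzF
          simp only [Set.mem_union, Set.mem_preimage, not_or, Finset.mem_coe] at hzF
          obtain ⟨⟨z0, z1⟩, qz0, qz1⟩ := hzF
          obtain ⟨b1, b2, b3, b4⟩ := hin z hz
          have s : ∀ (F : Finset ℂ) (n : ℂ → ℕ),
              |(∑ a ∈ F, (n a : ℝ) * log ‖q * z - a‖) - (∑ a ∈ F, (n a : ℝ) * log ‖z - a‖)| ≤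
              ∑ a ∈ F, (n a : ℝ) * |log ‖q * z - a‖ - log ‖z - a‖| := by
            intro F n
            rw [← Finset.sum_sub_distrib]
            refine (Finset.abs_sum_le_sum_abs _ _).trans (Finset.sum_le_sum fun a ha => ?_)
            rw [← mul_sub, abs_mul, abs_of_nonneg (Nat.cast_nonneg (n a))]
          have e : (log ‖f₀ (q * z)‖ - log ‖f₁ (q * z)‖) - (log ‖f₀ z‖ - log ‖f₁ z‖) =
              (u (q * z) - u z) +
              (((∑ a ∈ F₀, (n₀ a : ℝ) * log ‖q * z - a‖) - (∑ a ∈ F₀, (n₀ a : ℝ) * log ‖z - a‖)) -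
              ((∑ a ∈ F₁, (n₁ a : ℝ) * log ‖q * z - a‖) -
                (∑ a ∈ F₁, (n₁ a : ℝ) * log ‖z - a‖))) := by
            rw [hlog₀ z b1 z0, hlog₁ z b1 z1, hlog₀ _ b2 qz0, hlog₁ _ b2 qz1, hu]; ring
          rw [e]
          refine (abs_add_le _ _).trans (add_le_add
            (abs_sub_le_circleAverage_of_harmonicOnNhd hR hharm ht b4 b3)
            ((abs_sub _ _).trans (add_le_add (s F₀ n₀) (s F₁ n₁))))
      _ ≤ _ := by
          rw [circleAverage_fun_add (f₂ := fun z =>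
              (∑ a ∈ F₀, (n₀ a : ℝ) * |log ‖q * z - a‖ - log ‖z - a‖|) +
              ∑ a ∈ F₁, (n₁ a : ℝ) * |log ‖q * z - a‖ - log ‖z - a‖|)
              (circleIntegrable_const _ _ _) (k₀.1.add k₁.1),
            circleAverage_fun_add k₀.1 k₁.1, k₀.2, k₁.2, circleAverage_const, add_mul,
            Finset.sum_mul, Finset.sum_mul]
          refine add_le_add le_rfl (add_le_add ?_ ?_) <;>
          exact Finset.sum_le_sum fun a _ => mul_le_mul_of_nonneg_left
            (circleAverage_abs_log_dilate_sub_le a hq hr) (Nat.cast_nonneg _)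
  have hlogL : 0 < log L := log_pos hL
  have hNL : N₀ + N₁ ≤ ((logMean f₀ (L * R) - logMean f₀ R) +
      (logMean f₁ (L * R) - logMean f₁ R)) / log L := by
    rw [le_div_iff₀ hlogL]; linarith
  have hlog2 : 0 < log 2 := log_pos one_lt_two
  -- The zeros entering through u cost 8t · 2 log 2 ≤ 8 log 2 each, as t ≤ 1/2; with the direct cost
  -- 4 log 2 + |log|q|| this gives the 12 log 2 of the statement.
  have hB' : B ≤ 8 * t * circleAverage (fun z => |log ‖f₀ z‖ - log ‖f₁ z‖|) 0 R +
      (N₀ + N₁) * (8 * log 2) := by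
    rw [hB]
    refine (mul_le_mul_of_nonneg_left hmeanu (by positivity)).trans ?_
    rw [mul_add]
    refine add_le_add le_rfl ?_
    have : 0 ≤ (N₀ + N₁) * (2 * log 2) := by positivity
    nlinarith
  have hC : 0 ≤ 12 * log 2 + |log ‖q‖| := by positivity
  calc _ ≤ B + (N₀ + N₁) * (4 * log 2 + |log ‖q‖|) := hmain
    _ ≤ 8 * t * circleAverage (fun z => |log ‖f₀ z‖ - log ‖f₁ z‖|) 0 R +
        (12 * log 2 + |log ‖q‖|) * (N₀ + N₁) := by linarith
    _ ≤ _ := by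
        rw [div_mul_eq_mul_div, mul_div_assoc]
        exact add_le_add le_rfl (mul_le_mul_of_nonneg_left hNL hC)

/-! ### Rotation invariance of the sphere measure and slicing by complex lines. -/

section Sphere

variable {m : ℕ}

/-- The unit sphere of `ℂ^m`. -/
abbrev USphere (m : ℕ) : Type := Metric.sphere (0 : CSpace m) 1

instance instIsProbabilityMeasureSphereMeasure [Nontrivial (CSpace m)] :
    IsProbabilityMeasure (sphereMeasure m) := by
  constructor
  rw [sphereMeasure, Measure.smul_apply, smul_eq_mul]
  refine ENNReal.inv_mul_cancel ?_ (measure_ne_top _ _)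
  rw [Ne, Measure.measure_univ_eq_zero]
  exact Measure.toSphere_ne_zero _

instance instIsFiniteMeasureSphereMeasure : IsFiniteMeasure (sphereMeasure m) := by
  rcases subsingleton_or_nontrivial (CSpace m) with h | h
  · have : IsEmpty (USphere m) := ⟨fun ξ => by
      have h1 : ‖(ξ : CSpace m)‖ = 1 := by simp
      rw [Subsingleton.elim (ξ : CSpace m) 0] at h1
      simp at h1⟩
    rw [Measure.eq_zero_of_isEmpty (sphereMeasure m)]
    infer_instance
  · infer_instance

/-- Multiplication by a complex number of modulus one, as a real linear isometry of `ℂ^m`. -/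
noncomputable def unitSmulIsometry (θ : ℝ) : CSpace m ≃ₗᵢ[ℝ] CSpace m where
  toFun z := Complex.exp (θ * Complex.I) • z
  invFun z := Complex.exp (-(θ * Complex.I)) • z
  map_add' x y := smul_add _ _ _
  map_smul' c x := smul_comm _ _ _
  left_inv x := by simp [smul_smul, ← Complex.exp_add]
  right_inv x := by simp [smul_smul, ← Complex.exp_add]
  norm_map' x := by
    change ‖Complex.exp (θ * Complex.I) • x‖ = ‖x‖
    rw [norm_smul, Complex.norm_exp_ofReal_mul_I, one_mul]

/-- Rotation of the unit sphere by `e^{iθ}`. -/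
noncomputable def rotate (θ : ℝ) (ξ : USphere m) : USphere m :=
  ⟨unitSmulIsometry θ ξ, by
    rw [mem_sphere_zero_iff_norm, LinearIsometryEquiv.norm_map]; simp⟩

theorem coe_rotate (θ : ℝ) (ξ : USphere m) :
    (rotate θ ξ : CSpace m) = Complex.exp (θ * Complex.I) • (ξ : CSpace m) := rfl

theorem real_smul_rotate (r θ : ℝ) (ξ : USphere m) :
    r • (rotate θ ξ : CSpace m) = circleMap 0 r θ • (ξ : CSpace m) := by
  rw [coe_rotate, circleMap_zero, mul_smul, Complex.coe_smul]

theorem continuous_rotate : Continuous (fun p : ℝ × USphere m => rotate p.1 p.2) := by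
  refine Continuous.subtype_mk ?_ _
  change Continuous fun p : ℝ × USphere m => Complex.exp (p.1 * Complex.I) • (p.2 : CSpace m)
  fun_prop

-- The measure `toSphere` of a set is a multiple of the volume of the cone over it, and a linear
-- isometry maps cones to cones and preserves volume.
open Pointwise in
theorem measurePreserving_rotate (θ : ℝ) :
    MeasurePreserving (rotate (m := m) θ) (sphereMeasure m) (sphereMeasure m) := by
  have hmeas : Measurable (rotate (m := m) θ) :=
    (continuous_rotate.comp (Continuous.prodMk_right θ)).measurable
  suffices h : MeasurePreserving (rotate (m := m) θ) ((volume : Measure (CSpace m)).toSphere)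
      ((volume : Measure (CSpace m)).toSphere) from h.smul_measure _
  refine ⟨hmeas, Measure.ext fun s hs => ?_⟩
  rw [Measure.map_apply hmeas hs, Measure.toSphere_apply' _ (hmeas hs),
    Measure.toSphere_apply' _ hs]
  congr 1
  have hset : Set.Ioo (0 : ℝ) 1 • ((↑) '' (rotate (m := m) θ ⁻¹' s) : Set (CSpace m)) =
      (unitSmulIsometry θ) ⁻¹' (Set.Ioo (0 : ℝ) 1 • ((↑) '' s : Set (CSpace m))) := by
    ext z
    simp only [Set.mem_smul, Set.mem_image, Set.mem_preimage]
    constructor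
    · rintro ⟨t, ht, _, ⟨ξ, hξ, rfl⟩, rfl⟩
      exact ⟨t, ht, _, ⟨rotate θ ξ, hξ, rfl⟩, (map_smul (unitSmulIsometry θ) t _).symm⟩
    · rintro ⟨t, ht, _, ⟨ξ, hξ, rfl⟩, h⟩
      refine ⟨t, ht, (unitSmulIsometry θ).symm ξ, ⟨⟨(unitSmulIsometry θ).symm ξ, ?_⟩, ?_, rfl⟩, ?_⟩
      · rw [mem_sphere_zero_iff_norm, LinearIsometryEquiv.norm_map]; simp
      · have : rotate θ ⟨(unitSmulIsometry θ).symm ξ, by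
            rw [mem_sphere_zero_iff_norm, LinearIsometryEquiv.norm_map]; simp⟩ = ξ :=
          Subtype.ext ((unitSmulIsometry θ).apply_symm_apply _)
        exact this.symm ▸ hξ
      · rw [← map_smul, h, LinearIsometryEquiv.symm_apply_apply]
  rw [hset, (unitSmulIsometry θ).measurePreserving.measure_preimage_emb
    (unitSmulIsometry θ).toHomeomorph.measurableEmbedding]

/-- The measure `dθ` on `(0, 2π]`. -/
noncomputable abbrev angleMeasure : Measure ℝ := volume.restrict (Set.Ioc 0 (2 * Real.pi))

/-- Rotating ξ by an angle that is itself a variable still preserves the product measure. Fubini for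
this shear turns a sphere mean into a mean of circle means. -/
theorem measurePreserving_skew_rotate :
    MeasurePreserving (fun p : ℝ × USphere m => (p.1, rotate p.1 p.2))
      (angleMeasure.prod (sphereMeasure m)) (angleMeasure.prod (sphereMeasure m)) :=
  (MeasurePreserving.id angleMeasure).skew_product (g := fun θ ξ => rotate θ ξ)
    continuous_rotate.measurable (ae_of_all _ fun θ => (measurePreserving_rotate θ).map_eq)

theorem angleMeasure_univ : angleMeasure Set.univ = ENNReal.ofReal (2 * Real.pi) := by
  simp

/-- The version for nonnegative functions presupposes no integrability, so it can serve to prove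
that log|g| is integrable. -/
theorem lintegral_sphere_eq_lintegral_circle {φ : CSpace m → ℝ≥0∞} (hφ : Measurable φ) (r : ℝ) :
    ENNReal.ofReal (2 * Real.pi) * ∫⁻ ξ : USphere m, φ (r • (ξ : CSpace m)) ∂sphereMeasure m =
      ∫⁻ ξ : USphere m, ∫⁻ θ, φ (circleMap 0 r θ • (ξ : CSpace m)) ∂angleMeasure
        ∂sphereMeasure m := by
  have h1 : Measurable fun p : ℝ × USphere m => φ (r • (p.2 : CSpace m)) := by
    refine hφ.comp ?_
    have : Continuous fun p : ℝ × USphere m => r • (p.2 : CSpace m) := by fun_prop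
    exact this.measurable
  have h2 := (measurePreserving_skew_rotate (m := m)).lintegral_comp h1
  simp only [real_smul_rotate] at h2
  have h3 : Measurable fun p : ℝ × USphere m => φ (circleMap 0 r p.1 • (p.2 : CSpace m)) := by
    refine hφ.comp ?_
    have : Continuous fun p : ℝ × USphere m => circleMap 0 r p.1 • (p.2 : CSpace m) := by fun_prop
    exact this.measurable
  rw [lintegral_prod_symm _ h3.aemeasurable, lintegral_prod _ h1.aemeasurable,
    ] at h2
  simp only [lintegral_const, angleMeasure_univ] at h2
  rw [h2, mul_comm]

theorem circleAverage_eq_angleMeasure (u : ℂ → ℝ) (r : ℝ) :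
    Real.circleAverage u 0 r = (2 * Real.pi)⁻¹ * ∫ θ, u (circleMap 0 r θ) ∂angleMeasure := by
  rw [Real.circleAverage, intervalIntegral.integral_of_le (by positivity), smul_eq_mul]

theorem circleIntegrable_iff_angleMeasure (u : ℂ → ℝ) (r : ℝ) :
    CircleIntegrable u 0 r ↔ Integrable (fun θ => u (circleMap 0 r θ)) angleMeasure := by
  rw [CircleIntegrable, intervalIntegrable_iff_integrableOn_Ioc_of_le (by positivity)]
  rfl

/-- Fubini's theorem: the mean over a sphere as a mean of circle means. -/
theorem sphereMean_fubini {u : CSpace m → ℝ} {r : ℝ}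
    (hint : Integrable (fun ξ : USphere m => u (r • (ξ : CSpace m))) (sphereMeasure m)) :
    (∀ᵐ ξ : USphere m ∂sphereMeasure m, CircleIntegrable (fun ζ => u (ζ • (ξ : CSpace m))) 0 r) ∧
    Integrable (fun ξ : USphere m => Real.circleAverage (fun ζ => u (ζ • (ξ : CSpace m))) 0 r)
      (sphereMeasure m) ∧
    sphereMean u r = ∫ ξ : USphere m, Real.circleAverage (fun ζ => u (ζ • (ξ : CSpace m))) 0 r
      ∂sphereMeasure m := by
  have h1 : Integrable (fun p : ℝ × USphere m => u (r • (p.2 : CSpace m)))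
      (angleMeasure.prod (sphereMeasure m)) := hint.comp_snd angleMeasure
  have h2 := (measurePreserving_skew_rotate (m := m)).integrable_comp_of_integrable h1
  have h2' : Integrable (fun p : ℝ × USphere m => u (circleMap 0 r p.1 • (p.2 : CSpace m)))
      (angleMeasure.prod (sphereMeasure m)) := by
    simpa only [Function.comp_def, real_smul_rotate] using h2
  have e1 : ∫ p : ℝ × USphere m, u (circleMap 0 r p.1 • (p.2 : CSpace m))
      ∂(angleMeasure.prod (sphereMeasure m)) =
      ∫ p : ℝ × USphere m, u (r • (p.2 : CSpace m)) ∂(angleMeasure.prod (sphereMeasure m)) := by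
    have h3 := (measurePreserving_skew_rotate (m := m)).map_eq
    conv_rhs => rw [← h3]
    rw [integral_map measurePreserving_skew_rotate.measurable.aemeasurable]
    · simp only [real_smul_rotate]
    · rw [h3]; exact h1.aestronglyMeasurable
  refine ⟨?_, ?_, ?_⟩
  · filter_upwards [h2'.prod_left_ae] with ξ hξ
    exact (circleIntegrable_iff_angleMeasure _ _).2 hξ
  · simp only [circleAverage_eq_angleMeasure]
    exact h2'.integral_prod_right.const_mul _
  · simp only [circleAverage_eq_angleMeasure]
    rw [integral_const_mul, ← integral_prod_symm _ h2', e1, integral_prod _ h1]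
    simp only [integral_const]
    rw [sphereMean, measureReal_def, angleMeasure_univ, ENNReal.toReal_ofReal (by positivity),
      smul_eq_mul, inv_mul_cancel_left₀ (by positivity)]

open scoped Classical in
/-- The absolute value of `log |x|`, with value `∞` at `x = 0`. -/
noncomputable def absLog (x : ℂ) : ℝ≥0∞ := if x = 0 then ⊤ else ENNReal.ofReal |Real.log ‖x‖|

theorem measurable_absLog : Measurable absLog :=
  Measurable.ite (measurableSet_singleton 0) measurable_const
    (Real.measurable_log.comp measurable_norm).abs.ennreal_ofReal

/-- If log|f| ≤ C with C ≥ 0, then |log|f|| ≤ 2C - log|f|, so a lower bound for the circle mean of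
log|f| controls its absolute mean. -/
theorem lintegral_absLog_circle_le {f : ℂ → ℂ} (hf : AnalyticOnNhd ℂ f Set.univ)
    (hne : ∃ z, f z ≠ 0) {r C : ℝ} (hr : 0 < r) (hC : 0 ≤ C)
    (hfC : ∀ z : ℂ, ‖z‖ = r → Real.log ‖f z‖ ≤ C) :
    ∫⁻ θ, absLog (f (circleMap 0 r θ)) ∂angleMeasure ≤
      ENNReal.ofReal (2 * Real.pi * (2 * C - logMean f r)) := by
  obtain ⟨F, n, g, -, hg0, -, hfg⟩ := exists_eq_prod_mul_of_analyticOnNhd hf hne hr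
  have hnorm : ∀ θ, ‖circleMap 0 r θ‖ = r := fun θ => by simp [abs_of_pos hr]
  have hae : ∀ᵐ θ ∂angleMeasure, f (circleMap 0 r θ) ≠ 0 := by
    refine ae_restrict_of_ae ?_
    filter_upwards [(F.countable_toSet.preimage_circleMap 0 hr.ne').ae_notMem volume] with θ hθ
    have hmem : circleMap 0 r θ ∈ Metric.closedBall (0 : ℂ) r := by simp [abs_of_pos hr]
    rw [hfg _ hmem]
    refine mul_ne_zero (Finset.prod_ne_zero_iff.2 fun a ha => pow_ne_zero _ (sub_ne_zero.2 ?_))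
      (hg0 _ hmem)
    intro h
    exact hθ (show circleMap 0 r θ ∈ (F : Set ℂ) by rw [h]; exact ha)
  have hint : CircleIntegrable (fun z => 2 * C - Real.log ‖f z‖) 0 r :=
    (circleIntegrable_const _ _ _).sub
      (circleIntegrable_log_norm_of_analyticOnNhd (hf.mono (Set.subset_univ _)))
  have hint' := (circleIntegrable_iff_angleMeasure _ _).1 hint
  calc ∫⁻ θ, absLog (f (circleMap 0 r θ)) ∂angleMeasure
      ≤ ∫⁻ θ, ENNReal.ofReal (2 * C - Real.log ‖f (circleMap 0 r θ)‖) ∂angleMeasure := by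
        refine lintegral_mono_ae ?_
        filter_upwards [hae] with θ hθ
        rw [absLog, if_neg hθ]
        refine ENNReal.ofReal_le_ofReal ?_
        have := hfC _ (hnorm θ)
        rw [abs_le]
        constructor <;> linarith
    _ = ENNReal.ofReal (2 * Real.pi * (2 * C - logMean f r)) := by
        rw [← ofReal_integral_eq_lintegral_ofReal hint']
        · congr 1
          have h1 := circleAverage_eq_angleMeasure (fun z => 2 * C - Real.log ‖f z‖) r
          rw [Real.circleAverage_fun_sub (circleIntegrable_const _ _ _)
            (circleIntegrable_log_norm_of_analyticOnNhd (hf.mono (Set.subset_univ _))),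
            Real.circleAverage_const] at h1
          rw [logMean, h1, mul_inv_cancel_left₀ (by positivity)]
        · refine ae_of_all _ fun θ => ?_
          have := hfC _ (hnorm θ)
          simp only [Pi.zero_apply]
          linarith

/-- The restriction of an entire function to the complex line through `0` and `ξ`. -/
def Entire.onLine (g : Entire m) (ξ : CSpace m) (ζ : ℂ) : ℂ := g.1 (ζ • ξ)

theorem Entire.analyticOnNhd_onLine (g : Entire m) (ξ : CSpace m) :
    AnalyticOnNhd ℂ (g.onLine ξ) Set.univ := fun ζ _ =>
  AnalyticAt.fun_comp (f := fun ζ : ℂ => ζ • ξ) (g.2 (ζ • ξ) (Set.mem_univ _))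
    (((ContinuousLinearMap.id ℂ ℂ).smulRight ξ).analyticAt ζ)

theorem Entire.continuous (g : Entire m) : Continuous g.1 :=
  continuous_iff_continuousAt.2 fun z => (g.2 z (Set.mem_univ z)).continuousAt

theorem Entire.exists_log_norm_le (g : Entire m) (ρ : ℝ) :
    ∃ C : ℝ, 0 ≤ C ∧ ∀ z : CSpace m, ‖z‖ ≤ ρ → Real.log ‖g.1 z‖ ≤ C := by
  obtain ⟨B, hB⟩ := (isCompact_closedBall (0 : CSpace m) ρ).exists_bound_of_continuousOn
    g.continuous.continuousOn
  refine ⟨Real.log (max B 1), Real.log_nonneg (le_max_right _ _), fun z hz => ?_⟩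
  have h1 := hB z (by simpa using hz)
  rcases eq_or_ne (g.1 z) 0 with h0 | h0
  · rw [h0, norm_zero, Real.log_zero]; exact Real.log_nonneg (le_max_right _ _)
  · exact Real.log_le_log (norm_pos_iff.2 h0) (h1.trans (le_max_left _ _))

theorem norm_smul_coe_sphere (ζ : ℂ) (ξ : USphere m) : ‖ζ • (ξ : CSpace m)‖ = ‖ζ‖ := by
  have : ‖(ξ : CSpace m)‖ = 1 := by simp
  rw [norm_smul, this, mul_one]

theorem norm_real_smul_coe_sphere {r : ℝ} (hr : 0 ≤ r) (ξ : USphere m) :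
    ‖r • (ξ : CSpace m)‖ = r := by
  have : ‖(ξ : CSpace m)‖ = 1 := by simp
  rw [norm_smul, this, mul_one, Real.norm_of_nonneg hr]

theorem Entire.measurable_absLog (g : Entire m) : Measurable fun z => absLog (g.1 z) :=
  _root_.measurable_absLog.comp g.continuous.measurable

/-- On every complex line through 0 the circle mean is at least log|h(0)|, a bound independent of
the line. -/
theorem Entire.lintegral_absLog_sphere_le_of_ne_zero [Nontrivial (CSpace m)] (h : Entire m)
    (h0 : h.1 0 ≠ 0) {r C : ℝ} (hr : 0 < r) (hC : 0 ≤ C)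
    (hhC : ∀ z : CSpace m, ‖z‖ ≤ r → Real.log ‖h.1 z‖ ≤ C) :
    ENNReal.ofReal (2 * Real.pi) *
      ∫⁻ ξ : USphere m, absLog (h.1 (r • (ξ : CSpace m))) ∂sphereMeasure m ≤
      ENNReal.ofReal (2 * Real.pi * (2 * C - Real.log ‖h.1 0‖)) := by
  rw [lintegral_sphere_eq_lintegral_circle h.measurable_absLog]
  calc _ ≤ ∫⁻ _ : USphere m, ENNReal.ofReal (2 * Real.pi * (2 * C - Real.log ‖h.1 0‖))
        ∂sphereMeasure m := by
        refine lintegral_mono fun ξ => ?_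
        have hz : h.onLine ξ 0 = h.1 0 := by simp [Entire.onLine]
        refine (lintegral_absLog_circle_le (h.analyticOnNhd_onLine ξ) ⟨0, by rwa [hz]⟩ hr hC
          fun z hz => hhC _ (by rw [norm_smul_coe_sphere, hz])).trans ?_
        refine ENNReal.ofReal_le_ofReal (mul_le_mul_of_nonneg_left ?_ (by positivity))
        have := log_norm_zero_le_logMean (h.analyticOnNhd_onLine ξ) (by rwa [hz]) hr
        rw [hz] at this
        linarith
    _ = _ := by rw [lintegral_const, measure_univ, mul_one]

theorem lintegral_eq_lintegral_polar [Nontrivial (CSpace m)] {φ : CSpace m → ℝ≥0∞}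
    (hφ : Measurable φ) :
    ∫⁻ z, φ z = ∫⁻ t : Set.Ioi (0 : ℝ), ∫⁻ ξ : USphere m, φ (t.1 • (ξ : CSpace m))
      ∂(volume : Measure (CSpace m)).toSphere
      ∂Measure.volumeIoiPow (Module.finrank ℝ (CSpace m) - 1) := by
  have hc : Continuous fun p : USphere m × Set.Ioi (0 : ℝ) => p.2.1 • (p.1 : CSpace m) := by
    fun_prop
  have h1 : Measurable fun p : USphere m × Set.Ioi (0 : ℝ) => φ (p.2.1 • (p.1 : CSpace m)) :=
    hφ.comp hc.measurable
  rw [← lintegral_prod_symm _ h1.aemeasurable,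
    ← ((volume : Measure (CSpace m)).measurePreserving_homeomorphUnitSphereProd).lintegral_comp h1]
  have e : ∀ z : ({0}ᶜ : Set (CSpace m)),
      ((homeomorphUnitSphereProd (CSpace m) z).2.1 •
        ((homeomorphUnitSphereProd (CSpace m) z).1 : CSpace m)) = z := by
    intro z
    have hz : ‖(z : CSpace m)‖ ≠ 0 := norm_ne_zero_iff.2 z.2
    simp [smul_smul, mul_inv_cancel₀ hz]
  simp only [e]
  rw [lintegral_subtype_comap (measurableSet_singleton _).compl φ, restrict_compl_singleton]

end Sphere

/-! ### Integrability of log|g| over every sphere, including the case g(0) = 0. -/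

section LogIntegrability

variable {m : ℕ}

theorem toSphere_eq_smul_sphereMeasure [Nontrivial (CSpace m)] :
    (volume : Measure (CSpace m)).toSphere =
      (volume : Measure (CSpace m)).toSphere Set.univ • sphereMeasure m := by
  rw [sphereMeasure, smul_smul, ENNReal.mul_inv_cancel, one_smul]
  · rw [Ne, Measure.measure_univ_eq_zero]
    exact Measure.toSphere_ne_zero _
  · exact measure_ne_top _ _

theorem Entire.lintegral_absLog_ball_lt_top_of_ne_zero [Nontrivial (CSpace m)] (h : Entire m)
    (h0 : h.1 0 ≠ 0) {ρ : ℝ} (hρ : 0 < ρ) :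
    ∫⁻ z in Metric.ball (0 : CSpace m) ρ, absLog (h.1 z) < ⊤ := by
  obtain ⟨C, hC, hhC⟩ := h.exists_log_norm_le ρ
  set c := (volume : Measure (CSpace m)).toSphere Set.univ with hc
  set b := ENNReal.ofReal (2 * Real.pi * (2 * C - Real.log ‖h.1 0‖)) /
    ENNReal.ofReal (2 * Real.pi) with hb
  have hpi : ENNReal.ofReal (2 * Real.pi) ≠ 0 := by
    simp [Real.pi_pos]
  have hbtop : b ≠ ⊤ := ENNReal.div_ne_top ENNReal.ofReal_ne_top hpi
  rw [← lintegral_indicator measurableSet_ball, lintegral_eq_lintegral_polar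
    (h.measurable_absLog.indicator measurableSet_ball)]
  have hle : ∀ t : Set.Ioi (0 : ℝ), ∫⁻ ξ : USphere m, (Metric.ball (0 : CSpace m) ρ).indicator
      (fun z => absLog (h.1 z)) (t.1 • (ξ : CSpace m)) ∂(volume : Measure (CSpace m)).toSphere ≤
      (Set.Iio (⟨ρ, hρ⟩ : Set.Ioi (0 : ℝ))).indicator (fun _ => c * b) t := by
    intro t
    by_cases ht : t.1 < ρ
    · rw [Set.indicator_of_mem (show t ∈ Set.Iio (⟨ρ, hρ⟩ : Set.Ioi (0 : ℝ)) from ht),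
        toSphere_eq_smul_sphereMeasure, lintegral_smul_measure, smul_eq_mul]
      refine mul_le_mul_right ?_ _
      rw [hb, ENNReal.le_div_iff_mul_le (Or.inl hpi) (Or.inl ENNReal.ofReal_ne_top), mul_comm]
      refine le_trans (mul_le_mul_right (lintegral_mono fun ξ => ?_) _)
        (h.lintegral_absLog_sphere_le_of_ne_zero h0 (r := t.1) t.2 hC
          fun z hz => hhC z (hz.trans ht.le))
      exact Set.indicator_le_self _ _ _
    · have : ∀ ξ : USphere m, t.1 • (ξ : CSpace m) ∉ Metric.ball (0 : CSpace m) ρ := by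
        intro ξ
        rw [mem_ball_zero_iff, norm_real_smul_coe_sphere (le_of_lt t.2)]
        exact ht
      simp only [Set.indicator_of_notMem (this _), lintegral_zero]
      exact zero_le
  refine (lintegral_mono hle).trans_lt ?_
  rw [lintegral_indicator measurableSet_Iio, setLIntegral_const,
    Measure.volumeIoiPow_apply_Iio]
  exact ENNReal.mul_lt_top (ENNReal.mul_lt_top (measure_lt_top _ _) hbtop.lt_top)
    ENNReal.ofReal_lt_top

/-- Translation of an entire function. -/
def Entire.translate (g : Entire m) (z₀ : CSpace m) : Entire m :=
  ⟨fun z => g.1 (z + z₀), fun z _ =>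
    AnalyticAt.fun_comp (f := fun z => z + z₀) (g.2 (z + z₀) (Set.mem_univ _))
      (analyticAt_id.add analyticAt_const)⟩

theorem Entire.exists_ne_zero {g : Entire m} (hg : g ≠ 0) : ∃ z, g.1 z ≠ 0 := by
  by_contra h
  push Not at h
  exact hg (Subtype.ext (funext h))

/-- Spheres cannot be recentred, but balls can: translate a point where g is nonzero to the origin
and enlarge the ball. This is why the argument passes through volume integrals. -/
theorem Entire.lintegral_absLog_ball_lt_top [Nontrivial (CSpace m)] {g : Entire m} (hg : g ≠ 0)
    {ρ : ℝ} (hρ : 0 < ρ) : ∫⁻ z in Metric.ball (0 : CSpace m) ρ, absLog (g.1 z) < ⊤ := by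
  obtain ⟨z₀, hz₀⟩ := Entire.exists_ne_zero hg
  have h1 := (g.translate z₀).lintegral_absLog_ball_lt_top_of_ne_zero (ρ := ρ + ‖z₀‖)
    (by simpa [Entire.translate] using hz₀) (by positivity)
  refine lt_of_le_of_lt ?_ h1
  rw [← lintegral_indicator measurableSet_ball, ← lintegral_indicator measurableSet_ball,
    ← lintegral_add_right_eq_self _ z₀]
  refine lintegral_mono fun z => ?_
  by_cases hz : z + z₀ ∈ Metric.ball (0 : CSpace m) ρ
  · have hz' : z ∈ Metric.ball (0 : CSpace m) (ρ + ‖z₀‖) := by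
      rw [mem_ball_zero_iff] at hz ⊢
      have := norm_sub_le (z + z₀) z₀
      rw [add_sub_cancel_right] at this
      linarith
    rw [Set.indicator_of_mem hz, Set.indicator_of_mem hz']
    rfl
  · rw [Set.indicator_of_notMem hz]
    exact zero_le

/-- In polar coordinates, infinite integrals over all small spheres would make the integral over the
ball infinite. -/
theorem Entire.exists_radius_lintegral_absLog_lt_top [Nontrivial (CSpace m)] {g : Entire m}
    (hg : g ≠ 0) {ρ : ℝ} (hρ : 0 < ρ) :
    ∃ t, 0 < t ∧ t < ρ ∧
      ∫⁻ ξ : USphere m, absLog (g.1 (t • (ξ : CSpace m))) ∂sphereMeasure m < ⊤ := by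
  have h1 := Entire.lintegral_absLog_ball_lt_top hg hρ
  rw [← lintegral_indicator measurableSet_ball, lintegral_eq_lintegral_polar
    (g.measurable_absLog.indicator measurableSet_ball)] at h1
  by_contra! hcon
  have hc0 : (volume : Measure (CSpace m)).toSphere Set.univ ≠ 0 := by
    rw [Ne, Measure.measure_univ_eq_zero]
    exact Measure.toSphere_ne_zero _
  have hle : ∀ t : Set.Ioi (0 : ℝ), (Set.Iio (⟨ρ, hρ⟩ : Set.Ioi (0 : ℝ))).indicator (fun _ => ⊤) t ≤
      ∫⁻ ξ : USphere m, (Metric.ball (0 : CSpace m) ρ).indicator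
      (fun z => absLog (g.1 z)) (t.1 • (ξ : CSpace m)) ∂(volume : Measure (CSpace m)).toSphere := by
    intro t
    by_cases ht : t.1 < ρ
    · have hmem : ∀ ξ : USphere m, t.1 • (ξ : CSpace m) ∈ Metric.ball (0 : CSpace m) ρ := by
        intro ξ
        rw [mem_ball_zero_iff, norm_real_smul_coe_sphere (le_of_lt t.2)]
        exact ht
      simp only [Set.indicator_of_mem (hmem _)]
      rw [Set.indicator_of_mem (show t ∈ Set.Iio (⟨ρ, hρ⟩ : Set.Ioi (0 : ℝ)) from ht),
        toSphere_eq_smul_sphereMeasure, lintegral_smul_measure, smul_eq_mul,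
        top_le_iff.1 (hcon t.1 t.2 ht), ENNReal.mul_top hc0]
    · rw [Set.indicator_of_notMem (show t ∉ Set.Iio (⟨ρ, hρ⟩ : Set.Ioi (0 : ℝ)) from ht)]
      exact zero_le
  have h2 := (lintegral_mono hle).trans_lt h1
  rw [lintegral_indicator measurableSet_Iio, setLIntegral_const,
    Measure.volumeIoiPow_apply_Iio, ENNReal.top_mul] at h2
  · exact lt_irrefl _ h2
  · have : 0 < ρ ^ (Module.finrank ℝ (CSpace m) - 1 + 1) /
        (((Module.finrank ℝ (CSpace m) - 1 : ℕ) : ℝ) + 1) := by positivity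
    simpa using this

/-- The value ∞ of `absLog` at 0 makes one finite integral yield both conclusions. -/
theorem integrable_and_ae_ne_zero_of_lintegral_absLog_lt_top {α : Type*} [MeasurableSpace α]
    {μ : Measure α} {f : α → ℂ} (hf : Measurable f) (h : ∫⁻ x, absLog (f x) ∂μ < ⊤) :
    Integrable (fun x => Real.log ‖f x‖) μ ∧ ∀ᵐ x ∂μ, f x ≠ 0 := by
  have hae : ∀ᵐ x ∂μ, f x ≠ 0 := by
    filter_upwards [ae_lt_top (measurable_absLog.comp hf) h.ne] with x hx h0
    simp [absLog, h0] at hx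
  refine ⟨⟨(Real.measurable_log.comp hf.norm).aestronglyMeasurable, ?_⟩, hae⟩
  refine lt_of_le_of_lt (lintegral_mono_ae ?_) h
  filter_upwards [hae] with x hx
  rw [absLog, if_neg hx, ← ofReal_norm, Real.norm_eq_abs]

theorem Entire.measurable_sphere (g : Entire m) (r : ℝ) :
    Measurable fun ξ : USphere m => g.1 (r • (ξ : CSpace m)) := by
  have : Continuous fun ξ : USphere m => r • (ξ : CSpace m) := by fun_prop
  exact (g.continuous.comp this).measurable

/-- Integrability at one small radius t propagates to r: along almost every line the circle mean at
r is at least that at t, and the latter is integrable in ξ. This supplies the lower bound that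
log|g(0)| gives when g(0) ≠ 0. -/
theorem Entire.integrable_log_norm_and_ae_ne_zero [Nontrivial (CSpace m)] {g : Entire m}
    (hg : g ≠ 0) {r : ℝ} (hr : 0 < r) :
    Integrable (fun ξ : USphere m => Real.log ‖g.1 (r • (ξ : CSpace m))‖) (sphereMeasure m) ∧
      ∀ᵐ ξ : USphere m ∂sphereMeasure m, g.1 (r • (ξ : CSpace m)) ≠ 0 := by
  obtain ⟨t, ht0, htr, ht⟩ := Entire.exists_radius_lintegral_absLog_lt_top hg hr
  obtain ⟨hint, hae⟩ := integrable_and_ae_ne_zero_of_lintegral_absLog_lt_top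
    (g.measurable_sphere t) ht
  obtain ⟨-, hA, -⟩ := sphereMean_fubini (u := fun z => Real.log ‖g.1 z‖) hint
  obtain ⟨C, hC, hgC⟩ := g.exists_log_norm_le r
  refine integrable_and_ae_ne_zero_of_lintegral_absLog_lt_top (g.measurable_sphere r) ?_
  have h1 := lintegral_sphere_eq_lintegral_circle g.measurable_absLog r
  have h2 : ∫⁻ ξ : USphere m, ∫⁻ θ, absLog (g.1 (circleMap 0 r θ • (ξ : CSpace m))) ∂angleMeasure
      ∂sphereMeasure m < ⊤ := by
    have hint2 : Integrable (fun ξ : USphere m => 2 * Real.pi * (2 * C - Real.circleAverage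
        (fun ζ => Real.log ‖g.1 (ζ • (ξ : CSpace m))‖) 0 t)) (sphereMeasure m) :=
      ((integrable_const _).sub hA).const_mul _
    refine lt_of_le_of_lt (lintegral_mono_ae ?_) (hasFiniteIntegral_iff_norm _ |>.1 hint2.2)
    filter_upwards [hae] with ξ hξ
    have hne : ∃ ζ, g.onLine ξ ζ ≠ 0 := ⟨(t : ℂ), by simpa [Entire.onLine] using hξ⟩
    refine (lintegral_absLog_circle_le (g.analyticOnNhd_onLine ξ) hne hr hC
      fun z hz => hgC _ (by rw [norm_smul_coe_sphere, hz])).trans ?_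
    refine ENNReal.ofReal_le_ofReal (le_trans ?_ (le_abs_self _))
    refine mul_le_mul_of_nonneg_left ?_ (by positivity)
    have := logMean_mono (g.analyticOnNhd_onLine ξ) hne ht0 htr.le
    rw [logMean] at this
    simp only [Entire.onLine] at this ⊢
    linarith
  rw [← h1] at h2
  have hpi : ENNReal.ofReal (2 * Real.pi) ≠ 0 := by simp [Real.pi_pos]
  by_contra htop
  rw [not_lt, top_le_iff] at htop
  rw [htop, ENNReal.mul_top hpi] at h2
  exact lt_irrefl _ h2

theorem Entire.integrable_log_norm [Nontrivial (CSpace m)] {g : Entire m} (hg : g ≠ 0) {r : ℝ}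
    (hr : 0 < r) :
    Integrable (fun ξ : USphere m => Real.log ‖g.1 (r • (ξ : CSpace m))‖) (sphereMeasure m) :=
  (Entire.integrable_log_norm_and_ae_ne_zero hg hr).1

theorem Entire.ae_sphere_ne_zero [Nontrivial (CSpace m)] {g : Entire m} (hg : g ≠ 0) {r : ℝ}
    (hr : 0 < r) : ∀ᵐ ξ : USphere m ∂sphereMeasure m, g.1 (r • (ξ : CSpace m)) ≠ 0 :=
  (Entire.integrable_log_norm_and_ae_ne_zero hg hr).2

end LogIntegrability

/-! ### Growth functions on spheres, the first main theorem and the q-difference estimate. -/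

section GrowthFunctions

variable {m : ℕ}

/-- The mean of `log |g|` over the sphere `‖z‖ = r`. -/
noncomputable def Entire.sphereLogMean (g : Entire m) (r : ℝ) : ℝ :=
  sphereMean (fun z => Real.log ‖g.1 z‖) r

theorem Entire.ae_exists_onLine_ne_zero [Nontrivial (CSpace m)] {g : Entire m} (hg : g ≠ 0) :
    ∀ᵐ ξ : USphere m ∂sphereMeasure m, ∃ ζ, g.onLine (ξ : CSpace m) ζ ≠ 0 := by
  filter_upwards [Entire.ae_sphere_ne_zero hg one_pos] with ξ hξ
  exact ⟨1, by simpa [Entire.onLine] using hξ⟩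

theorem Entire.integrable_logMean_onLine [Nontrivial (CSpace m)] {g : Entire m} (hg : g ≠ 0)
    {r : ℝ} (hr : 0 < r) :
    Integrable (fun ξ : USphere m => logMean (g.onLine (ξ : CSpace m)) r) (sphereMeasure m) :=
  (sphereMean_fubini (u := fun z => Real.log ‖g.1 z‖) (Entire.integrable_log_norm hg hr)).2.1

theorem Entire.sphereLogMean_eq [Nontrivial (CSpace m)] {g : Entire m} (hg : g ≠ 0)
    {r : ℝ} (hr : 0 < r) :
    g.sphereLogMean r = ∫ ξ : USphere m, logMean (g.onLine (ξ : CSpace m)) r ∂sphereMeasure m :=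
  (sphereMean_fubini (u := fun z => Real.log ‖g.1 z‖) (Entire.integrable_log_norm hg hr)).2.2

theorem Entire.sphereLogMean_mono [Nontrivial (CSpace m)] {g : Entire m} (hg : g ≠ 0)
    {r R : ℝ} (hr : 0 < r) (hrR : r ≤ R) : g.sphereLogMean r ≤ g.sphereLogMean R := by
  rw [Entire.sphereLogMean_eq hg hr, Entire.sphereLogMean_eq hg (hr.trans_le hrR)]
  refine integral_mono_ae (Entire.integrable_logMean_onLine hg hr)
    (Entire.integrable_logMean_onLine hg (hr.trans_le hrR)) ?_
  filter_upwards [Entire.ae_exists_onLine_ne_zero hg] with ξ hξ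
  exact logMean_mono (g.analyticOnNhd_onLine ξ) hξ hr hrR

theorem Entire.log_le_sphereLogMean_sub [Nontrivial (CSpace m)] {g : Entire m} (hg : g ≠ 0)
    (h0 : g.1 0 = 0) {r : ℝ} (hr : 1 ≤ r) :
    Real.log r ≤ g.sphereLogMean r - g.sphereLogMean 1 := by
  have hr0 : 0 < r := one_pos.trans_le hr
  rw [Entire.sphereLogMean_eq hg hr0, Entire.sphereLogMean_eq hg one_pos, ← integral_sub
    (Entire.integrable_logMean_onLine hg hr0) (Entire.integrable_logMean_onLine hg one_pos)]
  calc Real.log r = ∫ _ : USphere m, Real.log r ∂sphereMeasure m := by simp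
    _ ≤ _ := by
      refine integral_mono_ae (integrable_const _) ((Entire.integrable_logMean_onLine hg hr0).sub
        (Entire.integrable_logMean_onLine hg one_pos)) ?_
      filter_upwards [Entire.ae_exists_onLine_ne_zero hg] with ξ hξ
      exact log_le_logMean_sub (g.analyticOnNhd_onLine ξ) hξ (by simpa [Entire.onLine] using h0) hr

/-- The mean of `max (log |f₀|) (log |f₁|)` over the sphere `‖z‖ = r`. -/
noncomputable def maxLogMean (f₀ f₁ : Entire m) (r : ℝ) : ℝ :=
  sphereMean (fun z => max (Real.log ‖f₀.1 z‖) (Real.log ‖f₁.1 z‖)) r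

theorem dilate_ne_zero {g : Entire m} (hg : g ≠ 0) (q : ℂˣ) : Entire.dilate q g ≠ 0 :=
  (map_ne_zero_iff _ (Entire.dilate_injective q)).2 hg

section MaxLogMean

variable [Nontrivial (CSpace m)] {f₀ f₁ : Entire m}

theorem integrable_max_log (h₀ : f₀ ≠ 0) (h₁ : f₁ ≠ 0) {r : ℝ} (hr : 0 < r) :
    Integrable (fun ξ : USphere m => max (Real.log ‖f₀.1 (r • (ξ : CSpace m))‖)
      (Real.log ‖f₁.1 (r • (ξ : CSpace m))‖)) (sphereMeasure m) :=
  (Entire.integrable_log_norm h₀ hr).sup (Entire.integrable_log_norm h₁ hr)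

theorem sphereLogMean_le_maxLogMean_left (h₀ : f₀ ≠ 0) (h₁ : f₁ ≠ 0) {r : ℝ} (hr : 0 < r) :
    f₀.sphereLogMean r ≤ maxLogMean f₀ f₁ r :=
  integral_mono (Entire.integrable_log_norm h₀ hr) (integrable_max_log h₀ h₁ hr)
    fun _ => le_max_left _ _

theorem sphereLogMean_le_maxLogMean_right (h₀ : f₀ ≠ 0) (h₁ : f₁ ≠ 0) {r : ℝ} (hr : 0 < r) :
    f₁.sphereLogMean r ≤ maxLogMean f₀ f₁ r :=
  integral_mono (Entire.integrable_log_norm h₁ hr) (integrable_max_log h₀ h₁ hr)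
    fun _ => le_max_right _ _

/-- Cartan's identity: Jensen's formula on the unit circle applied to b(ζ + a/b). -/
theorem circleAverage_log_norm_add_mul_eq_max {a b : ℂ} (ha : a ≠ 0) (hb : b ≠ 0) :
    CircleIntegrable (fun ζ => Real.log ‖a + ζ * b‖) 0 1 ∧
    Real.circleAverage (fun ζ => Real.log ‖a + ζ * b‖) 0 1 =
      max (Real.log ‖a‖) (Real.log ‖b‖) := by
  constructor
  · exact circleIntegrable_log_norm_of_analyticOnNhd fun z _ => by fun_prop
  · have hab : ‖-(a / b)‖ = ‖a‖ / ‖b‖ := by rw [norm_neg, norm_div]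
    have hi : CircleIntegrable (fun ζ => Real.log ‖ζ - -(a / b)‖) 0 1 :=
      circleIntegrable_log_norm_of_analyticOnNhd fun z _ => by fun_prop
    have hpa := norm_pos_iff.2 ha
    have hpb := norm_pos_iff.2 hb
    calc Real.circleAverage (fun ζ => Real.log ‖a + ζ * b‖) 0 1
        = Real.circleAverage (fun ζ => Real.log ‖b‖ + Real.log ‖ζ - -(a / b)‖) 0 1 := by
          refine circleAverage_congr_off_countable one_pos (Set.countable_singleton (-(a / b)))
            fun ζ _ hζ => ?_
          rw [← Real.log_mul hpb.ne' (norm_ne_zero_iff.2 (sub_ne_zero.2 hζ)), ← norm_mul]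
          congr 2
          field_simp
          ring
      _ = _ := by
          rw [Real.circleAverage_fun_add (circleIntegrable_const _ _ _) hi,
            Real.circleAverage_const, circleAverage_log_norm_sub_eq_log_max _ one_pos, hab,
            ← Real.log_mul hpb.ne' (by positivity), mul_max_of_nonneg _ _ hpb.le, mul_one,
            mul_div_cancel₀ _ hpb.ne', max_comm,
            Real.strictMonoOn_log.monotoneOn.map_max hpa hpb]

/-- Subtracting the logarithm from an upper bound C gives a nonnegative function, so joint
integrability reduces to iterated integrals; Cartan's identity evaluates the inner one. -/
theorem integrable_log_norm_add_circle_mul (h₀ : f₀ ≠ 0) (h₁ : f₁ ≠ 0) {r : ℝ} (hr : 0 < r) :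
    Integrable (fun p : USphere m × ℝ => Real.log ‖f₀.1 (r • (p.1 : CSpace m)) +
      circleMap 0 1 p.2 * f₁.1 (r • (p.1 : CSpace m))‖)
      ((sphereMeasure m).prod angleMeasure) := by
  obtain ⟨B₀, hB₀⟩ := (isCompact_closedBall (0 : CSpace m) r).exists_bound_of_continuousOn
    f₀.continuous.continuousOn
  obtain ⟨B₁, hB₁⟩ := (isCompact_closedBall (0 : CSpace m) r).exists_bound_of_continuousOn
    f₁.continuous.continuousOn
  set C := Real.log (max (B₀ + B₁) 1) with hC
  have hC0 : 0 ≤ C := Real.log_nonneg (le_max_right _ _)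
  have hle : ∀ p : USphere m × ℝ, Real.log ‖f₀.1 (r • (p.1 : CSpace m)) +
      circleMap 0 1 p.2 * f₁.1 (r • (p.1 : CSpace m))‖ ≤ C := by
    intro p
    have hz : r • (p.1 : CSpace m) ∈ Metric.closedBall (0 : CSpace m) r := by
      rw [mem_closedBall_zero_iff, norm_real_smul_coe_sphere hr.le]
    set x := f₀.1 (r • (p.1 : CSpace m)) + circleMap 0 1 p.2 * f₁.1 (r • (p.1 : CSpace m)) with hx
    rcases eq_or_ne x 0 with h | h
    · rw [h, norm_zero, Real.log_zero]; exact hC0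
    · refine Real.log_le_log (norm_pos_iff.2 h) (le_trans ?_ (le_max_left _ _))
      refine (norm_add_le _ _).trans (add_le_add (hB₀ _ hz) ?_)
      rw [norm_mul, norm_circleMap_zero, abs_one, one_mul]
      exact hB₁ _ hz
  have hcont : Continuous fun p : USphere m × ℝ => f₀.1 (r • (p.1 : CSpace m)) +
      circleMap 0 1 p.2 * f₁.1 (r • (p.1 : CSpace m)) := by
    have c1 : Continuous fun p : USphere m × ℝ => r • (p.1 : CSpace m) := by fun_prop
    have c2 : Continuous fun p : USphere m × ℝ => circleMap 0 1 p.2 := by fun_prop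
    exact (f₀.continuous.comp c1).add (c2.mul (f₁.continuous.comp c1))
  have hmeas := Real.measurable_log.comp hcont.measurable.norm
  have key : Integrable (fun p : USphere m × ℝ => C - Real.log ‖f₀.1 (r • (p.1 : CSpace m)) +
      circleMap 0 1 p.2 * f₁.1 (r • (p.1 : CSpace m))‖)
      ((sphereMeasure m).prod angleMeasure) := by
    have hmeas' : Measurable fun p : USphere m × ℝ => C - Real.log ‖f₀.1 (r • (p.1 : CSpace m)) +
      circleMap 0 1 p.2 * f₁.1 (r • (p.1 : CSpace m))‖ := measurable_const.sub hmeas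
    refine (integrable_prod_iff hmeas'.aestronglyMeasurable).2 ?_
    have hae : ∀ᵐ ξ : USphere m ∂sphereMeasure m, f₀.1 (r • (ξ : CSpace m)) ≠ 0 ∧
        f₁.1 (r • (ξ : CSpace m)) ≠ 0 :=
      (Entire.ae_sphere_ne_zero h₀ hr).and (Entire.ae_sphere_ne_zero h₁ hr)
    constructor
    · filter_upwards [hae] with ξ hξ
      exact (integrable_const _).sub ((circleIntegrable_iff_angleMeasure _ _).1
        (circleAverage_log_norm_add_mul_eq_max hξ.1 hξ.2).1)
    · refine Integrable.congr (f := fun ξ : USphere m => 2 * Real.pi *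
        (C - max (Real.log ‖f₀.1 (r • (ξ : CSpace m))‖) (Real.log ‖f₁.1 (r • (ξ : CSpace m))‖)))
        (((integrable_const _).sub (integrable_max_log h₀ h₁ hr)).const_mul _) ?_
      filter_upwards [hae] with ξ hξ
      obtain ⟨i1, i2⟩ := circleAverage_log_norm_add_mul_eq_max hξ.1 hξ.2
      have e : ∀ θ, ‖C - Real.log ‖f₀.1 (r • (ξ : CSpace m)) +
          circleMap 0 1 θ * f₁.1 (r • (ξ : CSpace m))‖‖ = C - Real.log ‖f₀.1 (r • (ξ : CSpace m)) +
          circleMap 0 1 θ * f₁.1 (r • (ξ : CSpace m))‖ := fun θ =>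
        Real.norm_of_nonneg (sub_nonneg.2 (hle (ξ, θ)))
      simp only [e]
      rw [circleAverage_eq_angleMeasure] at i2
      rw [integral_sub (integrable_const _) ((circleIntegrable_iff_angleMeasure _ _).1 i1), ← i2,
        integral_const, measureReal_def, angleMeasure_univ,
        ENNReal.toReal_ofReal (by positivity), smul_eq_mul, mul_sub,
        mul_inv_cancel_left₀ (by positivity)]
  have h2 := (integrable_const C).sub key
  refine h2.congr (ae_of_all _ fun p => ?_)
  simp

/-- By Cartan's identity this is an average over θ of the means of log|f₀ + e^{iθ} f₁|, each
increasing in the radius. -/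
theorem maxLogMean_mono (h₀ : f₀ ≠ 0) (h₁ : f₁ ≠ 0) (hne : ∀ c : ℂ, f₀ + c • f₁ ≠ 0) {r R : ℝ}
    (hr : 0 < r) (hrR : r ≤ R) : maxLogMean f₀ f₁ r ≤ maxLogMean f₀ f₁ R := by
  have key : ∀ ρ : ℝ, 0 < ρ →
      Integrable (fun θ => (f₀ + circleMap 0 1 θ • f₁).sphereLogMean ρ) angleMeasure ∧
      maxLogMean f₀ f₁ ρ = (2 * Real.pi)⁻¹ *
        ∫ θ, (f₀ + circleMap 0 1 θ • f₁).sphereLogMean ρ ∂angleMeasure := by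
    intro ρ hρ
    have hint := integrable_log_norm_add_circle_mul h₀ h₁ hρ
    refine ⟨hint.integral_prod_right, ?_⟩
    have hswap := integral_integral_swap (f := fun (ξ : USphere m) (θ : ℝ) =>
      Real.log ‖f₀.1 (ρ • (ξ : CSpace m)) + circleMap 0 1 θ * f₁.1 (ρ • (ξ : CSpace m))‖) hint
    have e2 : ∀ θ, (f₀ + circleMap 0 1 θ • f₁).sphereLogMean ρ = ∫ ξ : USphere m,
      Real.log ‖f₀.1 (ρ • (ξ : CSpace m)) + circleMap 0 1 θ * f₁.1 (ρ • (ξ : CSpace m))‖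
        ∂sphereMeasure m := fun θ => rfl
    simp only [e2]
    rw [← hswap, ← integral_const_mul, maxLogMean, sphereMean]
    refine integral_congr_ae ?_
    filter_upwards [Entire.ae_sphere_ne_zero h₀ hρ, Entire.ae_sphere_ne_zero h₁ hρ] with ξ x0 x1
    rw [← (circleAverage_log_norm_add_mul_eq_max x0 x1).2, circleAverage_eq_angleMeasure]
  rw [(key r hr).2, (key R (hr.trans_le hrR)).2]
  refine mul_le_mul_of_nonneg_left ?_ (by positivity)
  exact integral_mono (key r hr).1 (key R (hr.trans_le hrR)).1 fun θ =>
    Entire.sphereLogMean_mono (hne _) hr hrR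

/-- Either f₁ or a combination f₀ + c f₁ vanishes at the origin without vanishing identically, so
its logarithmic mean grows at least like log r; that mean is at most `maxLogMean` plus a constant.
-/
theorem exists_log_le_maxLogMean (h₀ : f₀ ≠ 0) (h₁ : f₁ ≠ 0) (hne : ∀ c : ℂ, f₀ + c • f₁ ≠ 0) :
    ∃ C : ℝ, ∀ r, 1 ≤ r → Real.log r - C ≤ maxLogMean f₀ f₁ r := by
  by_cases h : f₁.1 0 = 0
  · refine ⟨-f₁.sphereLogMean 1, fun r hr => ?_⟩
    have e1 := Entire.log_le_sphereLogMean_sub h₁ h hr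
    have e2 := sphereLogMean_le_maxLogMean_right h₀ h₁ (one_pos.trans_le hr)
    linarith
  · set c : ℂ := -(f₀.1 0 / f₁.1 0) with hc
    set g := f₀ + c • f₁ with hg
    have hgz : ∀ z, g.1 z = f₀.1 z + c * f₁.1 z := fun z => rfl
    have hg0 : g.1 0 = 0 := by rw [hgz, hc]; field_simp; ring
    have hc1 : 0 < 1 + ‖c‖ := by positivity
    refine ⟨Real.log (1 + ‖c‖) - g.sphereLogMean 1, fun r hr => ?_⟩
    have hr0 : 0 < r := one_pos.trans_le hr
    have e1 := Entire.log_le_sphereLogMean_sub (hne c) hg0 hr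
    have e2 : g.sphereLogMean r ≤ maxLogMean f₀ f₁ r + Real.log (1 + ‖c‖) := by
      have hmax := integrable_max_log h₀ h₁ hr0
      calc g.sphereLogMean r ≤ ∫ ξ : USphere m, (max (Real.log ‖f₀.1 (r • (ξ : CSpace m))‖)
            (Real.log ‖f₁.1 (r • (ξ : CSpace m))‖) + Real.log (1 + ‖c‖)) ∂sphereMeasure m := by
            refine integral_mono_ae (Entire.integrable_log_norm (hne c) hr0)
              (hmax.add (integrable_const _)) ?_
            filter_upwards [Entire.ae_sphere_ne_zero h₀ hr0, Entire.ae_sphere_ne_zero h₁ hr0,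
              Entire.ae_sphere_ne_zero (hne c) hr0] with ξ x0 x1 x2
            have p0 := norm_pos_iff.2 x0
            have p1 := norm_pos_iff.2 x1
            change Real.log ‖g.1 (r • (ξ : CSpace m))‖ ≤ _
            rw [← Real.strictMonoOn_log.monotoneOn.map_max p0 p1,
              ← Real.log_mul (lt_max_of_lt_left p0).ne' hc1.ne']
            refine Real.log_le_log (norm_pos_iff.2 x2) ?_
            rw [hgz]
            refine (norm_add_le _ _).trans ?_
            rw [norm_mul]
            have m0 := le_max_left ‖f₀.1 (r • (ξ : CSpace m))‖ ‖f₁.1 (r • (ξ : CSpace m))‖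
            have m1 := le_max_right ‖f₀.1 (r • (ξ : CSpace m))‖ ‖f₁.1 (r • (ξ : CSpace m))‖
            nlinarith [norm_nonneg c]
        _ = _ := by
            rw [integral_add hmax (integrable_const _), integral_const, probReal_univ, one_smul]
            rfl
    linarith

theorem log_sqrt_mem {x y : ℝ} (hx : 0 < x) (hy : 0 < y) :
    max (Real.log x) (Real.log y) ≤ Real.log (Real.sqrt (x ^ 2 + y ^ 2)) ∧
    Real.log (Real.sqrt (x ^ 2 + y ^ 2)) ≤ max (Real.log x) (Real.log y) + Real.log 2 := by
  have hm : 0 < max x y := lt_max_of_lt_left hx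
  rw [← Real.strictMonoOn_log.monotoneOn.map_max hx hy,
    ← Real.log_mul hm.ne' two_ne_zero]
  have hs : 0 < Real.sqrt (x ^ 2 + y ^ 2) := by positivity
  constructor
  · refine Real.log_le_log hm (max_le ?_ ?_) <;> apply Real.le_sqrt_of_sq_le <;> nlinarith
  · refine Real.log_le_log hs ?_
    rw [Real.sqrt_le_left (by positivity)]
    have h1 := le_max_left x y
    have h2 := le_max_right x y
    nlinarith

/-- Allows `maxLogMean`, which is monotone and symmetric in f₀ and f₁, to replace the characteristic
throughout. -/
theorem exists_abs_characteristic_sub_le (h₀ : f₀ ≠ 0) (h₁ : f₁ ≠ 0) :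
    ∃ c : ℝ, ∀ r, 0 < r → |characteristic f₀ f₁ r - maxLogMean f₀ f₁ r| ≤ c := by
  set S := sphereMean (fun z : CSpace m => Real.log (Real.sqrt (‖f₀.1 z‖ ^ 2 + ‖f₁.1 z‖ ^ 2)))
    with hS
  have key : ∀ r, 0 < r → |S r - maxLogMean f₀ f₁ r| ≤ Real.log 2 := by
    intro r hr
    have hae : ∀ᵐ ξ : USphere m ∂sphereMeasure m, f₀.1 (r • (ξ : CSpace m)) ≠ 0 ∧
        f₁.1 (r • (ξ : CSpace m)) ≠ 0 :=
      (Entire.ae_sphere_ne_zero h₀ hr).and (Entire.ae_sphere_ne_zero h₁ hr)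
    have hmax := integrable_max_log h₀ h₁ hr
    have hmeas : Measurable fun ξ : USphere m => Real.log (Real.sqrt
        (‖f₀.1 (r • (ξ : CSpace m))‖ ^ 2 + ‖f₁.1 (r • (ξ : CSpace m))‖ ^ 2)) :=
      Real.measurable_log.comp (((f₀.measurable_sphere r).norm.pow_const 2).add
        ((f₁.measurable_sphere r).norm.pow_const 2)).sqrt
    have hbd : ∀ᵐ ξ : USphere m ∂sphereMeasure m,
        ‖Real.log (Real.sqrt
        (‖f₀.1 (r • (ξ : CSpace m))‖ ^ 2 + ‖f₁.1 (r • (ξ : CSpace m))‖ ^ 2)) -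
        max (Real.log ‖f₀.1 (r • (ξ : CSpace m))‖) (Real.log ‖f₁.1 (r • (ξ : CSpace m))‖)‖ ≤
        Real.log 2 := by
      filter_upwards [hae] with ξ hξ
      obtain ⟨b1, b2⟩ := log_sqrt_mem (norm_pos_iff.2 hξ.1) (norm_pos_iff.2 hξ.2)
      rw [Real.norm_eq_abs, abs_le]
      constructor <;> linarith [Real.log_pos one_lt_two]
    have hd : Integrable (fun ξ : USphere m => Real.log (Real.sqrt
        (‖f₀.1 (r • (ξ : CSpace m))‖ ^ 2 + ‖f₁.1 (r • (ξ : CSpace m))‖ ^ 2)) -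
        max (Real.log ‖f₀.1 (r • (ξ : CSpace m))‖) (Real.log ‖f₁.1 (r • (ξ : CSpace m))‖))
        (sphereMeasure m) :=
      Integrable.of_bound (hmeas.aestronglyMeasurable.sub hmax.aestronglyMeasurable) _ hbd
    have hs : Integrable (fun ξ : USphere m => Real.log (Real.sqrt
        (‖f₀.1 (r • (ξ : CSpace m))‖ ^ 2 + ‖f₁.1 (r • (ξ : CSpace m))‖ ^ 2)))
        (sphereMeasure m) := by
      refine (hd.add hmax).congr (ae_of_all _ fun ξ => ?_)
      simp
    have h3 := norm_integral_le_of_norm_le_const hbd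
    rw [integral_sub hs hmax, probReal_univ, mul_one] at h3
    exact h3
  refine ⟨Real.log 2 + |S 1|, fun r hr => ?_⟩
  have e : characteristic f₀ f₁ r - maxLogMean f₀ f₁ r = (S r - maxLogMean f₀ f₁ r) - S 1 := by
    rw [characteristic]; ring
  rw [e]
  exact (abs_sub _ _).trans (add_le_add (key r hr) le_rfl)

/-- The first main theorem in the form needed here. -/
theorem exists_sphereMean_posLog_le (h₀ : f₀ ≠ 0) (h₁ : f₁ ≠ 0) :
    (∀ r : ℝ, 0 < r → Integrable (fun ξ : USphere m =>
      Real.posLog (‖f₀.1 (r • (ξ : CSpace m))‖ / ‖f₁.1 (r • (ξ : CSpace m))‖))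
      (sphereMeasure m)) ∧
    ∃ c : ℝ, ∀ r : ℝ, 1 ≤ r → sphereMean (fun z : CSpace m => Real.posLog (‖f₀.1 z‖ / ‖f₁.1 z‖)) r ≤
      maxLogMean f₀ f₁ r + c := by
  have hae : ∀ r : ℝ, 0 < r → (fun ξ : USphere m =>
      max (Real.log ‖f₀.1 (r • (ξ : CSpace m))‖) (Real.log ‖f₁.1 (r • (ξ : CSpace m))‖) -
        Real.log ‖f₁.1 (r • (ξ : CSpace m))‖) =ᵐ[sphereMeasure m]
      (fun ξ : USphere m =>
      Real.posLog (‖f₀.1 (r • (ξ : CSpace m))‖ / ‖f₁.1 (r • (ξ : CSpace m))‖)) := by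
    intro r hr
    filter_upwards [Entire.ae_sphere_ne_zero h₀ hr, Entire.ae_sphere_ne_zero h₁ hr] with ξ x0 x1
    -- The identity log⁺(x/y) = max(log x, log y) - log y; the mean of the last term is bounded
    -- below by its value at radius 1.
    rw [Real.posLog, Real.log_div (norm_ne_zero_iff.2 x0) (norm_ne_zero_iff.2 x1),
      ← max_sub_sub_right, sub_self, max_comm]
  refine ⟨fun r hr => ((integrable_max_log h₀ h₁ hr).sub
    (Entire.integrable_log_norm h₁ hr)).congr (hae r hr), -f₁.sphereLogMean 1, fun r hr => ?_⟩
  have hr0 : 0 < r := one_pos.trans_le hr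
  have h2 := Entire.sphereLogMean_mono h₁ one_pos hr
  rw [sphereMean, ← integral_congr_ae (hae r hr0), integral_sub (integrable_max_log h₀ h₁ hr0)
    (Entire.integrable_log_norm h₁ hr0)]
  change maxLogMean f₀ f₁ r - f₁.sphereLogMean r ≤ _
  linarith

/-- The function `|log |F(qz) / F(z)||` for `F = f₀ / f₁`. -/
noncomputable def absLogDilate (f₀ f₁ : Entire m) (q : ℂˣ) (z : CSpace m) : ℝ :=
  |(Real.log ‖f₀.1 ((q : ℂ) • z)‖ - Real.log ‖f₁.1 ((q : ℂ) • z)‖) -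
    (Real.log ‖f₀.1 z‖ - Real.log ‖f₁.1 z‖)|

theorem integrable_absLogDilate (h₀ : f₀ ≠ 0) (h₁ : f₁ ≠ 0) (q : ℂˣ) {r : ℝ} (hr : 0 < r) :
    Integrable (fun ξ : USphere m => absLogDilate f₀ f₁ q (r • (ξ : CSpace m)))
      (sphereMeasure m) :=
  (((Entire.integrable_log_norm (dilate_ne_zero h₀ q) hr).sub
    (Entire.integrable_log_norm (dilate_ne_zero h₁ q) hr)).sub
    ((Entire.integrable_log_norm h₀ hr).sub (Entire.integrable_log_norm h₁ hr))).abs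

/-- The `q`-difference analogue of the lemma on the logarithmic derivative. -/
theorem sphereMean_absLogDilate_le (h₀ : f₀ ≠ 0) (h₁ : f₁ ≠ 0) (hne : ∀ c : ℂ, f₀ + c • f₁ ≠ 0)
    (q : ℂˣ) {r K L : ℝ} (hr : 1 ≤ r) (hK : 2 * max 1 ‖(q : ℂ)‖ ≤ K) (hL : 1 < L) :
    sphereMean (absLogDilate f₀ f₁ q) r ≤
      (16 * (max 1 ‖(q : ℂ)‖ / K) + 2 * ((12 * Real.log 2 + |Real.log ‖(q : ℂ)‖|) / Real.log L)) *
        (maxLogMean f₀ f₁ (L * (K * r)) + (|f₀.sphereLogMean 1| + |f₁.sphereLogMean 1|)) := by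
  have hr0 : 0 < r := one_pos.trans_le hr
  have hK1 : 1 ≤ K := by linarith [le_max_left 1 ‖(q : ℂ)‖]
  have hKr1 : 1 ≤ K * r := one_le_mul_of_one_le_of_one_le hK1 hr
  have hKr : 0 < K * r := by positivity
  have hLKr : 0 < L * (K * r) := by positivity
  have hle : K * r ≤ L * (K * r) := by nlinarith
  set A := 8 * (max 1 ‖(q : ℂ)‖ / K)
  set B := (12 * Real.log 2 + |Real.log ‖(q : ℂ)‖|) / Real.log L
  have hA : 0 ≤ A := by positivity
  have hB : 0 ≤ B := by have := Real.log_pos hL; positivity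
  have i1 := Entire.integrable_logMean_onLine h₀ hLKr
  have i2 := Entire.integrable_logMean_onLine h₀ hKr
  have i3 := Entire.integrable_logMean_onLine h₁ hLKr
  have i4 := Entire.integrable_logMean_onLine h₁ hKr
  have hd : Integrable (fun ξ : USphere m => |Real.log ‖f₀.1 ((K * r) • (ξ : CSpace m))‖ -
      Real.log ‖f₁.1 ((K * r) • (ξ : CSpace m))‖|) (sphereMeasure m) :=
    ((Entire.integrable_log_norm h₀ hKr).sub (Entire.integrable_log_norm h₁ hKr)).abs
  have i12 : Integrable (fun ξ : USphere m => logMean (f₀.onLine (ξ : CSpace m)) (L * (K * r)) -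
      logMean (f₀.onLine (ξ : CSpace m)) (K * r)) (sphereMeasure m) := i1.sub i2
  have i34 : Integrable (fun ξ : USphere m => logMean (f₁.onLine (ξ : CSpace m)) (L * (K * r)) -
      logMean (f₁.onLine (ξ : CSpace m)) (K * r)) (sphereMeasure m) := i3.sub i4
  have i5 : Integrable (fun ξ : USphere m => B *
      ((logMean (f₀.onLine (ξ : CSpace m)) (L * (K * r)) -
        logMean (f₀.onLine (ξ : CSpace m)) (K * r)) +
      (logMean (f₁.onLine (ξ : CSpace m)) (L * (K * r)) -
        logMean (f₁.onLine (ξ : CSpace m)) (K * r)))) (sphereMeasure m) :=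
    (i12.add i34).const_mul _
  obtain ⟨-, hF1, hF2⟩ := sphereMean_fubini (u := absLogDilate f₀ f₁ q)
    (integrable_absLogDilate h₀ h₁ q hr0)
  obtain ⟨-, hG1, hG2⟩ := sphereMean_fubini
    (u := fun z => |Real.log ‖f₀.1 z‖ - Real.log ‖f₁.1 z‖|) hd
  have h1 : sphereMean (absLogDilate f₀ f₁ q) r ≤
      A * sphereMean (fun z => |Real.log ‖f₀.1 z‖ - Real.log ‖f₁.1 z‖|) (K * r) +
      B * ((f₀.sphereLogMean (L * (K * r)) - f₀.sphereLogMean (K * r)) +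
        (f₁.sphereLogMean (L * (K * r)) - f₁.sphereLogMean (K * r))) := by
    rw [hF2, hG2, Entire.sphereLogMean_eq h₀ hLKr, Entire.sphereLogMean_eq h₀ hKr,
      Entire.sphereLogMean_eq h₁ hLKr, Entire.sphereLogMean_eq h₁ hKr, ← integral_sub i1 i2,
      ← integral_sub i3 i4, ← integral_add i12 i34, ← integral_const_mul,
      ← integral_const_mul, ← integral_add (hG1.const_mul _) i5]
    refine integral_mono_ae hF1 ((hG1.const_mul _).add i5) ?_
    filter_upwards [Entire.ae_exists_onLine_ne_zero h₀, Entire.ae_exists_onLine_ne_zero h₁]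
      with ξ x0 x1
    have := circleAverage_abs_log_quotient_dilate_le (q := q) q.ne_zero
      (f₀.analyticOnNhd_onLine ξ) (f₁.analyticOnNhd_onLine ξ) x0 x1 hr0 hK hL
    simp only [absLogDilate, smul_smul]
    exact this
  -- From |x - y| = 2 max(x, y) - x - y.
  have h2 : sphereMean (fun z => |Real.log ‖f₀.1 z‖ - Real.log ‖f₁.1 z‖|) (K * r) =
      2 * maxLogMean f₀ f₁ (K * r) - f₀.sphereLogMean (K * r) - f₁.sphereLogMean (K * r) := by
    have j0 := Entire.integrable_log_norm h₀ hKr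
    have j1 := Entire.integrable_log_norm h₁ hKr
    have jm := integrable_max_log h₀ h₁ hKr
    simp only [maxLogMean, Entire.sphereLogMean, sphereMean]
    have j2 : Integrable (fun ξ : USphere m =>
        2 * max (Real.log ‖f₀.1 ((K * r) • (ξ : CSpace m))‖)
          (Real.log ‖f₁.1 ((K * r) • (ξ : CSpace m))‖) -
          Real.log ‖f₀.1 ((K * r) • (ξ : CSpace m))‖) (sphereMeasure m) := (jm.const_mul 2).sub j0
    rw [← integral_const_mul, ← integral_sub (jm.const_mul _) j0, ← integral_sub j2 j1]
    refine integral_congr_ae (ae_of_all _ fun ξ => ?_)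
    simp only
    rcases le_total (Real.log ‖f₀.1 ((K * r) • (ξ : CSpace m))‖)
      (Real.log ‖f₁.1 ((K * r) • (ξ : CSpace m))‖) with h | h
    · rw [max_eq_right h, abs_of_nonpos (sub_nonpos.2 h)]; ring
    · rw [max_eq_left h, abs_of_nonneg (sub_nonneg.2 h)]; ring
  have m0 := Entire.sphereLogMean_mono h₀ one_pos hKr1
  have m1 := Entire.sphereLogMean_mono h₁ one_pos hKr1
  have v0 := sphereLogMean_le_maxLogMean_left h₀ h₁ hLKr
  have v1 := sphereLogMean_le_maxLogMean_right h₀ h₁ hLKr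
  have v2 := maxLogMean_mono h₀ h₁ hne hKr hle
  have n0 := neg_abs_le (f₀.sphereLogMean 1)
  have n1 := neg_abs_le (f₁.sphereLogMean 1)
  rw [h2] at h1
  -- D dominates all the means involved: by monotonicity the subtracted means at Kr are at least
  -- those at 1, and the added ones are at most `maxLogMean` at LKr.
  set D := maxLogMean f₀ f₁ (L * (K * r)) + (|f₀.sphereLogMean 1| + |f₁.sphereLogMean 1|)
  have s1 : A * (2 * maxLogMean f₀ f₁ (K * r) - f₀.sphereLogMean (K * r) -
      f₁.sphereLogMean (K * r)) ≤ A * (2 * D) := by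
    refine mul_le_mul_of_nonneg_left ?_ hA
    have a0 := abs_nonneg (f₀.sphereLogMean 1)
    have a1 := abs_nonneg (f₁.sphereLogMean 1)
    linarith
  have s2 : B * ((f₀.sphereLogMean (L * (K * r)) - f₀.sphereLogMean (K * r)) +
        (f₁.sphereLogMean (L * (K * r)) - f₁.sphereLogMean (K * r))) ≤ B * (2 * D) := by
    refine mul_le_mul_of_nonneg_left ?_ hB
    have a0 := abs_nonneg (f₀.sphereLogMean 1)
    have a1 := abs_nonneg (f₁.sphereLogMean 1)
    linarith
  calc _ ≤ A * (2 * D) + B * (2 * D) := by linarith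
    _ = _ := by simp only [A, B]; ring

end MaxLogMean

end GrowthFunctions

/-! ### Logarithmic density, the diagonal argument and the growth lemma. -/

/-- The logarithmic measure of `E ∩ [1, r]`. -/
noncomputable def logMeasure (E : Set ℝ) (r : ℝ) : ℝ := ∫ t in E ∩ Set.Icc 1 r, t⁻¹

theorem integrableOn_inv_Icc_one (r : ℝ) : IntegrableOn (fun t : ℝ => t⁻¹) (Set.Icc 1 r) :=
  ContinuousOn.integrableOn_Icc fun _ ht =>
    (continuousAt_inv₀ (one_pos.trans_le ht.1).ne').continuousWithinAt

theorem logMeasure_mono {E F : Set ℝ} {r : ℝ}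
    (hF : MeasurableSet F) (h : E ∩ Set.Icc 1 r ⊆ F) : logMeasure E r ≤ logMeasure F r := by
  refine setIntegral_mono_set ((integrableOn_inv_Icc_one r).mono_set Set.inter_subset_right) ?_
    (LE.le.eventuallyLE fun t ht => ⟨h ht, ht.2⟩)
  refine (ae_restrict_iff' (hF.inter measurableSet_Icc)).2 (ae_of_all _ fun t ht => ?_)
  exact inv_nonneg.2 (zero_le_one.trans ht.2.1)

theorem logMeasure_nonneg {E : Set ℝ} (hE : MeasurableSet E) (r : ℝ) : 0 ≤ logMeasure E r :=
  setIntegral_nonneg (hE.inter measurableSet_Icc) fun _ ht =>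
    inv_nonneg.2 (zero_le_one.trans ht.2.1)

theorem logMeasure_add_compl {E : Set ℝ} (hE : MeasurableSet E) {r : ℝ} (hr : 1 ≤ r) :
    logMeasure E r + logMeasure Eᶜ r = Real.log r := by
  have h1 : ∫ t in Set.Icc 1 r, t⁻¹ = Real.log r := by
    rw [integral_Icc_eq_integral_Ioc, ← intervalIntegral.integral_of_le hr,
      integral_inv_of_pos one_pos (one_pos.trans_le hr), div_one]
  rw [← h1, ← integral_inter_add_sdiff hE (integrableOn_inv_Icc_one r), logMeasure, logMeasure,
    Set.inter_comm, Set.inter_comm Eᶜ, Set.sdiff_eq]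

theorem logMeasure_union_le {E F : Set ℝ} (hE : MeasurableSet E) (hF : MeasurableSet F) (r : ℝ) :
    logMeasure (E ∪ F) r ≤ logMeasure E r + logMeasure F r := by
  have hi := (integrableOn_inv_Icc_one r)
  have h1 : logMeasure (E ∪ F) r = logMeasure E r + logMeasure (F \ E) r := by
    rw [logMeasure, logMeasure, logMeasure, ← setIntegral_union]
    · rw [← Set.union_inter_distrib_right, Set.union_sdiff_self]
    · exact Set.disjoint_of_subset Set.inter_subset_left Set.inter_subset_left
        Set.disjoint_sdiff_right
    · exact (hF.diff hE).inter measurableSet_Icc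
    · exact hi.mono_set Set.inter_subset_right
    · exact hi.mono_set Set.inter_subset_right
  rw [h1]
  exact add_le_add le_rfl (logMeasure_mono hF fun t ht => ht.1.1)

theorem hasLogDensityOne_iff {E : Set ℝ} (hE : MeasurableSet E) :
    HasLogDensityOne E ↔ Tendsto (fun r => logMeasure Eᶜ r / Real.log r) atTop (nhds 0) := by
  have hev : ∀ᶠ r : ℝ in atTop, logMeasure E r / Real.log r =
      1 - logMeasure Eᶜ r / Real.log r := by
    filter_upwards [eventually_gt_atTop 1] with r hr
    have h1 := logMeasure_add_compl hE hr.le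
    have h2 := (Real.log_pos hr).ne'
    field_simp
    linarith
  have h0 : HasLogDensityOne E ↔
      Tendsto (fun r => logMeasure E r / Real.log r) atTop (nhds 1) :=
    ⟨fun h => h.2, fun h => ⟨hE, h⟩⟩
  rw [h0, tendsto_congr' hev]
  constructor
  · intro h
    simpa using (tendsto_const_nhds (x := (1 : ℝ))).sub h
  · intro h
    simpa using (tendsto_const_nhds (x := (1 : ℝ))).sub h

theorem hasLogDensityOne_iff_eventually {E : Set ℝ} (hE : MeasurableSet E) :
    HasLogDensityOne E ↔
      ∀ ε > 0, ∀ᶠ r : ℝ in atTop, logMeasure Eᶜ r ≤ ε * Real.log r := by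
  rw [hasLogDensityOne_iff hE, Metric.tendsto_nhds]
  constructor
  · intro h ε hε
    filter_upwards [h ε hε, eventually_gt_atTop 1] with r hr hr1
    have h2 := Real.log_pos hr1
    rw [Real.dist_eq, sub_zero, abs_of_nonneg (div_nonneg (logMeasure_nonneg hE.compl r) h2.le),
      div_lt_iff₀ h2] at hr
    exact hr.le
  · intro h ε hε
    filter_upwards [h (ε / 2) (half_pos hε), eventually_gt_atTop 1] with r hr hr1
    have h2 := Real.log_pos hr1
    rw [Real.dist_eq, sub_zero, abs_of_nonneg (div_nonneg (logMeasure_nonneg hE.compl r) h2.le),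
      div_lt_iff₀ h2]
    nlinarith

theorem hasLogDensityOne_univ : HasLogDensityOne Set.univ := by
  rw [hasLogDensityOne_iff MeasurableSet.univ]
  simp [logMeasure]

theorem HasLogDensityOne.inter {E F : Set ℝ} (hE : HasLogDensityOne E) (hF : HasLogDensityOne F) :
    HasLogDensityOne (E ∩ F) := by
  have h1 := (hasLogDensityOne_iff_eventually hE.1).1 hE
  have h2 := (hasLogDensityOne_iff_eventually hF.1).1 hF
  refine (hasLogDensityOne_iff_eventually (hE.1.inter hF.1)).2 fun ε hε => ?_
  filter_upwards [h1 (ε / 2) (half_pos hε), h2 (ε / 2) (half_pos hε)] with r a1 a2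
  rw [Set.compl_inter]
  linarith [logMeasure_union_le hE.1.compl hF.1.compl r]

/-- A diagonal argument: it suffices to bound `S` by `ε T` on a set of logarithmic density one for
each `ε > 0` separately. -/
theorem isLittleOLogDensityOne_of_forall {S T : ℝ → ℝ}
    (h : ∀ ε > 0, ∃ E : Set ℝ, HasLogDensityOne E ∧ ∀ᶠ r in atTop, r ∈ E → |S r| ≤ ε * |T r|) :
    IsLittleOLogDensityOne S T := by
  have hpos : ∀ k : ℕ, (0 : ℝ) < 1 / (k + 1) := fun k => by positivity
  choose A hA hAS using fun k : ℕ => h (1 / (k + 1)) (hpos k)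
  obtain ⟨E, hE, hanti, hEA⟩ : ∃ E : ℕ → Set ℝ, (∀ k, HasLogDensityOne (E k)) ∧
      Antitone E ∧ ∀ k, E k ⊆ A k := by
    refine ⟨fun k => Nat.rec (A 0) (fun k F => F ∩ A (k + 1)) k, ?_, ?_, ?_⟩
    · intro k
      induction k with
      | zero => exact hA 0
      | succ k ih => exact ih.inter (hA (k + 1))
    · exact antitone_nat_of_succ_le fun k => Set.inter_subset_left
    · intro k
      cases k with
      | zero => exact le_rfl
      | succ k => exact Set.inter_subset_right
  have hR : ∀ k : ℕ, ∃ R : ℝ, ∀ r ≥ R, (r ∈ E k → |S r| ≤ 1 / (k + 1) * |T r|) ∧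
      logMeasure (E k)ᶜ r ≤ 1 / (k + 1) * Real.log r := by
    intro k
    have h1 := (hasLogDensityOne_iff_eventually (hE k).1).1 (hE k) _ (hpos k)
    obtain ⟨R, hR⟩ := eventually_atTop.1 ((hAS k).and h1)
    exact ⟨R, fun r hr => ⟨fun hrE => (hR r hr).1 (hEA k hrE), (hR r hr).2⟩⟩
  choose R hR using hR
  -- An increasing, unbounded sequence of radii with ρ k ≥ R k.
  set ρ : ℕ → ℝ := fun k => ∑ j ∈ Finset.range (k + 1), |R j| + k with hρ
  have hρmono : Monotone ρ := by
    refine monotone_nat_of_le_succ fun k => ?_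
    simp only [hρ, Finset.sum_range_succ _ (k + 1)]
    push_cast
    linarith [abs_nonneg (R (k + 1))]
  have hρR : ∀ k, R k ≤ ρ k := by
    intro k
    have h1 : |R k| ≤ ∑ j ∈ Finset.range (k + 1), |R j| :=
      Finset.single_le_sum (f := fun j => |R j|) (fun _ _ => abs_nonneg _)
        (Finset.self_mem_range_succ k)
    have h2 := le_abs_self (R k)
    have h3 : (0 : ℝ) ≤ k := Nat.cast_nonneg k
    simp only [hρ]
    linarith
  have hρk : ∀ k : ℕ, (k : ℝ) ≤ ρ k := by
    intro k
    have : 0 ≤ ∑ j ∈ Finset.range (k + 1), |R j| := Finset.sum_nonneg fun _ _ => abs_nonneg _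
    simp only [hρ]
    linarith
  -- As the E k decrease, F coincides with E k on [ρ k, ρ (k + 1)). So Fᶜ up to a radius in that
  -- interval lies in (E k)ᶜ, and beyond ρ N the set F lies in E N.
  set F : Set ℝ := ⋂ k, (Set.Iio (ρ k) ∪ E k) with hF
  have hFmeas : MeasurableSet F :=
    MeasurableSet.iInter fun k => measurableSet_Iio.union (hE k).1
  refine ⟨F, ?_, ?_⟩
  · rw [hasLogDensityOne_iff_eventually hFmeas]
    intro ε hε
    obtain ⟨N, hN⟩ := exists_nat_one_div_lt hε
    filter_upwards [eventually_ge_atTop (ρ N), eventually_ge_atTop 1] with r hr hr1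
    obtain ⟨k, hkN, hk1, hk2⟩ : ∃ k, N ≤ k ∧ ρ k ≤ r ∧ r < ρ (k + 1) := by
      have hex : ∃ n, r < ρ n := by
        obtain ⟨n, hn⟩ := exists_nat_gt r
        exact ⟨n, hn.trans_le (hρk n)⟩
      classical
      have hspec := Nat.find_spec hex
      have hlt : N < Nat.find hex := by
        by_contra hcon
        exact absurd (hspec.trans_le (hρmono (not_lt.1 hcon))) (not_lt.2 hr)
      refine ⟨Nat.find hex - 1, by omega, ?_, ?_⟩
      · exact not_lt.1 (Nat.find_min hex (by omega))
      · rwa [Nat.sub_add_cancel (by omega)]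
    have h1 : logMeasure Fᶜ r ≤ logMeasure (E k)ᶜ r := by
      refine logMeasure_mono (hE k).1.compl ?_
      rintro t ⟨htF, ht⟩
      simp only [hF, Set.mem_compl_iff, Set.mem_iInter, not_forall, Set.mem_union, Set.mem_Iio,
        not_or, not_lt] at htF
      obtain ⟨j, hj1, hj2⟩ := htF
      have hjk : j ≤ k := by
        by_contra hcon
        have := hρmono (show k + 1 ≤ j by omega)
        linarith [ht.2]
      exact fun htk => hj2 (hanti hjk htk)
    have h2 := (hR k r ((hρR k).trans hk1)).2
    have h3 : (1 : ℝ) / (k + 1) ≤ 1 / (N + 1) :=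
      one_div_le_one_div_of_le (by positivity) (by exact_mod_cast Nat.succ_le_succ hkN)
    have h4 := Real.log_nonneg hr1
    nlinarith
  · rw [isLittleO_iff]
    intro ε hε
    obtain ⟨N, hN⟩ := exists_nat_one_div_lt hε
    rw [eventually_inf_principal]
    filter_upwards [eventually_ge_atTop (ρ N)] with r hr hrF
    have h1 : r ∈ E N := by
      rcases Set.mem_iInter.1 hrF N with h | h
      · exact absurd h (not_lt.2 hr)
      · exact h
    have h2 := (hR N r ((hρR N).trans hr)).1 h1
    rw [Real.norm_eq_abs, Real.norm_eq_abs]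
    nlinarith [abs_nonneg (T r)]

/-- A monotone function of slow growth satisfies `w(Kr) ≤ w(r) + δ` outside a set of logarithmic
density zero. -/
theorem hasLogDensityOne_of_monotone {w : ℝ → ℝ} (hw : Monotone w) (hw0 : ∀ r, 0 ≤ w r)
    (hgrow : ∀ ε > 0, ∀ᶠ r in atTop, w r ≤ ε * Real.log r) {K δ : ℝ} (hK : 1 < K) (hδ : 0 < δ) :
    HasLogDensityOne {r | w (K * r) ≤ w r + δ} := by
  have hK0 : 0 < K := one_pos.trans hK
  have hwK : Monotone fun r => w (K * r) := fun a b hab => hw (mul_le_mul_of_nonneg_left hab hK0.le)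
  have hmeas : MeasurableSet {r | w (K * r) ≤ w r + δ} :=
    measurableSet_le hwK.measurable (hw.measurable.add_const _)
  rw [hasLogDensityOne_iff_eventually hmeas]
  have hinv : ∀ a b : ℝ, 0 < a → 0 < b → ContinuousOn (fun t : ℝ => t⁻¹) (Set.uIcc a b) := by
    intro a b ha hb t ht
    have : 0 < t := lt_of_lt_of_le (lt_min ha hb) ht.1
    exact (continuousAt_inv₀ this.ne').continuousWithinAt
  have hI : ∀ a b : ℝ, 0 < a → 0 < b → IntervalIntegrable (fun t => w t * t⁻¹) volume a b :=
    fun a b ha hb => (hw.monotoneOn _).intervalIntegrable.mul_continuousOn (hinv a b ha hb)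
  have hI' : ∀ a b : ℝ, 0 < a → 0 < b → IntervalIntegrable (fun t => w (K * t) * t⁻¹) volume a b :=
    fun a b ha hb => (hwK.monotoneOn _).intervalIntegrable.mul_continuousOn (hinv a b ha hb)
  -- Chebyshev's inequality: on the exceptional set w(Kt) - w(t) > δ. The integral of this
  -- difference against dt/t over [1, r] telescopes, since dt/t is scale invariant, leaving at most
  -- the integral of w over [r, Kr].
  have hbound : ∀ r : ℝ, 1 ≤ r →
      δ * logMeasure {r | w (K * r) ≤ w r + δ}ᶜ r ≤ w (K * r) * Real.log K := by
    intro r hr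
    have hr0 : 0 < r := one_pos.trans_le hr
    have hKr : r ≤ K * r := by nlinarith
    have e1 : ∫ t in (1 : ℝ)..r, w (K * t) * t⁻¹ = ∫ t in (K * 1)..(K * r), w t * t⁻¹ := by
      have h := intervalIntegral.integral_comp_mul_left (a := 1) (b := r)
        (fun t => w t * t⁻¹) hK0.ne'
      rw [smul_eq_mul, eq_inv_mul_iff_mul_eq₀ hK0.ne', ← intervalIntegral.integral_const_mul] at h
      rw [← h]
      refine intervalIntegral.integral_congr fun t _ => ?_
      change w (K * t) * t⁻¹ = K * (w (K * t) * (K * t)⁻¹)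
      rw [mul_inv]
      field_simp
    rw [mul_one] at e1
    have e2 : (∫ t in K..(K * r), w t * t⁻¹) - ∫ t in (1 : ℝ)..r, w t * t⁻¹ =
        (∫ t in r..(K * r), w t * t⁻¹) - ∫ t in (1 : ℝ)..K, w t * t⁻¹ := by
      have a1 := intervalIntegral.integral_add_adjacent_intervals (hI 1 K one_pos hK0)
        (hI K (K * r) hK0 (by positivity))
      have a2 := intervalIntegral.integral_add_adjacent_intervals (hI 1 r one_pos hr0)
        (hI r (K * r) hr0 (by positivity))
      linarith
    have e3 : 0 ≤ ∫ t in (1 : ℝ)..K, w t * t⁻¹ :=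
      intervalIntegral.integral_nonneg hK.le fun t ht =>
        mul_nonneg (hw0 t) (inv_nonneg.2 (zero_le_one.trans ht.1))
    have e4 : ∫ t in r..(K * r), w t * t⁻¹ ≤ w (K * r) * Real.log K := by
      calc ∫ t in r..(K * r), w t * t⁻¹ ≤ ∫ t in r..(K * r), w (K * r) * t⁻¹ := by
            refine intervalIntegral.integral_mono_on hKr (hI r (K * r) hr0 (by positivity))
              ((hinv r (K * r) hr0 (by positivity)).intervalIntegrable.const_mul _) fun t ht => ?_
            exact mul_le_mul_of_nonneg_right (hw ht.2) (inv_nonneg.2 (hr0.le.trans ht.1))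
        _ = w (K * r) * Real.log K := by
            rw [intervalIntegral.integral_const_mul, integral_inv_of_pos hr0 (by positivity),
              mul_div_cancel_right₀ _ hr0.ne']
    have e5 : δ * logMeasure {r | w (K * r) ≤ w r + δ}ᶜ r ≤
        ∫ t in (1 : ℝ)..r, (w (K * t) * t⁻¹ - w t * t⁻¹) := by
      have hint : IntegrableOn (fun t => w (K * t) * t⁻¹ - w t * t⁻¹) (Set.Icc 1 r) := by
        have := (hI' 1 r one_pos hr0).sub (hI 1 r one_pos hr0)
        rwa [intervalIntegrable_iff_integrableOn_Icc_of_le hr] at this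
      rw [logMeasure, ← integral_const_mul, intervalIntegral.integral_of_le hr,
        ← integral_Icc_eq_integral_Ioc]
      calc ∫ t in {r | w (K * r) ≤ w r + δ}ᶜ ∩ Set.Icc 1 r, δ * t⁻¹
          ≤ ∫ t in {r | w (K * r) ≤ w r + δ}ᶜ ∩ Set.Icc 1 r,
              (w (K * t) * t⁻¹ - w t * t⁻¹) := by
            refine setIntegral_mono_on
              (((integrableOn_inv_Icc_one r).mono_set Set.inter_subset_right).const_mul _)
              (hint.mono_set Set.inter_subset_right) (hmeas.compl.inter measurableSet_Icc) ?_
            rintro t ⟨ht1, ht2⟩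
            rw [Set.mem_compl_iff, Set.mem_ofPred_eq, not_le] at ht1
            rw [← sub_mul]
            exact mul_le_mul_of_nonneg_right (by linarith)
              (inv_nonneg.2 (zero_le_one.trans ht2.1))
        _ ≤ _ := by
            refine setIntegral_mono_set hint ?_ (LE.le.eventuallyLE Set.inter_subset_right)
            refine (ae_restrict_iff' measurableSet_Icc).2 (ae_of_all _ fun t ht => ?_)
            simp only [Pi.zero_apply]
            rw [← sub_mul]
            have ht0 : 0 ≤ t := zero_le_one.trans ht.1
            exact mul_nonneg (sub_nonneg.2 (hw (by nlinarith))) (inv_nonneg.2 ht0)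
    rw [intervalIntegral.integral_sub (hI' 1 r one_pos hr0) (hI 1 r one_pos hr0), e1, e2] at e5
    linarith
  intro ε hε
  have hlogK : 0 < Real.log K := Real.log_pos hK
  -- The factor 2 absorbs log(Kr) ≤ 2 log r, valid for r ≥ K.
  set η := ε * δ / (2 * Real.log K) with hη
  have hη0 : 0 < η := by positivity
  have htend : Tendsto (fun r => K * r) atTop atTop := tendsto_id.const_mul_atTop hK0
  filter_upwards [htend.eventually (hgrow η hη0), eventually_ge_atTop K] with r h1 h2
  have hr1 : 1 ≤ r := hK.le.trans h2
  have hr0 : 0 < r := one_pos.trans_le hr1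
  have h3 := hbound r hr1
  have h4 : Real.log (K * r) ≤ 2 * Real.log r := by
    rw [Real.log_mul hK0.ne' hr0.ne']
    linarith [Real.log_le_log hK0 h2]
  have h5 : w (K * r) * Real.log K ≤ δ * (ε * Real.log r) := by
    calc w (K * r) * Real.log K ≤ (η * (2 * Real.log r)) * Real.log K := by
          refine mul_le_mul_of_nonneg_right (h1.trans ?_) hlogK.le
          exact mul_le_mul_of_nonneg_left h4 hη0.le
      _ = δ * (ε * Real.log r) := by rw [hη]; field_simp
  exact le_of_mul_le_mul_left (h3.trans h5) hδ

/-! ### Calculus of error terms o(T) on sets of logarithmic density one. -/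

theorem sphereMean_nonneg {m : ℕ} {u : CSpace m → ℝ} (hu : ∀ z, 0 ≤ u z) (r : ℝ) :
    0 ≤ sphereMean u r :=
  integral_nonneg fun _ => hu _

theorem IsLittleOLogDensityOne.add {S₁ S₂ T : ℝ → ℝ} (h₁ : IsLittleOLogDensityOne S₁ T)
    (h₂ : IsLittleOLogDensityOne S₂ T) : IsLittleOLogDensityOne (fun r => S₁ r + S₂ r) T := by
  obtain ⟨E₁, hE₁, hS₁⟩ := h₁
  obtain ⟨E₂, hE₂, hS₂⟩ := h₂
  refine ⟨E₁ ∩ E₂, hE₁.inter hE₂, IsLittleO.add (hS₁.mono ?_) (hS₂.mono ?_)⟩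
  · exact inf_le_inf le_rfl (principal_mono.2 Set.inter_subset_left)
  · exact inf_le_inf le_rfl (principal_mono.2 Set.inter_subset_right)

theorem IsLittleOLogDensityOne.const_mul {S T : ℝ → ℝ} (h : IsLittleOLogDensityOne S T) (c : ℝ) :
    IsLittleOLogDensityOne (fun r => c * S r) T := by
  obtain ⟨E, hE, hS⟩ := h
  exact ⟨E, hE, hS.const_mul_left c⟩

theorem isLittleOLogDensityOne_const {T : ℝ → ℝ} (hT : Tendsto T atTop atTop) (c : ℝ) :
    IsLittleOLogDensityOne (fun _ => c) T := by
  refine ⟨Set.univ, hasLogDensityOne_univ, ?_⟩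
  rw [principal_univ, inf_top_eq]
  exact isLittleO_const_left.2 (Or.inr (tendsto_norm_atTop_atTop.comp hT))

theorem isLittleOLogDensityOne_sum {ι : Type*} (s : Finset ι) {S : ι → ℝ → ℝ} {T : ℝ → ℝ}
    (h : ∀ i ∈ s, IsLittleOLogDensityOne (S i) T) :
    IsLittleOLogDensityOne (fun r => ∑ i ∈ s, S i r) T := by
  classical
  induction s using Finset.induction_on with
  | empty =>
    refine ⟨Set.univ, hasLogDensityOne_univ, ?_⟩
    simp
  | insert a s ha ih =>
    simp only [Finset.sum_insert ha]
    exact (h a (Finset.mem_insert_self a s)).add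
      (ih fun i hi => h i (Finset.mem_insert_of_mem hi))

theorem IsLittleOLogDensityOne.of_le {S S' T : ℝ → ℝ} (h : IsLittleOLogDensityOne S' T)
    (h0 : ∀ r, 1 ≤ r → 0 ≤ S r) (hle : ∀ r, 1 ≤ r → S r ≤ S' r) : IsLittleOLogDensityOne S T := by
  obtain ⟨E, hE, hS⟩ := h
  refine ⟨E, hE, IsBigO.trans_isLittleO (IsBigO.of_bound 1 ?_) hS⟩
  filter_upwards [mem_inf_of_left (eventually_ge_atTop (1 : ℝ))] with r hr
  rw [one_mul, Real.norm_of_nonneg (h0 r hr)]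
  exact (hle r hr).trans (le_abs_self _)

theorem eventually_posLog_le_of_growthOrder_eq_zero {T : ℝ → ℝ} (h : growthOrder T = 0) {ε : ℝ}
    (hε : 0 < ε) : ∀ᶠ r in atTop, Real.posLog (T r) ≤ ε * Real.log r := by
  have h1 : limsup (fun r : ℝ => ENNReal.ofReal (Real.posLog (T r) / Real.log r)) atTop <
      ENNReal.ofReal ε := by
    change growthOrder T < _
    rw [h]
    exact ENNReal.ofReal_pos.2 hε
  filter_upwards [eventually_lt_of_limsup_lt h1, eventually_gt_atTop 1] with r hr hr1
  have h2 := (ENNReal.ofReal_lt_ofReal_iff hε).1 hr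
  rw [div_lt_iff₀ (Real.log_pos hr1)] at h2
  exact h2.le

/-! ### Functions of order zero: the shift terms are o(T). -/

section

variable {m : ℕ} [Nontrivial (CSpace m)] {f₀ f₁ : Entire m}

theorem tendsto_maxLogMean (h₀ : f₀ ≠ 0) (h₁ : f₁ ≠ 0) (hne : ∀ c : ℂ, f₀ + c • f₁ ≠ 0) :
    Tendsto (maxLogMean f₀ f₁) atTop atTop := by
  obtain ⟨C, hC⟩ := exists_log_le_maxLogMean h₀ h₁ hne
  refine tendsto_atTop_mono' _ ?_ (tendsto_atTop_add_const_right _ (-C) Real.tendsto_log_atTop)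
  filter_upwards [eventually_ge_atTop 1] with r hr
  exact hC r hr

theorem tendsto_characteristic (h₀ : f₀ ≠ 0) (h₁ : f₁ ≠ 0) (hne : ∀ c : ℂ, f₀ + c • f₁ ≠ 0) :
    Tendsto (characteristic f₀ f₁) atTop atTop := by
  obtain ⟨c, hc⟩ := exists_abs_characteristic_sub_le h₀ h₁
  refine tendsto_atTop_mono' _ ?_
    (tendsto_atTop_add_const_right _ (-c) (tendsto_maxLogMean h₀ h₁ hne))
  filter_upwards [eventually_gt_atTop 0] with r hr
  linarith [(abs_le.1 (hc r hr)).1]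

/-- For functions of order zero, `maxLogMean` at most doubles under dilation of the radius, outside
a set of logarithmic density zero. -/
theorem exists_hasLogDensityOne_maxLogMean_le (h₀ : f₀ ≠ 0) (h₁ : f₁ ≠ 0)
    (hne : ∀ c : ℂ, f₀ + c • f₁ ≠ 0) (horder : growthOrder (characteristic f₀ f₁) = 0) {K : ℝ}
    (hK : 1 < K) : ∃ E, HasLogDensityOne E ∧
      ∀ᶠ r in atTop, r ∈ E → maxLogMean f₀ f₁ (K * r) ≤ 2 * maxLogMean f₀ f₁ r := by
  set V := maxLogMean f₀ f₁ with hV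
  obtain ⟨c, hc⟩ := exists_abs_characteristic_sub_le h₀ h₁
  have hVtop := tendsto_maxLogMean h₀ h₁ hne
  have hTtop := tendsto_characteristic h₀ h₁ hne
  -- The truncations make log V monotone and nonnegative on the whole line without changing it for
  -- large r. The growth lemma with δ = log 2 then says V(Kr) ≤ 2V(r).
  set w : ℝ → ℝ := fun r => Real.log (max (V (max r 1)) 1) with hw
  have hwmono : Monotone w := by
    intro r s hrs
    refine Real.log_le_log (lt_max_of_lt_right one_pos) (max_le_max_right _ ?_)
    exact maxLogMean_mono h₀ h₁ hne (lt_max_of_lt_right one_pos) (max_le_max_right _ hrs)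
  have hw0 : ∀ r, 0 ≤ w r := fun r => Real.log_nonneg (le_max_right _ _)
  have hweq : ∀ᶠ r in atTop, w r = Real.log (V r) ∧ 1 ≤ V r := by
    filter_upwards [hVtop.eventually_ge_atTop 1, eventually_ge_atTop 1] with r h1 h2
    refine ⟨?_, h1⟩
    simp only [hw]
    rw [max_eq_left h2, max_eq_left h1]
  refine ⟨_, hasLogDensityOne_of_monotone hwmono hw0 ?_ hK (Real.log_pos one_lt_two), ?_⟩
  · intro ε hε
    filter_upwards [hweq, eventually_posLog_le_of_growthOrder_eq_zero horder (half_pos hε),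
      hTtop.eventually_ge_atTop (max 1 c), eventually_gt_atTop 0,
      (Real.tendsto_log_atTop.const_mul_atTop (half_pos hε)).eventually_ge_atTop (Real.log 2)]
      with r ⟨a1, a2⟩ a3 a4 a5 a6
    have b1 : 1 ≤ characteristic f₀ f₁ r := (le_max_left _ _).trans a4
    have b2 : c ≤ characteristic f₀ f₁ r := (le_max_right _ _).trans a4
    have b3 : V r ≤ 2 * characteristic f₀ f₁ r := by linarith [(abs_le.1 (hc r a5)).1]
    have b4 : Real.log (V r) ≤ Real.log 2 + Real.log (characteristic f₀ f₁ r) := by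
      rw [← Real.log_mul two_ne_zero (by linarith)]
      exact Real.log_le_log (by linarith) b3
    have b5 : Real.log (characteristic f₀ f₁ r) ≤ Real.posLog (characteristic f₀ f₁ r) :=
      le_max_right _ _
    rw [a1]
    linarith
  · have htend : Tendsto (fun r => K * r) atTop atTop :=
      tendsto_id.const_mul_atTop (one_pos.trans hK)
    filter_upwards [hweq, htend.eventually hweq] with r ⟨a1, a2⟩ ⟨b1, b2⟩ hr
    rw [a1, b1, add_comm, ← Real.log_mul two_ne_zero (by linarith)] at hr
    exact (Real.log_le_log_iff (by linarith) (by linarith)).1 hr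

/-- The `q`-difference lemma on the logarithmic derivative for functions of order zero. -/
theorem isLittleOLogDensityOne_absLogDilate (h₀ : f₀ ≠ 0) (h₁ : f₁ ≠ 0)
    (hne : ∀ c : ℂ, f₀ + c • f₁ ≠ 0) (horder : growthOrder (characteristic f₀ f₁) = 0) (q : ℂˣ) :
    IsLittleOLogDensityOne (sphereMean (absLogDilate f₀ f₁ q)) (characteristic f₀ f₁) := by
  refine isLittleOLogDensityOne_of_forall fun ε hε => ?_
  set M := max 1 ‖(q : ℂ)‖ with hM
  have hM1 : 1 ≤ M := le_max_left _ _
  set c₁ := 12 * Real.log 2 + |Real.log ‖(q : ℂ)‖| with hc₁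
  have hc₁0 : 0 ≤ c₁ := by positivity
  obtain ⟨c, hc⟩ := exists_abs_characteristic_sub_le h₀ h₁
  -- K and L are chosen so that each of the two terms of the prefactor is at most ε/16.
  set K := 2 * M + 16 * M * 16 / ε with hKdef
  have hK : 2 * M ≤ K := by
    rw [hKdef]; exact le_add_of_nonneg_right (by positivity)
  have hK0 : 0 < K := by linarith
  set L := Real.exp (1 + 2 * c₁ * 16 / ε) with hLdef
  have hL : 1 < L := Real.one_lt_exp_iff.2 (by positivity)
  have hA : 16 * (M / K) ≤ ε / 16 := by
    have : 16 * M * 16 / ε ≤ K := by rw [hKdef]; linarith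
    rw [div_le_iff₀ hε] at this
    rw [← mul_div_assoc, div_le_iff₀ hK0]
    linarith
  have hB : 2 * (c₁ / Real.log L) ≤ ε / 16 := by
    have hl : 0 < Real.log L := Real.log_pos hL
    have : 2 * c₁ * 16 / ε ≤ Real.log L := by rw [hLdef, Real.log_exp]; linarith
    rw [div_le_iff₀ hε] at this
    rw [← mul_div_assoc, div_le_iff₀ hl]
    linarith
  obtain ⟨E, hE, hEV⟩ := exists_hasLogDensityOne_maxLogMean_le h₀ h₁ hne horder
    (K := L * K) (one_lt_mul_of_lt_of_le hL (by linarith))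
  refine ⟨E, hE, ?_⟩
  set b := |f₀.sphereLogMean 1| + |f₁.sphereLogMean 1| with hb
  have hb0 : 0 ≤ b := by positivity
  filter_upwards [hEV, eventually_ge_atTop 1, (tendsto_maxLogMean h₀ h₁ hne).eventually_ge_atTop b,
    (tendsto_characteristic h₀ h₁ hne).eventually_ge_atTop (max 0 c)] with r a1 a2 a3 a4 hrE
  have hr0 : 0 < r := one_pos.trans_le a2
  have b1 := sphereMean_absLogDilate_le h₀ h₁ hne q a2 hK hL
  have b2 := a1 hrE
  rw [mul_assoc] at b2
  have b3 := (abs_le.1 (hc r hr0)).1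
  have b4 : c ≤ characteristic f₀ f₁ r := (le_max_right _ _).trans a4
  have b5 : 0 ≤ characteristic f₀ f₁ r := (le_max_left _ _).trans a4
  rw [abs_of_nonneg (sphereMean_nonneg (u := absLogDilate f₀ f₁ q) (fun z => abs_nonneg _) r),
    abs_of_nonneg b5]
  -- For large r one has V ≤ T + c ≤ 2T; hence V(LKr) ≤ 2V(r) ≤ 4T and b ≤ V(r) ≤ 2T.
  have b6 : maxLogMean f₀ f₁ (L * (K * r)) + b ≤ 6 * characteristic f₀ f₁ r := by linarith
  have b7 : 0 ≤ 16 * (M / K) + 2 * (c₁ / Real.log L) := by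
    have hl : 0 < Real.log L := Real.log_pos hL
    positivity
  calc sphereMean (absLogDilate f₀ f₁ q) r
      ≤ (16 * (M / K) + 2 * (c₁ / Real.log L)) * (6 * characteristic f₀ f₁ r) :=
        b1.trans (mul_le_mul_of_nonneg_left b6 b7)
    _ ≤ (ε / 8) * (6 * characteristic f₀ f₁ r) :=
        mul_le_mul_of_nonneg_right (by linarith) (by linarith)
    _ ≤ ε * characteristic f₀ f₁ r := by nlinarith

end

/-! ### The pointwise Clunie estimate. -/

/-- The pointwise estimate behind Clunie's lemma: `C` and `e` depend only on the shape of the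
polynomials. -/
theorem exists_norm_eval_le {ι : Type*} (SU SP SQ : Finset (ι →₀ ℕ)) (n D : ℕ) (d₀ : ι →₀ ℕ)
    (hd₀ : d₀ ∈ SU) (hd₀n : d₀.degree = n) (hU : ∀ d ∈ SU, d ≠ d₀ → d.degree < n)
    (hP : ∀ d ∈ SP, d.degree ≤ D) (hQ : ∀ d ∈ SQ, d.degree ≤ n) :
    ∃ (C : ℝ) (e : ℕ), 1 ≤ C ∧ ∀ (u p q : (ι →₀ ℕ) → ℂ) (x : ι → ℂ) (W : ℂ) (B : ℝ), W ≠ 0 →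
      1 ≤ B → (∀ d ∈ SU, ‖u d‖ ≤ B) → (∀ d ∈ SP, ‖p d‖ ≤ B) → (∀ d ∈ SQ, ‖q d‖ ≤ B) →
      1 ≤ B * ‖u d₀‖ →
      (∀ d, d ∈ SU ∨ d ∈ SP ∨ d ∈ SQ → ∀ i ∈ d.support, ‖x i‖ ≤ B * ‖W‖ ∧ ‖W‖ ≤ B * ‖x i‖) →
      (∑ d ∈ SU, u d * ∏ i ∈ d.support, x i ^ d i) * (∑ d ∈ SP, p d * ∏ i ∈ d.support, x i ^ d i) =
        ∑ d ∈ SQ, q d * ∏ i ∈ d.support, x i ^ d i →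
      ‖∑ d ∈ SP, p d * ∏ i ∈ d.support, x i ^ d i‖ ≤ C * B ^ e := by
  classical
  set NU : ℝ := (SU.card : ℝ) with hNU
  set NP : ℝ := (SP.card : ℝ) with hNP
  set NQ : ℝ := (SQ.card : ℝ) with hNQ
  have hNP0 : 0 ≤ NP := Nat.cast_nonneg _
  have hNQ0 : 0 ≤ NQ := Nat.cast_nonneg _
  have hNU1 : 1 ≤ NU := by
    rw [hNU]; exact_mod_cast Finset.card_pos.2 ⟨d₀, hd₀⟩
  refine ⟨NP * (2 * NU) ^ D + 2 * NQ + 1, (1 + (2 * n + 3) * D) + (2 * n + 2), ?_, ?_⟩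
  · have : 0 ≤ NP * (2 * NU) ^ D := by positivity
    linarith
  intro u p q x W B hW hB hu hp hq hu0 hx heq
  have hB0 : 0 < B := one_pos.trans_le hB
  have hWpos : 0 < ‖W‖ := norm_pos_iff.2 hW
  have hmon : ∀ d, d ∈ SU ∨ d ∈ SP ∨ d ∈ SQ →
      ‖∏ i ∈ d.support, x i ^ d i‖ ≤ (B * ‖W‖) ^ d.degree := by
    intro d hd
    rw [norm_prod, Finsupp.degree_apply, ← Finset.prod_pow_eq_pow_sum]
    refine Finset.prod_le_prod (fun _ _ => norm_nonneg _) fun i hi => ?_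
    rw [norm_pow]
    exact pow_le_pow_left₀ (norm_nonneg _) (hx d hd i hi).1 _
  have hmon' : ‖W‖ ^ n ≤ B ^ n * ‖∏ i ∈ d₀.support, x i ^ d₀ i‖ := by
    rw [norm_prod, ← hd₀n, Finsupp.degree_apply, ← Finset.prod_pow_eq_pow_sum,
      ← Finset.prod_pow_eq_pow_sum, ← Finset.prod_mul_distrib]
    refine Finset.prod_le_prod (fun _ _ => by positivity) fun i hi => ?_
    rw [norm_pow, ← mul_pow]
    exact pow_le_pow_left₀ (norm_nonneg _) (hx d₀ (Or.inl hd₀) i hi).2 _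
  set PP := ∑ d ∈ SP, p d * ∏ i ∈ d.support, x i ^ d i with hPP
  have hBe : ∀ k l : ℕ, B ^ k ≤ B ^ (k + l) := fun k l =>
    pow_le_pow_right₀ hB (Nat.le_add_right _ _)
  -- The threshold beyond which the leading term of U is at least twice the sum of the others. Below
  -- it P is estimated term by term.
  set τ := 2 * NU * B ^ (2 * n + 2) with hτ
  have hτ1 : 1 ≤ τ := by
    have := one_le_pow₀ hB (n := 2 * n + 2)
    rw [hτ]; nlinarith
  rcases le_or_gt ‖W‖ τ with hle | hgt
  · have h1 : ‖PP‖ ≤ NP * (B * (B * τ) ^ D) := by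
      refine (norm_sum_le _ _).trans ?_
      rw [hNP, ← nsmul_eq_mul]
      refine Finset.sum_le_card_nsmul _ _ _ fun d hd => ?_
      rw [norm_mul]
      refine mul_le_mul (hp d hd) ?_ (norm_nonneg _) hB0.le
      refine (hmon d (Or.inr (Or.inl hd))).trans ?_
      refine (pow_le_pow_left₀ (by positivity) (mul_le_mul_of_nonneg_left hle hB0.le) _).trans ?_
      exact pow_le_pow_right₀ (one_le_mul_of_one_le_of_one_le hB hτ1) (hP d hd)
    have h2 : NP * (B * (B * τ) ^ D) = NP * (2 * NU) ^ D * B ^ (1 + (2 * n + 3) * D) := by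
      have : B * τ = 2 * NU * B ^ (2 * n + 3) := by rw [hτ]; ring
      rw [this, mul_pow, ← pow_mul, pow_add, pow_one]
      ring
    rw [h2] at h1
    refine h1.trans ?_
    refine mul_le_mul ?_ (hBe _ _) (by positivity) (by positivity)
    linarith
  · have hW1 : 1 ≤ ‖W‖ := hτ1.trans hgt.le
    -- lower bound for the leading factor
    have h1 : ‖W‖ ^ n ≤ 2 * B ^ (n + 1) * ‖∑ d ∈ SU, u d * ∏ i ∈ d.support, x i ^ d i‖ := by
      rw [← Finset.add_sum_erase SU _ hd₀]
      set lead := u d₀ * ∏ i ∈ d₀.support, x i ^ d₀ i with hlead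
      set rest := ∑ d ∈ SU.erase d₀, u d * ∏ i ∈ d.support, x i ^ d i with hrest
      have l1 : ‖W‖ ^ n ≤ B ^ (n + 1) * ‖lead‖ := by
        rw [hlead, norm_mul]
        calc ‖W‖ ^ n ≤ B ^ n * ‖∏ i ∈ d₀.support, x i ^ d₀ i‖ := hmon'
          _ ≤ B ^ n * ‖∏ i ∈ d₀.support, x i ^ d₀ i‖ * (B * ‖u d₀‖) :=
              le_mul_of_one_le_right (by positivity) hu0
          _ = _ := by ring
      -- Multiplying by |W| instead of using the exponent n - 1 avoids truncated subtraction and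
      -- covers n = 0.
      have l2 : ‖rest‖ * ‖W‖ ≤ NU * (B * (B * ‖W‖) ^ n) := by
        have l3 : ‖rest‖ * ‖W‖ ≤ ((SU.erase d₀).card : ℝ) * (B * (B * ‖W‖) ^ n) := by
          refine (mul_le_mul_of_nonneg_right (norm_sum_le _ _) hWpos.le).trans ?_
          rw [Finset.sum_mul, ← nsmul_eq_mul]
          refine Finset.sum_le_card_nsmul _ _ _ fun d hd => ?_
          obtain ⟨hne, hdU⟩ := Finset.mem_erase.1 hd
          rw [norm_mul, mul_assoc]
          refine mul_le_mul (hu d hdU) ?_ (by positivity) hB0.le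
          have hBW : 1 ≤ B * ‖W‖ := one_le_mul_of_one_le_of_one_le hB hW1
          calc ‖∏ i ∈ d.support, x i ^ d i‖ * ‖W‖ ≤ (B * ‖W‖) ^ d.degree * (B * ‖W‖) := by
                refine mul_le_mul (hmon d (Or.inl hdU)) ?_ hWpos.le (by positivity)
                exact le_mul_of_one_le_left hWpos.le hB
            _ = (B * ‖W‖) ^ (d.degree + 1) := (pow_succ _ _).symm
            _ ≤ (B * ‖W‖) ^ n := pow_le_pow_right₀ hBW (hU d hdU hne)
        refine l3.trans (mul_le_mul_of_nonneg_right ?_ (by positivity))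
        rw [hNU]
        exact_mod_cast Finset.card_le_card (Finset.erase_subset _ _)
      have l4 : 2 * B ^ (n + 1) * ‖rest‖ ≤ ‖W‖ ^ n := by
        refine le_of_mul_le_mul_right ?_ hWpos
        calc 2 * B ^ (n + 1) * ‖rest‖ * ‖W‖ = 2 * B ^ (n + 1) * (‖rest‖ * ‖W‖) := by ring
          _ ≤ 2 * B ^ (n + 1) * (NU * (B * (B * ‖W‖) ^ n)) :=
              mul_le_mul_of_nonneg_left l2 (by positivity)
          _ = ‖W‖ ^ n * (2 * NU * B ^ (2 * n + 2)) := by rw [mul_pow]; ring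
          _ ≤ ‖W‖ ^ n * ‖W‖ := mul_le_mul_of_nonneg_left hgt.le (by positivity)
      have l5 : ‖lead‖ ≤ ‖lead + rest‖ + ‖rest‖ := by
        have := norm_sub_le (lead + rest) rest
        rwa [add_sub_cancel_right] at this
      have l6 : B ^ (n + 1) * ‖lead‖ ≤ B ^ (n + 1) * (‖lead + rest‖ + ‖rest‖) :=
        mul_le_mul_of_nonneg_left l5 (by positivity)
      nlinarith
    have h2 : ‖∑ d ∈ SQ, q d * ∏ i ∈ d.support, x i ^ d i‖ ≤ NQ * (B * (B * ‖W‖) ^ n) := by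
      refine (norm_sum_le _ _).trans ?_
      rw [hNQ, ← nsmul_eq_mul]
      refine Finset.sum_le_card_nsmul _ _ _ fun d hd => ?_
      rw [norm_mul]
      refine mul_le_mul (hq d hd) ?_ (norm_nonneg _) hB0.le
      refine (hmon d (Or.inr (Or.inr hd))).trans ?_
      exact pow_le_pow_right₀ (one_le_mul_of_one_le_of_one_le hB hW1) (hQ d hd)
    rw [← heq, norm_mul] at h2
    have h3 : ‖PP‖ ≤ 2 * NQ * B ^ (2 * n + 2) := by
      refine le_of_mul_le_mul_left ?_ (pow_pos hWpos n)
      calc ‖W‖ ^ n * ‖PP‖ ≤ 2 * B ^ (n + 1) *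
            ‖∑ d ∈ SU, u d * ∏ i ∈ d.support, x i ^ d i‖ * ‖PP‖ :=
            mul_le_mul_of_nonneg_right h1 (norm_nonneg _)
        _ = 2 * B ^ (n + 1) * (‖∑ d ∈ SU, u d * ∏ i ∈ d.support, x i ^ d i‖ * ‖PP‖) := by ring
        _ ≤ 2 * B ^ (n + 1) * (NQ * (B * (B * ‖W‖) ^ n)) :=
            mul_le_mul_of_nonneg_left h2 (by positivity)
        _ = ‖W‖ ^ n * (2 * NQ * B ^ (2 * n + 2)) := by rw [mul_pow]; ring
    refine h3.trans ?_
    rw [add_comm (1 + (2 * n + 3) * D)]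
    refine mul_le_mul ?_ (hBe _ _) (by positivity) (by positivity)
    have : 0 ≤ NP * (2 * NU) ^ D := by positivity
    linarith

/-! ### Values of meromorphic functions and proximity of small functions. -/

section MeromorphicValues

variable {m : ℕ}

/-- The meromorphic function `f` has the value `v` at the point `z`, seen from a representation as
a quotient of entire functions whose denominator does not vanish at `z`. -/
def Mero.HasVal (f : Mero m) (z : CSpace m) (v : ℂ) : Prop :=
  ∃ g h : Entire m, f = algebraMap (Entire m) (Mero m) g / algebraMap (Entire m) (Mero m) h ∧
    h.1 z ≠ 0 ∧ v = g.1 z / h.1 z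

theorem Entire.algebraMap_ne_zero {h : Entire m} (hh : h ≠ 0) :
    algebraMap (Entire m) (Mero m) h ≠ 0 :=
  (map_ne_zero_iff _ (IsFractionRing.injective (Entire m) (Mero m))).2 hh

theorem Entire.ne_zero_of_apply {h : Entire m} {z : CSpace m} (hz : h.1 z ≠ 0) : h ≠ 0 := by
  rintro rfl
  exact hz rfl

namespace Mero.HasVal

variable {f f' : Mero m} {z : CSpace m} {v v' : ℂ}

theorem val_eq (hf : Mero.HasVal f z v) : Mero.val f z = v := by
  obtain ⟨g, h, hfgh, hz, rfl⟩ := hf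
  exact Mero.val_eq f g h hfgh z hz

theorem of_entire (g : Entire m) (z : CSpace m) :
    Mero.HasVal (algebraMap (Entire m) (Mero m) g) z (g.1 z) :=
  ⟨g, 1, by simp, one_ne_zero, (div_one _).symm⟩

theorem add (hf : Mero.HasVal f z v) (hf' : Mero.HasVal f' z v') :
    Mero.HasVal (f + f') z (v + v') := by
  obtain ⟨g, h, rfl, hz, rfl⟩ := hf
  obtain ⟨g', h', rfl, hz', rfl⟩ := hf'
  refine ⟨g * h' + h * g', h * h', ?_, mul_ne_zero hz hz', div_add_div _ _ hz hz'⟩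
  have hh : algebraMap (Entire m) (Mero m) h ≠ 0 :=
    Entire.algebraMap_ne_zero (Entire.ne_zero_of_apply hz)
  have hh' : algebraMap (Entire m) (Mero m) h' ≠ 0 :=
    Entire.algebraMap_ne_zero (Entire.ne_zero_of_apply hz')
  rw [div_add_div _ _ hh hh']
  simp only [map_add, map_mul]

theorem mul (hf : Mero.HasVal f z v) (hf' : Mero.HasVal f' z v') :
    Mero.HasVal (f * f') z (v * v') := by
  obtain ⟨g, h, rfl, hz, rfl⟩ := hf
  obtain ⟨g', h', rfl, hz', rfl⟩ := hf'
  refine ⟨g * g', h * h', ?_, mul_ne_zero hz hz', div_mul_div_comm _ _ _ _⟩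
  rw [div_mul_div_comm, map_mul, map_mul]

theorem one (z : CSpace m) : Mero.HasVal (1 : Mero m) z 1 := by
  simpa using Mero.HasVal.of_entire (1 : Entire m) z

theorem zero (z : CSpace m) : Mero.HasVal (0 : Mero m) z 0 := by
  simpa using Mero.HasVal.of_entire (0 : Entire m) z

theorem pow (hf : Mero.HasVal f z v) (k : ℕ) : Mero.HasVal (f ^ k) z (v ^ k) := by
  induction k with
  | zero => simpa using Mero.HasVal.one z
  | succ k ih => rw [pow_succ, pow_succ]; exact ih.mul hf

theorem sum {ι : Type*} (s : Finset ι) {F : ι → Mero m} {V : ι → ℂ}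
    (h : ∀ i ∈ s, Mero.HasVal (F i) z (V i)) :
    Mero.HasVal (∑ i ∈ s, F i) z (∑ i ∈ s, V i) := by
  classical
  induction s using Finset.induction_on with
  | empty => simpa using Mero.HasVal.zero z
  | insert a s ha ih =>
    rw [Finset.sum_insert ha, Finset.sum_insert ha]
    exact (h a (Finset.mem_insert_self a s)).add (ih fun i hi => h i (Finset.mem_insert_of_mem hi))

theorem prod {ι : Type*} (s : Finset ι) {F : ι → Mero m} {V : ι → ℂ}
    (h : ∀ i ∈ s, Mero.HasVal (F i) z (V i)) :
    Mero.HasVal (∏ i ∈ s, F i) z (∏ i ∈ s, V i) := by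
  classical
  induction s using Finset.induction_on with
  | empty => simpa using Mero.HasVal.one z
  | insert a s ha ih =>
    rw [Finset.prod_insert ha, Finset.prod_insert ha]
    exact (h a (Finset.mem_insert_self a s)).mul (ih fun i hi => h i (Finset.mem_insert_of_mem hi))

theorem shift {q : ℂˣ} (hf : Mero.HasVal f ((q : ℂ) • z) v) :
    Mero.HasVal (Mero.shift q f) z v := by
  obtain ⟨g, h, rfl, hz, rfl⟩ := hf
  refine ⟨Entire.dilate q g, Entire.dilate q h, ?_, hz, rfl⟩
  have key : ∀ k : Entire m, Mero.shift q (algebraMap (Entire m) (Mero m) k) =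
      algebraMap (Entire m) (Mero m) (Entire.dilate q k) := fun k =>
    IsLocalization.map_eq (nonZeroDivisors_le_comap_nonZeroDivisors_of_injective _
      (Entire.dilate_injective q)) k
  rw [map_div₀, key, key]

theorem subst {w : Mero m} (P : QDiffPoly m) {a : (ℂˣ →₀ ℕ) → ℂ} {x : ℂˣ → ℂ}
    (ha : ∀ d ∈ P.support, Mero.HasVal (P.coeff d) z (a d))
    (hx : ∀ d ∈ P.support, ∀ q ∈ d.support, Mero.HasVal (Mero.shift q w) z (x q)) :
    Mero.HasVal (P.subst w) z (∑ d ∈ P.support, a d * ∏ q ∈ d.support, x q ^ d q) := by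
  rw [QDiffPoly.subst, MvPolynomial.eval_eq]
  exact .sum _ fun d hd => (ha d hd).mul (.prod _ fun q hq => (hx d hd q hq).pow _)

end Mero.HasVal

theorem Mero.exists_eq_div (f : Mero m) : ∃ g h : Entire m, h ≠ 0 ∧
    f = algebraMap (Entire m) (Mero m) g / algebraMap (Entire m) (Mero m) h := by
  obtain ⟨g, h, hh, rfl⟩ := IsFractionRing.div_surjective (A := Entire m) f
  exact ⟨g, h, nonZeroDivisors.ne_zero hh, rfl⟩

variable [Nontrivial (CSpace m)]

/-- The default value 0 of `Mero.val` is not compatible with sums and products, but on each sphere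
it can occur only on a null set. Elsewhere `Mero.HasVal` transfers algebraic identities in the field
to values. -/
theorem Mero.ae_hasVal (f : Mero m) {r : ℝ} (hr : 0 < r) : ∀ᵐ ξ : USphere m ∂sphereMeasure m,
    Mero.HasVal f (r • (ξ : CSpace m)) (Mero.val f (r • (ξ : CSpace m))) := by
  obtain ⟨g, h, hh, hf⟩ := f.exists_eq_div
  filter_upwards [Entire.ae_sphere_ne_zero hh hr] with ξ hξ
  exact ⟨g, h, hf, hξ, Mero.val_eq f g h hf _ hξ⟩

theorem Mero.posLog_val_ae_eq {f : Mero m} {g h : Entire m} (hh : h ≠ 0)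
    (hf : f = algebraMap (Entire m) (Mero m) g / algebraMap (Entire m) (Mero m) h)
    {r : ℝ} (hr : 0 < r) :
    (fun ξ : USphere m => Real.posLog (‖g.1 (r • (ξ : CSpace m))‖ / ‖h.1 (r • (ξ : CSpace m))‖))
      =ᵐ[sphereMeasure m] fun ξ => Real.posLog ‖Mero.val f (r • (ξ : CSpace m))‖ := by
  filter_upwards [Entire.ae_sphere_ne_zero hh hr] with ξ hξ
  rw [Mero.val_eq f g h hf _ hξ, norm_div]

theorem Mero.integrable_posLog_val (f : Mero m) {r : ℝ} (hr : 0 < r) :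
    Integrable (fun ξ : USphere m => Real.posLog ‖Mero.val f (r • (ξ : CSpace m))‖)
      (sphereMeasure m) := by
  obtain ⟨g, h, hh, hf⟩ := f.exists_eq_div
  refine Integrable.congr ?_ (Mero.posLog_val_ae_eq hh hf hr)
  by_cases hg : g = 0
  · subst hg
    have : ∀ z : CSpace m, (0 : Entire m).1 z = 0 := fun _ => rfl
    simp [this]
  · exact (exists_sphereMean_posLog_le hg hh).1 r hr

/-- The proximity function of a nonzero small function, and of its reciprocal, is negligible. -/
theorem IsSmallFor.isLittleOLogDensityOne_proximity {a : Mero m} {T : ℝ → ℝ} (h : IsSmallFor a T)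
    (ha : a ≠ 0) (hT : Tendsto T atTop atTop) :
    IsLittleOLogDensityOne (proximity a) T ∧ IsLittleOLogDensityOne (proximity a⁻¹) T := by
  obtain ⟨a₀, a₁, hrep, hsmall⟩ := h
  have h₁ := hrep.den_ne_zero
  have h₀ : a₀ ≠ 0 := by
    rintro rfl
    exact ha (by rw [hrep.eq_div, map_zero, zero_div])
  obtain ⟨c, hc⟩ := exists_abs_characteristic_sub_le h₀ h₁
  -- Stated so as to serve both a = a₀/a₁ and its reciprocal a₁/a₀: `maxLogMean` is symmetric.
  have key : ∀ (b : Mero m) (g k : Entire m), k ≠ 0 →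
      b = algebraMap (Entire m) (Mero m) g / algebraMap (Entire m) (Mero m) k → ∀ c' : ℝ,
      (∀ r : ℝ, 1 ≤ r → sphereMean (fun z : CSpace m => Real.posLog (‖g.1 z‖ / ‖k.1 z‖)) r ≤
        maxLogMean a₀ a₁ r + c') → IsLittleOLogDensityOne (proximity b) T := by
    intro b g k hk hb c' hle
    refine (hsmall.add (isLittleOLogDensityOne_const hT (c + c'))).of_le
      (fun r _ => sphereMean_nonneg (fun _ => Real.posLog_nonneg) r) fun r hr => ?_
    have h1 : sphereMean (fun z : CSpace m => Real.posLog (‖g.1 z‖ / ‖k.1 z‖)) r = proximity b r :=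
      integral_congr_ae (Mero.posLog_val_ae_eq hk hb (one_pos.trans_le hr))
    rw [← h1]
    linarith [hle r hr, (abs_le.1 (hc r (one_pos.trans_le hr))).1]
  obtain ⟨c₁, hc₁⟩ := (exists_sphereMean_posLog_le h₀ h₁).2
  obtain ⟨c₂, hc₂⟩ := (exists_sphereMean_posLog_le h₁ h₀).2
  refine ⟨key a a₀ a₁ h₁ hrep.eq_div c₁ hc₁,
    key a⁻¹ a₁ a₀ h₀ (by rw [hrep.eq_div, inv_div]) c₂ fun r hr => ?_⟩
  have : maxLogMean a₁ a₀ r = maxLogMean a₀ a₁ r := by simp only [maxLogMean, max_comm]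
  exact this ▸ hc₂ r hr

end MeromorphicValues

/-! ### Consequences of nonconstancy and assembly of the proof. -/

/-- Excludes m = 0, where every meromorphic function is constant and the unit sphere is empty. -/
theorem nontrivial_of_ne_algebraMap {m : ℕ} {w : Mero m}
    (hw : ∀ c : ℂ, w ≠ algebraMap ℂ (Mero m) c) : Nontrivial (CSpace m) := by
  by_contra hn
  rw [not_nontrivial_iff_subsingleton] at hn
  have hconst : ∀ g : Entire m,
      algebraMap (Entire m) (Mero m) g = algebraMap ℂ (Mero m) (g.1 0) := by
    intro g
    rw [IsScalarTower.algebraMap_apply ℂ (Entire m) (Mero m)]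
    congr 1
    exact Subtype.ext (funext fun z => congrArg g.1 (Subsingleton.elim z 0))
  obtain ⟨g, h, -, hf⟩ := w.exists_eq_div
  exact hw (g.1 0 / h.1 0) (by rw [hf, hconst g, hconst h, map_div₀])

theorem IsReducedRep.add_smul_ne_zero {m : ℕ} {w : Mero m} {w₀ w₁ : Entire m}
    (hrep : IsReducedRep w w₀ w₁) (hw : ∀ c : ℂ, w ≠ algebraMap ℂ (Mero m) c) (c : ℂ) :
    w₀ + c • w₁ ≠ 0 := by
  intro h
  refine hw (-c) ?_
  have h' : w₀ = algebraMap ℂ (Entire m) (-c) * w₁ := by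
    rw [eq_neg_of_add_eq_zero_left h, ← Algebra.smul_def, ← neg_smul]
  rw [hrep.eq_div, div_eq_iff (Entire.algebraMap_ne_zero hrep.den_ne_zero), h', map_mul,
    ← IsScalarTower.algebraMap_apply ℂ (Entire m) (Mero m)]

theorem norm_le_exp_mul_of_abs_log_sub_le {x y : ℂ} {G : ℝ} (hx : x ≠ 0) (hy : y ≠ 0)
    (h : |Real.log ‖x‖ - Real.log ‖y‖| ≤ G) :
    ‖x‖ ≤ Real.exp G * ‖y‖ ∧ ‖y‖ ≤ Real.exp G * ‖x‖ := by
  have hx' := norm_pos_iff.2 hx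
  have hy' := norm_pos_iff.2 hy
  obtain ⟨h1, h2⟩ := abs_le.1 h
  constructor
  · rw [← Real.log_le_log_iff hx' (by positivity), Real.log_mul (Real.exp_ne_zero _) hy'.ne',
      Real.log_exp]
    linarith
  · rw [← Real.log_le_log_iff hy' (by positivity), Real.log_mul (Real.exp_ne_zero _) hx'.ne',
      Real.log_exp]
    linarith

theorem le_exp_posLog (x : ℝ) : x ≤ Real.exp (Real.posLog x) := by
  rcases le_or_gt x 0 with hx | hx
  · exact hx.trans (Real.exp_nonneg _)
  · rw [← Real.log_le_iff_le_exp hx]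
    exact le_max_right _ _

/-- The pointwise estimate for `log⁺ |P(z, w)|` on the sphere `‖z‖ = r`. -/
theorem exists_posLog_subst_le {m : ℕ} [Nontrivial (CSpace m)] {w : Mero m} {w₀ w₁ : Entire m}
    (h₀ : w₀ ≠ 0) (h₁ : w₁ ≠ 0)
    (hw : w = algebraMap (Entire m) (Mero m) w₀ / algebraMap (Entire m) (Mero m) w₁)
    {U P Q : QDiffPoly m} (heq : U.subst w * P.subst w = Q.subst w) {n : ℕ}
    (hUdeg : U.totalDegree = n) (hQdeg : Q.totalDegree ≤ n) {d₀ : ℂˣ →₀ ℕ} (hd₀ : d₀ ∈ U.support)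
    (hd₀n : d₀.degree = n) (huniq : ∀ d ∈ U.support, d.degree = n → d = d₀)
    {A : Finset (Mero m)} (hUA : ∀ d ∈ U.support, U.coeff d ∈ A)
    (hPA : ∀ d ∈ P.support, P.coeff d ∈ A) (hQA : ∀ d ∈ Q.support, Q.coeff d ∈ A)
    (hinv : (U.coeff d₀)⁻¹ ∈ A) {V : Finset ℂˣ}
    (hV : ∀ d, d ∈ U.support ∨ d ∈ P.support ∨ d ∈ Q.support → d.support ⊆ V) :
    ∃ c e : ℝ, ∀ r : ℝ, 0 < r → ∀ᵐ ξ : USphere m ∂sphereMeasure m,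
      Real.posLog ‖Mero.val (P.subst w) (r • (ξ : CSpace m))‖ ≤
        c + e * (∑ a ∈ A, Real.posLog ‖Mero.val a (r • (ξ : CSpace m))‖ +
          ∑ q ∈ V, absLogDilate w₀ w₁ q (r • (ξ : CSpace m))) := by
  have hdeg : ∀ {R : QDiffPoly m} {d : ℂˣ →₀ ℕ}, d ∈ R.support → d.degree ≤ R.totalDegree :=
    fun hd => MvPolynomial.le_totalDegree hd
  obtain ⟨C, e, hC, hest⟩ := exists_norm_eval_le U.support P.support Q.support n P.totalDegree d₀
    hd₀ hd₀n (fun d hd hne => lt_of_le_of_ne (hUdeg ▸ hdeg hd) fun h => hne (huniq d hd h))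
    (fun d hd => hdeg hd) (fun d hd => (hdeg hd).trans hQdeg)
  refine ⟨Real.log C, e, fun r hr => ?_⟩
  have hA : ∀ᵐ ξ : USphere m ∂sphereMeasure m, ∀ a ∈ A,
      Mero.HasVal a (r • (ξ : CSpace m)) (Mero.val a (r • (ξ : CSpace m))) :=
    (ae_ball_iff A.countable_toSet).2 fun a _ => a.ae_hasVal hr
  have hdil : ∀ g : Entire m, g ≠ 0 → ∀ᵐ ξ : USphere m ∂sphereMeasure m, ∀ q ∈ V,
      g.1 ((q : ℂ) • r • (ξ : CSpace m)) ≠ 0 := fun g hg =>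
    (ae_ball_iff V.countable_toSet).2 fun q _ => Entire.ae_sphere_ne_zero (dilate_ne_zero hg q) hr
  filter_upwards [hA, hdil w₀ h₀, hdil w₁ h₁, Entire.ae_sphere_ne_zero h₀ hr,
    Entire.ae_sphere_ne_zero h₁ hr] with ξ hA hV₀ hV₁ hz₀ hz₁
  set z : CSpace m := r • (ξ : CSpace m) with hz
  have hS₁ : ∀ a ∈ A, 0 ≤ Real.posLog ‖Mero.val a z‖ := fun _ _ => Real.posLog_nonneg
  have hS₂ : ∀ q ∈ V, 0 ≤ absLogDilate w₀ w₁ q z := fun _ _ => abs_nonneg _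
  -- B = exp G serves as the common bound in `exists_norm_eval_le`: every summand of G is
  -- nonnegative, so G dominates each of them.
  set G := ∑ a ∈ A, Real.posLog ‖Mero.val a z‖ + ∑ q ∈ V, absLogDilate w₀ w₁ q z with hG
  have hG0 : 0 ≤ G := add_nonneg (Finset.sum_nonneg hS₁) (Finset.sum_nonneg hS₂)
  have hAG : ∀ a ∈ A, ‖Mero.val a z‖ ≤ Real.exp G := fun a ha =>
    (le_exp_posLog _).trans (Real.exp_le_exp.2 ((Finset.single_le_sum hS₁ ha).trans
      (le_add_of_nonneg_right (Finset.sum_nonneg hS₂))))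
  set x : ℂˣ → ℂ := fun q => w₀.1 ((q : ℂ) • z) / w₁.1 ((q : ℂ) • z) with hx
  have hxval : ∀ q ∈ V, Mero.HasVal (Mero.shift q w) z (x q) := fun q hq =>
    Mero.HasVal.shift ⟨w₀, w₁, hw, hV₁ q hq, rfl⟩
  have hsub : ∀ R : QDiffPoly m, (∀ d ∈ R.support, d ∈ U.support ∨ d ∈ P.support ∨ d ∈ Q.support) →
      (∀ d ∈ R.support, R.coeff d ∈ A) → Mero.HasVal (R.subst w) z
        (∑ d ∈ R.support, Mero.val (R.coeff d) z * ∏ q ∈ d.support, x q ^ d q) :=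
    fun R h1 h2 => Mero.HasVal.subst R (fun d hd => hA _ (h2 d hd))
      fun d hd q hq => hxval q (hV d (h1 d hd) hq)
  have hPval := hsub P (fun _ h => Or.inr (Or.inl h)) hPA
  -- The reciprocal of the leading coefficient belongs to A, and its bound exp G gives the required
  -- lower bound for that coefficient.
  have hinvval : Mero.val (U.coeff d₀)⁻¹ z * Mero.val (U.coeff d₀) z = 1 := by
    have h1 := (hA _ hinv).mul (hA _ (hUA d₀ hd₀))
    rw [inv_mul_cancel₀ (MvPolynomial.mem_support_iff.1 hd₀)] at h1
    exact h1.val_eq.symm.trans (Mero.HasVal.one z).val_eq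
  have hbound := hest (fun d => Mero.val (U.coeff d) z) (fun d => Mero.val (P.coeff d) z)
    (fun d => Mero.val (Q.coeff d) z) x (w₀.1 z / w₁.1 z) (Real.exp G) (div_ne_zero hz₀ hz₁)
    (Real.one_le_exp hG0) (fun d hd => hAG _ (hUA d hd)) (fun d hd => hAG _ (hPA d hd))
    (fun d hd => hAG _ (hQA d hd))
    (by
      calc (1 : ℝ) = ‖Mero.val (U.coeff d₀)⁻¹ z‖ * ‖Mero.val (U.coeff d₀) z‖ := by
            rw [← norm_mul, hinvval, norm_one]
        _ ≤ _ := mul_le_mul_of_nonneg_right (hAG _ hinv) (norm_nonneg _))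
    (by
      intro d hd q hq
      have hqV := hV d hd hq
      refine norm_le_exp_mul_of_abs_log_sub_le (div_ne_zero (hV₀ q hqV) (hV₁ q hqV))
        (div_ne_zero hz₀ hz₁) ?_
      rw [norm_div, norm_div, Real.log_div (norm_ne_zero_iff.2 (hV₀ q hqV))
        (norm_ne_zero_iff.2 (hV₁ q hqV)), Real.log_div (norm_ne_zero_iff.2 hz₀)
        (norm_ne_zero_iff.2 hz₁)]
      exact (Finset.single_le_sum hS₂ hqV).trans
        (le_add_of_nonneg_left (Finset.sum_nonneg hS₁)))
    (by
      have h1 := (hsub U (fun _ h => Or.inl h) hUA).mul hPval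
      rw [heq] at h1
      exact h1.val_eq.symm.trans (hsub Q (fun _ h => Or.inr (Or.inr h)) hQA).val_eq)
  rw [hPval.val_eq]
  have hlogC : 0 ≤ Real.log C := Real.log_nonneg hC
  refine max_le (by positivity) ?_
  rcases (norm_nonneg (∑ d ∈ P.support, Mero.val (P.coeff d) z *
    ∏ q ∈ d.support, x q ^ d q)).eq_or_lt with h0 | hpos
  · rw [← h0, Real.log_zero]
    positivity
  · refine (Real.log_le_log hpos hbound).trans_eq ?_
    rw [Real.log_mul (by linarith) (pow_ne_zero _ (Real.exp_ne_zero _)), Real.log_pow, Real.log_exp]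

theorem mainTheorem10 (m : ℕ) (w : Mero m)
    (hw : ∀ c : ℂ, w ≠ algebraMap ℂ (Mero m) c)
    (w₀ w₁ : Entire m) (hrep : IsReducedRep w w₀ w₁)
    (horder : growthOrder (characteristic w₀ w₁) = 0)
    (U P Q : QDiffPoly m)
    (hUsmall : ∀ d, IsSmallFor (U.coeff d) (characteristic w₀ w₁))
    (hPsmall : ∀ d, IsSmallFor (P.coeff d) (characteristic w₀ w₁))
    (hQsmall : ∀ d, IsSmallFor (Q.coeff d) (characteristic w₀ w₁))
    (heq : U.subst w * P.subst w = Q.subst w)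
    (n : ℕ) (hUdeg : U.totalDegree = n) (hQdeg : Q.totalDegree ≤ n)
    (hUtop : ∃! d, d ∈ U.support ∧ d.degree = n) :
    (∀ r : ℝ, 0 < r → Integrable
      (fun ξ : Metric.sphere (0 : CSpace m) 1 =>
        Real.posLog ‖Mero.val (P.subst w) (r • (ξ : CSpace m))‖) (sphereMeasure m)) ∧
    IsLittleOLogDensityOne (proximity (P.subst w)) (characteristic w₀ w₁) := by
  classical
  have : Nontrivial (CSpace m) := nontrivial_of_ne_algebraMap hw
  refine ⟨fun r hr => Mero.integrable_posLog_val _ hr, ?_⟩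
  have h₁ := hrep.den_ne_zero
  have hne := hrep.add_smul_ne_zero hw
  have h₀ : w₀ ≠ 0 := by simpa using hne 0
  have hT := tendsto_characteristic h₀ h₁ hne
  obtain ⟨d₀, ⟨hd₀, hd₀n⟩, huniq⟩ := hUtop
  set A : Finset (Mero m) := insert (U.coeff d₀)⁻¹ (U.support.image (fun d => U.coeff d) ∪
    (P.support.image (fun d => P.coeff d) ∪ Q.support.image (fun d => Q.coeff d))) with hA
  set V : Finset ℂˣ := (U.support ∪ (P.support ∪ Q.support)).biUnion Finsupp.support with hV
  have hsmallA : ∀ a ∈ A, IsLittleOLogDensityOne (proximity a) (characteristic w₀ w₁) := by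
    have key : ∀ R : QDiffPoly m, (∀ d, IsSmallFor (R.coeff d) (characteristic w₀ w₁)) →
        ∀ d ∈ R.support, IsLittleOLogDensityOne (proximity (R.coeff d)) (characteristic w₀ w₁) ∧
          IsLittleOLogDensityOne (proximity (R.coeff d)⁻¹) (characteristic w₀ w₁) :=
      fun R hR d hd =>
        (hR d).isLittleOLogDensityOne_proximity (MvPolynomial.mem_support_iff.1 hd) hT
    intro a ha
    simp only [hA, Finset.mem_insert, Finset.mem_union, Finset.mem_image] at ha
    rcases ha with rfl | ⟨d, hd, rfl⟩ | ⟨d, hd, rfl⟩ | ⟨d, hd, rfl⟩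
    · exact (key U hUsmall d₀ hd₀).2
    · exact (key U hUsmall d hd).1
    · exact (key P hPsmall d hd).1
    · exact (key Q hQsmall d hd).1
  obtain ⟨c, e, hce⟩ := exists_posLog_subst_le h₀ h₁ hrep.eq_div heq hUdeg hQdeg hd₀ hd₀n
    (fun d hd hdn => huniq d ⟨hd, hdn⟩) (A := A) (V := V)
    (fun d hd => Finset.mem_insert_of_mem
      (Finset.mem_union_left _ (Finset.mem_image_of_mem (fun d => U.coeff d) hd)))
    (fun d hd => Finset.mem_insert_of_mem (Finset.mem_union_right _
      (Finset.mem_union_left _ (Finset.mem_image_of_mem (fun d => P.coeff d) hd))))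
    (fun d hd => Finset.mem_insert_of_mem (Finset.mem_union_right _
      (Finset.mem_union_right _ (Finset.mem_image_of_mem (fun d => Q.coeff d) hd))))
    (Finset.mem_insert_self _ _)
    (fun d hd => Finset.subset_biUnion_of_mem Finsupp.support
      (by simpa only [Finset.mem_union] using hd))
  -- The constant is o(T) as T tends to infinity, the elements of A by smallness, and the shifts by
  -- the q-difference lemma. Integrating the pointwise estimate bounds the proximity function by
  -- this sum.
  refine ((isLittleOLogDensityOne_const hT c).add
    (((isLittleOLogDensityOne_sum A hsmallA).add (isLittleOLogDensityOne_sum V fun q _ =>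
      isLittleOLogDensityOne_absLogDilate h₀ h₁ hne horder q)).const_mul e)).of_le
    (fun r _ => sphereMean_nonneg (fun _ => Real.posLog_nonneg) r) fun r hr => ?_
  have hr0 : 0 < r := one_pos.trans_le hr
  have i₁ : Integrable (fun ξ : USphere m => ∑ a ∈ A, Real.posLog
      ‖Mero.val a (r • (ξ : CSpace m))‖) (sphereMeasure m) :=
    integrable_finsetSum A fun a _ => a.integrable_posLog_val hr0
  have i₂ : Integrable (fun ξ : USphere m => ∑ q ∈ V,
      absLogDilate w₀ w₁ q (r • (ξ : CSpace m))) (sphereMeasure m) :=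
    integrable_finsetSum V fun q _ => integrable_absLogDilate h₀ h₁ q hr0
  have i₃ : Integrable (fun ξ : USphere m => e * (∑ a ∈ A, Real.posLog
      ‖Mero.val a (r • (ξ : CSpace m))‖ + ∑ q ∈ V, absLogDilate w₀ w₁ q (r • (ξ : CSpace m))))
      (sphereMeasure m) := (i₁.add i₂).const_mul e
  refine (integral_mono_ae (Mero.integrable_posLog_val _ hr0) ((integrable_const c).add i₃)
    (hce r hr0)).trans_eq ?_
  simp only [Pi.add_apply]
  rw [integral_add (integrable_const c) i₃, integral_const_mul, integral_add i₁ i₂,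
    integral_finsetSum A fun a _ => a.integrable_posLog_val hr0,
    integral_finsetSum V fun q _ => integrable_absLogDilate h₀ h₁ q hr0]
  simp [proximity, sphereMean]
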